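/- **Conventions.** Let $S_1,\dots,S_k$ be finite sets of points in $\mathbb{Q}^d$ (the colors). A *colorful set* $T$ selects at most one point from each $S_i$; points are regarded together with their color, so that a point lying in two of the sets may be selected once for each of them. A set of points is *positively dependent* if it is nonempty and contains $0$ in its convex hull. * *Colorful Linear Programming* (decision version): given $d$, $k$ and $S_1,\dots,S_k\subset\mathbb{Q}^d$, decide whether there is a positively dependent colorful set. * *Colorful Linear Programming* (TFNP version): given $d+1$ positively dependent sets $S_1,\dots,S_{d+1}\subset\mathbb{Q}^d$, find a positively dependent colorful set. * *Finding Another Colorful Simplex*: given $d+1$ pairs of (distinct) points $S_1,\dots,S_{d+1}$ in $\mathbb{Q}^d$ and a positively dependent colorful set $T$, find a positively dependent colorful set different from $T$. * *Bimatrix*: given rational $m\times n$ matrices $A,B$ with $m,n\ge 1$, find a Nash equilibrium with rational coefficients, i.e. rational probability vectors $y\in\Delta^m$, $z\in\Delta^n$ with $y'^{T}Az\le y^{T}Az$ for all $y'\in\Delta^m$ and $y^{T}Bz'\le y^{T}Bz$ for all $z'\in\Delta^n$. Instances are encoded with integers in binary and rationals as reduced fractions; running times are measured in a logarithmic-cost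 model of computation with an oracle (polynomially equivalent to oracle Turing machines), as a function of the bit size of the instance. A search problem *reduces polynomially* to a decision problem if there is one program that, with any correct solver of the decision problem as its oracle, finds a solution of every instance in time bounded by one polynomial in the bit size of the instance. **Statement.** Let $\mathcal A$ be any algorithm solving the decision version of Colorful Linear Programming. 1. Given an instance $S_1,\dots,S_{d+1}$, $T$ of Finding Another Colorful Simplex, perform for $i=1,\dots,d+1$ in turn the following iteration: let $S_i':=S_i\setminus T$, where $T$ stands for its point of color $i$ (if $T$ has no point of color $i$, let $S_i'$ consist of the first point of the pair only); apply $\mathcal A$ to $S_1',\dots,S_i',S_{i+1},\dots,S_{d+1}$; if the answer is "no", replace $S_i'$ by the remaining point of $S_i$. Then $S_1'\cup\dots\cup S_{d+1}'$ is a positively dependent colorful set different from $T$, and $\mathcal A$ has been called exactly $d+1$ times. Moreover, one program performs this procedure, with exactly these calls of $\mathcal A$ as its oracle, on all instances and in polynomial time. 2. Bimatrix reduces polynomially to the decision version of Colorful Linear Programming. 3. The TFNP version of Colorful Linear Programming reduces polynomially to the decision version of Colorful Linear Programming. -/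

import Mathlib

namespace ColorfulLP

/-! ## Data, programs with an oracle, and their logarithmic cost -/

/-- The values on which programs operate: finite binary trees with integer leaves. -/
inductive Data where
  | num (z : ℤ) : Data
  | node (a b : Data) : Data
  deriving DecidableEq

namespace Data

/-- Bit size: an integer counts for the length of its binary expansion. -/
def size : Data → ℕ
  | num z => 1 + Nat.size z.natAbs
  | node a b => 1 + a.size + b.size

/-- Truth values are the integers `1` and `0`. -/
def ofBool (b : Bool) : Data := num (if b then 1 else 0)

/-- A function of two integers, applied to a pair of leaves (and `0` on all other values). -/
def arith (f : ℤ → ℤ → ℤ) : Data → Data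
  | node (num a) (num b) => num (f a b)
  | _ => num 0

end Data

/-- The elementary operations. -/
inductive Prim where
  | ident : Prim
  | const (z : ℤ) : Prim
  | fst : Prim
  | snd : Prim
  | isLeaf : Prim
  | eq : Prim
  | lt : Prim
  | add : Prim
  | sub : Prim
  | mul : Prim
  | div : Prim
  | mod : Prim

/-- The effect of the elementary operations; `eq` compares the two halves of a pair. -/
def Prim.eval : Prim → Data → Data
  | ident, x => x
  | const z, _ => .num z
  | fst, .node a _ => a
  | fst, .num _ => .num 0
  | snd, .node _ b => b
  | snd, .num _ => .num 0
  | isLeaf, .num _ => .num 1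
  | isLeaf, .node _ _ => .num 0
  | eq, .node a b => .ofBool (decide (a = b))
  | eq, .num _ => .num 0
  | lt, x => Data.arith (fun a b => if a < b then 1 else 0) x
  | add, x => Data.arith (fun a b => a + b) x
  | sub, x => Data.arith (fun a b => a - b) x
  | mul, x => Data.arith (fun a b => a * b) x
  | div, x => Data.arith (fun a b => a / b) x
  | mod, x => Data.arith (fun a b => a % b) x

/-- Programs: elementary operations, a call of the oracle, pairing of two results, sequential
composition (first `f`, then `g`), a test `branch c f g` (if `c` then `f` else `g`), and
`loop c f` (while `c` do `f`). -/
inductive Code where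
  | prim (p : Prim) : Code
  | query : Code
  | pair (f g : Code) : Code
  | seq (f g : Code) : Code
  | branch (c f g : Code) : Code
  | loop (c f : Code) : Code

/-- `Runs O c x y t qs`: with the oracle `O`, the program `c` halts on the input `x` with the
output `y`, its running time is `t`, and `qs` is the list of the questions that it has put to the
oracle, in order.  Every instruction that is executed, including a call of the oracle, is charged
one unit plus the bit size of the value it reads, and elementary operations and calls of the oracle
are charged the bit size of the value they produce as well (logarithmic cost).  So `t` dominates
the bit size of everything that the program handles, and polynomial time in this model is
polynomial time on an oracle Turing machine. -/
inductive Runs (O : Data → Bool) : Code → Data → Data → ℕ → List Data → Prop where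
  | prim (p : Prim) (x : Data) :
      Runs O (.prim p) x (p.eval x) (1 + x.size + (p.eval x).size) []
  | query (x : Data) :
      Runs O .query x (.ofBool (O x)) (1 + x.size + (Data.ofBool (O x)).size) [x]
  | pair {f g : Code} {x a b : Data} {s t : ℕ} {qs rs : List Data} :
      Runs O f x a s qs → Runs O g x b t rs →
      Runs O (.pair f g) x (.node a b) (1 + x.size + s + t) (qs ++ rs)
  | seq {f g : Code} {x y z : Data} {s t : ℕ} {qs rs : List Data} :
      Runs O f x y s qs → Runs O g y z t rs →
      Runs O (.seq f g) x z (1 + x.size + s + t) (qs ++ rs)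
  | branch_true {c f g : Code} {x b y : Data} {s t : ℕ} {qs rs : List Data} :
      Runs O c x b s qs → b ≠ .num 0 → Runs O f x y t rs →
      Runs O (.branch c f g) x y (1 + x.size + s + t) (qs ++ rs)
  | branch_false {c f g : Code} {x y : Data} {s t : ℕ} {qs rs : List Data} :
      Runs O c x (.num 0) s qs → Runs O g x y t rs →
      Runs O (.branch c f g) x y (1 + x.size + s + t) (qs ++ rs)
  | loop_stop {c f : Code} {x : Data} {s : ℕ} {qs : List Data} :
      Runs O c x (.num 0) s qs →
      Runs O (.loop c f) x x (1 + x.size + s) qs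
  | loop_step {c f : Code} {x b y z : Data} {s t u : ℕ} {qs rs ps : List Data} :
      Runs O c x b s qs → b ≠ .num 0 → Runs O f x y t rs → Runs O (.loop c f) y z u ps →
      Runs O (.loop c f) x z (1 + x.size + s + t + u) (qs ++ rs ++ ps)

/-! ## Decision problems, search problems, polynomial reductions -/

/-- A decision problem with the encoding of its instances. -/
structure DecisionProblem where
  Inst : Type
  enc : Inst → Data
  Yes : Inst → Prop

/-- A search problem with the encodings of its instances and of the candidate solutions. -/
structure SearchProblem where
  Inst : Type
  enc : Inst → Data
  Sol : Inst → Type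
  encSol : (I : Inst) → Sol I → Data
  IsSol : (I : Inst) → Sol I → Prop

/-- `O` solves the decision problem `D`: it answers every instance correctly (and anything at all
on data that encode no instance). -/
def Decides (O : Data → Bool) (D : DecisionProblem) : Prop :=
  ∀ I : D.Inst, O (D.enc I) = true ↔ D.Yes I

/-- Polynomial (Turing) reduction of a search problem to a decision problem: one program which,
with any solver of `D` as its oracle, finds a solution of every instance of `P`, in time bounded by
one polynomial in the bit size of the instance. -/
def PolyReducible (P : SearchProblem) (D : DecisionProblem) : Prop :=
  ∃ (c : Code) (p : Polynomial ℕ), ∀ O : Data → Bool, Decides O D → ∀ I : P.Inst,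
    ∃ (s : P.Sol I) (t : ℕ) (qs : List Data),
      Runs O c (P.enc I) (P.encSol I s) t qs ∧ P.IsSol I s ∧ t ≤ p.eval (P.enc I).size

/-! ## Encodings -/

/-- A rational number, as its reduced fraction. -/
def encRat (q : ℚ) : Data := .node (.num q.num) (.num (q.den : ℤ))

/-- A list, given the encoding of its members. -/
def encList {α : Type} (e : α → Data) : List α → Data
  | [] => .num 0
  | a :: l => .node (e a) (encList e l)

/-- A vector of `ℚⁿ`, or any family indexed by `1, …, n`. -/
def encFamily {α : Type} (e : α → Data) {n : ℕ} (v : Fin n → α) : Data := encList e (List.ofFn v)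

def encOption {α : Type} (e : α → Data) : Option α → Data
  | none => .num 0
  | some a => .node (.num 1) (e a)

/-! ## Colorful sets -/

/-- Points of `ℚᵈ`. -/
abbrev Point (d : ℕ) : Type := Fin d → ℚ

/-- A point of `ℚᵈ` as a point of `ℝᵈ`. -/
def toReal {d : ℕ} (x : Point d) : Fin d → ℝ := fun i => (x i : ℝ)

def encPoint {d : ℕ} (x : Point d) : Data := encFamily encRat x

/-- Nonempty, with the origin in the convex hull. -/
def PositivelyDependent {d : ℕ} (X : Set (Point d)) : Prop :=
  X.Nonempty ∧ (0 : Fin d → ℝ) ∈ convexHull ℝ (toReal '' X)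

/-- A configuration of `k` finite sets of points in `ℚᵈ`, each given by a list of its points. -/
abbrev Config (d k : ℕ) : Type := Fin k → List (Point d)

/-- A selection of at most one point for each color: `T i` is the point of color `i`, if any.
Points carry their colors, so that a point lying in two of the sets may be taken twice. -/
abbrev Selection (d k : ℕ) : Type := Fin k → Option (Point d)

/-- The points of a selection. -/
def Selection.points {d k : ℕ} (T : Selection d k) : Set (Point d) := {x | ∃ i, T i = some x}

/-- `T` is a colorful set of the configuration `S`. -/
def IsColorful {d k : ℕ} (S : Config d k) (T : Selection d k) : Prop :=
  ∀ i x, T i = some x → x ∈ S i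

/-- `T` is a positively dependent colorful set of the configuration `S`. -/
def IsPDCS {d k : ℕ} (S : Config d k) (T : Selection d k) : Prop :=
  IsColorful S T ∧ PositivelyDependent T.points

def encConfig {d k : ℕ} (S : Config d k) : Data :=
  .node (.num (d : ℤ)) (encFamily (encList encPoint) S)

def encSelection {d k : ℕ} (T : Selection d k) : Data := encFamily (encOption encPoint) T

/-! ## The problems -/

/-- Instances of Colorful Linear Programming. -/
structure CLPInstance where
  d : ℕ
  k : ℕ
  S : Config d k

/-- Colorful Linear Programming, decision version. -/
def colorfulLP : DecisionProblem where
  Inst := CLPInstance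
  enc I := encConfig I.S
  Yes I := ∃ T : Selection I.d I.k, IsPDCS I.S T

/-- Instances of the TFNP version: `d + 1` positively dependent sets in `ℚᵈ`. -/
structure TFNPInstance where
  d : ℕ
  S : Config d (d + 1)
  dependent : ∀ i, PositivelyDependent {x | x ∈ S i}

/-- Colorful Linear Programming, TFNP version. -/
def colorfulLPTFNP : SearchProblem where
  Inst := TFNPInstance
  enc I := encConfig I.S
  Sol I := Selection I.d (I.d + 1)
  encSol _ T := encSelection T
  IsSol I T := IsPDCS I.S T

/-- `(y, z)` is a Nash equilibrium of the game in which the payoffs are `A` for the first and `B`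
for the second player. -/
def IsNash {m n : ℕ} (A B : Matrix (Fin m) (Fin n) ℝ) (y : Fin m → ℝ) (z : Fin n → ℝ) : Prop :=
  y ∈ stdSimplex ℝ (Fin m) ∧ z ∈ stdSimplex ℝ (Fin n) ∧
    (∀ y' ∈ stdSimplex ℝ (Fin m), y' ⬝ᵥ A.mulVec z ≤ y ⬝ᵥ A.mulVec z) ∧
    (∀ z' ∈ stdSimplex ℝ (Fin n), y ⬝ᵥ B.mulVec z' ≤ y ⬝ᵥ B.mulVec z)

/-- Instances of Bimatrix. -/
structure BimatrixInstance where
  m : ℕ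
  n : ℕ
  m_pos : 0 < m
  n_pos : 0 < n
  A : Matrix (Fin m) (Fin n) ℚ
  B : Matrix (Fin m) (Fin n) ℚ

/-- A matrix, by rows. -/
def encMatrix {m n : ℕ} (A : Matrix (Fin m) (Fin n) ℚ) : Data :=
  encFamily (fun r : Fin n → ℚ => encFamily encRat r) (fun i => A i)

/-- Bimatrix: find a Nash equilibrium (with rational coefficients). -/
def bimatrix : SearchProblem where
  Inst := BimatrixInstance
  enc I := .node (.node (.num (I.m : ℤ)) (.num (I.n : ℤ))) (.node (encMatrix I.A) (encMatrix I.B))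
  Sol I := (Fin I.m → ℚ) × (Fin I.n → ℚ)
  encSol _ s := .node (encFamily encRat s.1) (encFamily encRat s.2)
  IsSol I s := IsNash (I.A.map (fun q : ℚ => (q : ℝ))) (I.B.map (fun q : ℚ => (q : ℝ)))
    (fun i => (s.1 i : ℝ)) (fun j => (s.2 j : ℝ))

/-- Instances of Finding Another Colorful Simplex: `d + 1` pairs of points in `ℚᵈ` and a positively
dependent colorful set `T`. -/
structure AnotherInstance where
  d : ℕ
  S : Fin (d + 1) → Point d × Point d
  distinct : ∀ i, (S i).1 ≠ (S i).2
  T : Selection d (d + 1)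
  isPDCS : IsPDCS (fun i => [(S i).1, (S i).2]) T

namespace AnotherInstance

/-- The pairs as a configuration. -/
def config (I : AnotherInstance) : Config I.d (I.d + 1) := fun i => [(I.S i).1, (I.S i).2]

def enc (I : AnotherInstance) : Data :=
  .node (.num (I.d : ℤ)) (.node
    (encFamily (fun s : Point I.d × Point I.d => .node (encPoint s.1) (encPoint s.2)) I.S)
    (encSelection I.T))

/-- The point of the `i`th pair that is tried first: the one outside `T` (the first point of the
pair, if both are outside `T`). -/
def preferred (I : AnotherInstance) (i : Fin (I.d + 1)) : Point I.d :=
  if I.T i = some (I.S i).1 then (I.S i).2 else (I.S i).1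

/-- The remaining point of the `i`th pair. -/
def fallback (I : AnotherInstance) (i : Fin (I.d + 1)) : Point I.d :=
  if I.T i = some (I.S i).1 then (I.S i).1 else (I.S i).2

/-- Iteration `i`, on the current configuration and the list of the questions asked so far: replace
the `i`th pair by its preferred point, ask `O` whether the new configuration has a positively
dependent colorful set, and if the answer is no, take the remaining point instead. -/
def step (I : AnotherInstance) (O : Data → Bool)
    (st : Config I.d (I.d + 1) × List Data) (i : Fin (I.d + 1)) :
    Config I.d (I.d + 1) × List Data :=
  let S' := Function.update st.1 i [I.preferred i]
  (if O (encConfig S') then S' else Function.update st.1 i [I.fallback i],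
    st.2 ++ [encConfig S'])

/-- All iterations, for the pairs in turn. -/
def run (I : AnotherInstance) (O : Data → Bool) : Config I.d (I.d + 1) × List Data :=
  (List.finRange (I.d + 1)).foldl (I.step O) (I.config, [])

/-- The points selected at the end. -/
def output (I : AnotherInstance) (O : Data → Bool) : Selection I.d (I.d + 1) :=
  fun i => ((I.run O).1 i).head?

/-- The questions asked to `O`, in order. -/
def queries (I : AnotherInstance) (O : Data → Bool) : List Data := (I.run O).2

end AnotherInstance

end ColorfulLP

/-! The geometric core is the octahedron lemma: among d + 1 pairs in ℚᵈ, a positively dependent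
selection of all colors is never the only one. Points are lifted to height 1 in dimension d + 1,
where convex hulls containing 0 become cones containing a fixed vector. If the coefficients of c₁,
…, cₙ are independent exponential variables, their combination has the characteristic function ∏ 1 /
(1 - iL(cⱼ)). The matrix with rows aⱼ / (1 - iL(aⱼ)) - bⱼ / (1 - iL(bⱼ)) annihilates the functional
h - iL, where h is the height; expanding its zero determinant in the rows shows that the laws of all
colorful cones, weighted by signed determinants, cancel (`signed_sum_coneLaw`). So no point of a
nondegenerate colorful cone is covered by this cone alone, and degenerate cones are settled by
dropping a vector (`exists_other_cone`). In part 1 this starts the invariant that a positively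
dependent selection other than T survives; each iteration preserves it (`hasOther_step`).

For part 2, a game with payoffs scaled to positive integers becomes a complementarity problem:
nonnegative weights on columns, with slack variables. Pairing each column with a unit vector and
projecting along the diagonal gives an instance of Finding Another Colorful Simplex, in which T is
the set of unit vectors; a second solution uses a column and its weights give an equilibrium
(`IsBalance.complementary`, `isNash_of_complementary`). The weights must be computed exactly.
Further calls of the oracle delete colors until the set is minimal; then the weights are unique up
to a factor (`IsBalance.unique_of_minimal`) and span the kernel of a symmetric integer matrix. The
last matrix of the Faddeev–LeVerrier recursion displays this kernel (`exists_rowSum_leVerrier`) with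
numbers of polynomial bit size.

For part 3, the colorful Carathéodory theorem gives a solution to begin with, and colors are shrunk
to single points as long as the oracle agrees.

Running times are handled by a calculus of polynomial time functions on encoded types, closed under
composition, tests and loops of controlled growth; `fun_prop` discharges its side conditions. -/

namespace ColorfulLP

set_option linter.unusedSectionVars false

/-! ## Encoded types -/

/-- Types whose members are encoded as data. -/
class HasEnc (α : Type) where
  enc : α → Data

/-- The encoding of a value. -/
abbrev enc {α : Type} [HasEnc α] (a : α) : Data := HasEnc.enc a

/-- The bit size of a value. -/
abbrev bits {α : Type} [HasEnc α] (a : α) : ℕ := (enc a).size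

instance : HasEnc Data := ⟨id⟩
instance : HasEnc ℤ := ⟨Data.num⟩
instance : HasEnc ℕ := ⟨fun n => Data.num n⟩
instance : HasEnc Bool := ⟨Data.ofBool⟩
instance : HasEnc ℚ := ⟨encRat⟩
instance {α β : Type} [HasEnc α] [HasEnc β] : HasEnc (α × β) := ⟨fun p => .node (enc p.1) (enc p.2)⟩
instance {α : Type} [HasEnc α] : HasEnc (List α) := ⟨encList enc⟩
instance {α : Type} [HasEnc α] : HasEnc (Option α) := ⟨encOption enc⟩

theorem Data.size_pos (x : Data) : 1 ≤ x.size := by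
  cases x <;> simp only [Data.size] <;> omega

section
variable {α β : Type} [HasEnc α] [HasEnc β]

theorem bits_pair (a : α) (b : β) : bits (a, b) = 1 + bits a + bits b := rfl
theorem bits_nil : bits ([] : List α) = 1 := rfl
theorem bits_cons (a : α) (l : List α) : bits (a :: l) = 1 + bits a + bits l := rfl
theorem enc_cons (a : α) (l : List α) : enc (a :: l) = .node (enc a) (enc l) := rfl
theorem bits_int (z : ℤ) : bits z = 1 + Nat.size z.natAbs := rfl
theorem bits_nat (n : ℕ) : bits n = 1 + Nat.size n := rfl
theorem one_le_bits (a : α) : 1 ≤ bits a := Data.size_pos _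
theorem bits_bool (b : Bool) : bits b ≤ 2 := by cases b <;> decide

theorem length_le_bits (l : List α) : l.length < bits l := by
  induction l with
  | nil => simp [bits_nil]
  | cons a l ih => rw [bits_cons, List.length_cons]; have := one_le_bits a; omega

theorem bits_le_of_mem {a : α} {l : List α} (h : a ∈ l) : bits a < bits l := by
  induction l with
  | nil => simp at h
  | cons b l ih =>
    rw [bits_cons]
    rcases List.mem_cons.1 h with rfl | h
    · have := one_le_bits l; omega
    · have := ih h; omega

theorem bits_append (l l' : List α) : bits (l ++ l') + 1 = bits l + bits l' := by
  induction l with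
  | nil => simp [bits_nil]; omega
  | cons a l ih => rw [List.cons_append, bits_cons, bits_cons]; omega

theorem bits_reverse (l : List α) : bits l.reverse = bits l := by
  induction l with
  | nil => rfl
  | cons a l ih =>
    have := bits_append l.reverse [a]
    rw [List.reverse_cons, bits_cons]
    rw [bits_cons, bits_nil, ih] at this
    omega

end

/-! ## Computations with the oracle in polynomial time -/

theorem Runs.size_le {O : Data → Bool} {c : Code} {x y : Data} {t : ℕ} {qs : List Data}
    (h : Runs O c x y t qs) : y.size ≤ t := by
  induction h <;> try simp only [Data.size] at *
  all_goals omega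

theorem eval_nat_mono (p : Polynomial ℕ) : Monotone fun n => p.eval n := by
  intro a b hab
  simp only [Polynomial.eval_eq_sum]
  simp only [Polynomial.sum]
  exact Finset.sum_le_sum fun i _ => Nat.mul_le_mul_left _ (Nat.pow_le_pow_left hab i)

/-- `f`, whose questions to the oracle are `q`, is computed by one program in polynomial time. -/
def PolyQ {α β : Type} [HasEnc α] [HasEnc β] (f : (Data → Bool) → α → β)
    (q : (Data → Bool) → α → List Data) : Prop :=
  ∃ (c : Code) (p : Polynomial ℕ), ∀ O a, ∃ t,
    Runs O c (enc a) (enc (f O a)) t (q O a) ∧ t ≤ p.eval (bits a)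

/-- `f` is computed in polynomial time, with the help of the oracle. -/
def PolyO {α β : Type} [HasEnc α] [HasEnc β] (f : (Data → Bool) → α → β) : Prop :=
  ∃ q, PolyQ f q

/-- `f` is computed in polynomial time, without calls of the oracle. -/
@[fun_prop]
def Poly {α β : Type} [HasEnc α] [HasEnc β] (f : α → β) : Prop :=
  PolyQ (fun _ => f) (fun _ _ => [])

section
variable {α β γ δ σ : Type} [HasEnc α] [HasEnc β] [HasEnc γ] [HasEnc δ] [HasEnc σ]

/-- The running time dominates the size of the output, so a time bound is also a size bound. This is
what makes polynomial bounds compose in `PolyQ.comp`. -/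
theorem PolyQ.bits_le {f : (Data → Bool) → α → β} {q : (Data → Bool) → α → List Data}
    (h : PolyQ f q) : ∃ p : Polynomial ℕ, ∀ O a, bits (f O a) ≤ p.eval (bits a) := by
  obtain ⟨c, p, h⟩ := h
  refine ⟨p, fun O a => ?_⟩
  obtain ⟨t, hr, ht⟩ := h O a
  exact hr.size_le.trans ht

theorem Poly.bits_le {f : α → β} (h : Poly f) :
    ∃ p : Polynomial ℕ, ∀ a, bits (f a) ≤ p.eval (bits a) := by
  obtain ⟨p, hp⟩ := PolyQ.bits_le h
  exact ⟨p, hp fun _ => true⟩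

theorem Poly.polyO {f : α → β} (h : Poly f) : PolyO fun _ => f := ⟨_, h⟩

/-- A program sees encodings only, so a function may be retyped along any map that preserves them:
the same program with the same questions still computes it. Cons cells are treated as pairs and
naturals as integers in this way. -/
theorem PolyQ.congr_enc {α' β' : Type} [HasEnc α'] [HasEnc β'] {f : (Data → Bool) → α → β}
    {q : (Data → Bool) → α → List Data} (h : PolyQ f q) (φ : α' → α)
    {f' : (Data → Bool) → α' → β'} (hφ : ∀ a, enc a = enc (φ a))
    (hf : ∀ O a, enc (f' O a) = enc (f O (φ a))) : PolyQ f' fun O a => q O (φ a) := by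
  obtain ⟨c, p, h⟩ := h
  refine ⟨c, p, fun O a => ?_⟩
  have := h O (φ a)
  simp only [bits, ← hφ, ← hf] at this
  exact this

theorem Poly.congr_enc {α' β' : Type} [HasEnc α'] [HasEnc β'] {f : α → β}
    (h : Poly f) (φ : α' → α) {f' : α' → β'} (hφ : ∀ a, enc a = enc (φ a))
    (hf : ∀ a, enc (f' a) = enc (f (φ a))) : Poly f' :=
  PolyQ.congr_enc h φ hφ fun _ => hf

theorem PolyQ.comp {g : (Data → Bool) → β → γ} {r : (Data → Bool) → β → List Data}
    {f : (Data → Bool) → α → β} {q : (Data → Bool) → α → List Data}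
    (hg : PolyQ g r) (hf : PolyQ f q) :
    PolyQ (fun O a => g O (f O a)) (fun O a => q O a ++ r O (f O a)) := by
  obtain ⟨m, hm⟩ := hf.bits_le
  obtain ⟨c, p, hf⟩ := hf
  obtain ⟨d, s, hg⟩ := hg
  refine ⟨.seq c d, 1 + Polynomial.X + p + s.comp m, fun O a => ?_⟩
  obtain ⟨t, h1, h2⟩ := hf O a
  obtain ⟨u, h3, h4⟩ := hg O (f O a)
  refine ⟨_, .seq h1 h3, ?_⟩
  have := eval_nat_mono s (hm O a)
  simp only [Polynomial.eval_add, Polynomial.eval_one, Polynomial.eval_X, Polynomial.eval_comp]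
  simp only [bits] at *
  omega

theorem PolyQ.pair {f : (Data → Bool) → α → β} {q : (Data → Bool) → α → List Data}
    {g : (Data → Bool) → α → γ} {r : (Data → Bool) → α → List Data}
    (hf : PolyQ f q) (hg : PolyQ g r) :
    PolyQ (fun O a => (f O a, g O a)) (fun O a => q O a ++ r O a) := by
  obtain ⟨c, p, hf⟩ := hf
  obtain ⟨d, s, hg⟩ := hg
  refine ⟨.pair c d, 1 + Polynomial.X + p + s, fun O a => ?_⟩
  obtain ⟨t, h1, h2⟩ := hf O a
  obtain ⟨u, h3, h4⟩ := hg O a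
  refine ⟨_, .pair h1 h3, ?_⟩
  simp only [Polynomial.eval_add, Polynomial.eval_one, Polynomial.eval_X]
  simp only [bits] at *
  omega

theorem enc_bool_true : enc true ≠ .num 0 := by simp [enc, HasEnc.enc, Data.ofBool]
theorem enc_bool_false : enc false = .num 0 := rfl

theorem PolyQ.ite {b : (Data → Bool) → α → Bool} {s : (Data → Bool) → α → List Data}
    {f : (Data → Bool) → α → β} {q : (Data → Bool) → α → List Data}
    {g : (Data → Bool) → α → β} {r : (Data → Bool) → α → List Data}
    (hb : PolyQ b s) (hf : PolyQ f q) (hg : PolyQ g r) :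
    PolyQ (fun O a => if b O a then f O a else g O a)
      (fun O a => s O a ++ if b O a then q O a else r O a) := by
  obtain ⟨c₀, p₀, hb⟩ := hb
  obtain ⟨c, p, hf⟩ := hf
  obtain ⟨d, m, hg⟩ := hg
  refine ⟨.branch c₀ c d, 1 + Polynomial.X + p₀ + p + m, fun O a => ?_⟩
  obtain ⟨t, h1, h2⟩ := hf O a
  obtain ⟨u, h3, h4⟩ := hg O a
  obtain ⟨v, h5, h6⟩ := hb O a
  simp only [Polynomial.eval_add, Polynomial.eval_one, Polynomial.eval_X]
  cases hba : b O a with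
  | true =>
    refine ⟨_, .branch_true h5 (by rw [hba]; exact enc_bool_true) h1, ?_⟩
    simp only [bits] at *
    omega
  | false =>
    refine ⟨_, .branch_false (by rw [hba, enc_bool_false] at h5; exact h5) h3, ?_⟩
    simp only [bits] at *
    omega

theorem PolyQ.query : PolyQ (fun O (x : Data) => O x) (fun _ x => [x]) := by
  refine ⟨.query, Polynomial.X + 3, fun O a => ⟨_, .query a, ?_⟩⟩
  have : (Data.ofBool (O a)).size ≤ 2 := bits_bool (O a)
  simp only [Polynomial.eval_add, Polynomial.eval_X, Polynomial.eval_ofNat]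
  have h : bits a = a.size := rfl
  omega

theorem PolyO.comp {g : (Data → Bool) → β → γ} {f : (Data → Bool) → α → β}
    (hg : PolyO g) (hf : PolyO f) : PolyO (fun O a => g O (f O a)) := by
  obtain ⟨q, hf⟩ := hf
  obtain ⟨r, hg⟩ := hg
  exact ⟨_, hg.comp hf⟩

theorem PolyO.pair {f : (Data → Bool) → α → β} {g : (Data → Bool) → α → γ}
    (hf : PolyO f) (hg : PolyO g) : PolyO (fun O a => (f O a, g O a)) := by
  obtain ⟨q, hf⟩ := hf
  obtain ⟨r, hg⟩ := hg
  exact ⟨_, hf.pair hg⟩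

theorem PolyO.ite {b : (Data → Bool) → α → Bool} {f g : (Data → Bool) → α → β}
    (hb : PolyO b) (hf : PolyO f) (hg : PolyO g) :
    PolyO (fun O a => if b O a then f O a else g O a) := by
  obtain ⟨q, hf⟩ := hf
  obtain ⟨r, hg⟩ := hg
  obtain ⟨s, hb⟩ := hb
  exact ⟨_, hb.ite hf hg⟩

theorem Poly.prim (p : Prim) (s : Polynomial ℕ) (f : α → β)
    (hf : ∀ a, enc (f a) = p.eval (enc a)) (hs : ∀ a, bits (f a) ≤ s.eval (bits a)) : Poly f := by
  refine ⟨.prim p, 1 + Polynomial.X + s,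
    fun O a => ⟨1 + (enc a).size + (p.eval (enc a)).size, ?_, ?_⟩⟩
  · show Runs O (.prim p) (enc a) (enc (f a)) _ []
    rw [hf]
    exact .prim p _
  · have := hs a
    simp only [bits, hf] at this
    simp only [Polynomial.eval_add, Polynomial.eval_one, Polynomial.eval_X, bits]
    omega

theorem Poly.of_enc_eq (f : α → β) (h : ∀ a, enc (f a) = enc a) : Poly f :=
  Poly.prim .ident Polynomial.X f (fun a => by rw [h]; rfl) (fun a => by simp [bits, h])

@[fun_prop]
theorem Poly.id : Poly (fun a : α => a) := Poly.of_enc_eq _ fun _ => rfl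

theorem Poly.comp {g : β → γ} {f : α → β} (hg : Poly g) (hf : Poly f) :
    Poly (fun a => g (f a)) := PolyQ.comp hg hf

@[fun_prop]
theorem Poly.comp' {g : β → γ} {f : α → β} (hg : Poly g) (hf : Poly f) :
    Poly (fun a => g (f a)) := PolyQ.comp hg hf

@[fun_prop]
theorem Poly.pair {f : α → β} {g : α → γ} (hf : Poly f) (hg : Poly g) :
    Poly (fun a => (f a, g a)) := PolyQ.pair hf hg

@[fun_prop]
theorem Poly.ite {b : α → Bool} {f g : α → β} (hb : Poly b) (hf : Poly f) (hg : Poly g) :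
    Poly (fun a => if b a then f a else g a) := by
  simpa [Poly] using PolyQ.ite hb hf hg

theorem Poly.const_data (d : Data) : Poly (fun _ : α => d) := by
  induction d with
  | num z =>
    refine Poly.prim (.const z) (Polynomial.C (Data.num z).size) _ (fun a => rfl) (fun a => ?_)
    simp only [Polynomial.eval_C]
    exact le_rfl
  | node a b iha ihb =>
    have := iha.pair ihb
    exact this.comp (Poly.id)

@[fun_prop]
theorem Poly.const (b : β) : Poly (fun _ : α => b) :=
  (Poly.const_data (α := α) (enc b)).congr_enc (fun a => a) (fun _ => rfl) fun _ => rfl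

theorem Poly.fst : Poly (fun p : α × β => p.1) :=
  Poly.prim .fst Polynomial.X _ (fun _ => rfl) (fun a => by
    obtain ⟨a, b⟩ := a
    simp only [Polynomial.eval_X, bits_pair]; omega)

theorem Poly.snd : Poly (fun p : α × β => p.2) :=
  Poly.prim .snd Polynomial.X _ (fun _ => rfl) (fun a => by
    obtain ⟨a, b⟩ := a
    simp only [Polynomial.eval_X, bits_pair]; omega)

@[fun_prop]
theorem Poly.fst' {f : α → β × γ} (h : Poly f) : Poly (fun a => (f a).1) := Poly.fst.comp h

@[fun_prop]
theorem Poly.snd' {f : α → β × γ} (h : Poly f) : Poly (fun a => (f a).2) := Poly.snd.comp h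

/-! ### Lists -/

@[fun_prop]
theorem Poly.cons {f : α → β} {g : α → List β} (hf : Poly f) (hg : Poly g) :
    Poly (fun a => f a :: g a) :=
  (hf.pair hg).congr_enc (fun a => a) (fun _ => rfl) fun _ => rfl

theorem Poly.isEmpty' : Poly (fun l : List α => l.isEmpty) :=
  Poly.prim .isLeaf 2 _ (fun l => by cases l <;> rfl) fun l => by
    simpa using bits_bool _

@[fun_prop]
theorem Poly.isEmpty {l : α → List β} (h : Poly l) : Poly (fun a => (l a).isEmpty) :=
  Poly.isEmpty'.comp h

@[fun_prop]
theorem Poly.tail {l : α → List β} (h : Poly l) : Poly (fun a => (l a).tail) :=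
  Poly.comp (Poly.prim .snd Polynomial.X _ (fun l => by cases l <;> rfl) (fun l => by
    cases l with
    | nil => simp
    | cons a l => simp only [Polynomial.eval_X, List.tail, bits_cons]; omega)) h

/-- `fst` returns `num 0` on a leaf, so taking the head is an elementary operation provided that the
default value has this encoding. -/
theorem Poly.headD_zero (z : β) (hz : enc z = .num 0) :
    Poly (fun l : List β => l.headD z) :=
  Poly.prim .fst Polynomial.X _ (fun l => by
    cases l
    · exact hz
    · rfl) (fun l => by
    cases l with
    | nil => simp [bits, hz]; exact le_rfl
    | cons a l => simp only [Polynomial.eval_X, List.headD_cons, bits_cons]; omega)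

@[fun_prop]
theorem Poly.head? {l : α → List β} (h : Poly l) : Poly (fun a => (l a).head?) := by
  refine Poly.comp (g := List.head?) ?_ h
  -- No member of `β` need be encoded by `num 0`, so the head is taken in `Data`, where this default
  -- exists. The pair with 1 has the encoding of `some`.
  have h1 : Poly (fun l : List β => (1, (HasEnc.enc ((l.map enc).headD (.num 0)) : Data))) :=
    (Poly.const 1).pair ((Poly.headD_zero (Data.num 0) rfl).congr_enc (fun l => l.map enc)
      (fun l => by
        induction l with
        | nil => rfl
        | cons a l ih => rw [enc_cons, List.map_cons, enc_cons, ih]; rfl) fun _ => rfl)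
  have h2 : Poly (fun l : List β => if l.isEmpty then Data.num 0 else
      enc (1, (HasEnc.enc ((l.map enc).headD (.num 0)) : Data))) :=
    Poly.ite (by fun_prop) (by fun_prop) (h1.congr_enc (fun a => a) (fun _ => rfl) fun _ => rfl)
  refine h2.congr_enc (fun l => l) (fun _ => rfl) fun l => ?_
  cases l <;> rfl

end

/-! ### Loops over a list -/

/-- The questions asked in a loop over a list. -/
def foldlQ {α β σ : Type} (step : (Data → Bool) → α → σ → β → σ)
    (q : (Data → Bool) → α × σ × β → List Data) (O : Data → Bool) (a : α) :
    List β → σ → List Data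
  | [], _ => []
  | b :: l, s => q O (a, s, b) ++ foldlQ step q O a l (step O a s b)

section
variable {α β γ δ σ : Type} [HasEnc α] [HasEnc β] [HasEnc γ] [HasEnc δ] [HasEnc σ]

/-- The loop runs on triples of the remaining list, the state and the parameter. Polynomially many
polynomial steps may still produce exponentially large values; hence the hypothesis `hB`, which
bounds the state after every prefix of the list. -/
theorem PolyQ.foldl {l : α → List β} {s₀ : α → σ} {step : (Data → Bool) → α → σ → β → σ}
    {q : (Data → Bool) → α × σ × β → List Data} (hl : Poly l) (hs : Poly s₀)
    (hstep : PolyQ (fun O (x : α × σ × β) => step O x.1 x.2.1 x.2.2) q)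
    (hB : ∃ P : Polynomial ℕ, ∀ O a k,
      bits (((l a).take k).foldl (step O a) (s₀ a)) ≤ P.eval (bits a)) :
    PolyQ (fun O a => (l a).foldl (step O a) (s₀ a))
      (fun O a => foldlQ step q O a (l a) (s₀ a)) := by
  have hcond : Poly (fun x : List β × σ × α => if x.1.isEmpty then false else true) := by fun_prop
  -- A nonempty list has the same encoding as the pair of its head and tail. Typing the input in
  -- this way turns both into projections.
  have hbody : PolyQ (fun O (x : (β × List β) × σ × α) =>
      ((x.1.2, step O x.2.2 x.2.1 x.1.1, x.2.2) : List β × σ × α))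
      (fun O x => q O (x.2.2, x.2.1, x.1.1)) := by
    have h1 : Poly (fun x : (β × List β) × σ × α => (x.2.2, x.2.1, x.1.1)) := by fun_prop
    have h2 : Poly (fun x : (β × List β) × σ × α => x.1.2) := by fun_prop
    have h3 : Poly (fun x : (β × List β) × σ × α => x.2.2) := by fun_prop
    simpa using PolyQ.pair h2 ((hstep.comp h1).pair h3)
  have hinit : Poly (fun a => (l a, s₀ a, a)) := by fun_prop
  have hout : Poly (fun x : List β × σ × α => x.2.1) := by fun_prop
  obtain ⟨P, hP⟩ := hB
  obtain ⟨L, hL⟩ := hl.bits_le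
  obtain ⟨cc, pc, hcond⟩ := hcond
  obtain ⟨cb, pb, hbody⟩ := hbody
  -- One bound for list, state and parameter at once; the triple then has size at most 2 + 3R.
  let R : Polynomial ℕ := 2 + L + P + Polynomial.X
  have loop : ∀ (O : Data → Bool) (a : α) (N : ℕ) (l : List β) (s : σ),
      bits l ≤ N → (∀ k, bits ((l.take k).foldl (step O a) s) ≤ N) → bits a ≤ N →
      ∃ t, Runs O (.loop cc cb) (enc (l, s, a)) (enc (([] : List β), l.foldl (step O a) s, a)) t
        (foldlQ step q O a l s) ∧
        t ≤ (l.length + 1) * (1 + (2 + 3 * N) + pc.eval (2 + 3 * N) + pb.eval (2 + 3 * N)) := by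
    intro O a N l
    induction l with
    | nil =>
      intro s h1 h2 h3
      obtain ⟨t, ht, ht'⟩ := hcond O (([] : List β), s, a)
      refine ⟨_, Runs.loop_stop ht, ?_⟩
      have h4 : bits s ≤ N := h2 0
      have h5 : bits (([] : List β), s, a) ≤ 2 + 3 * N := by
        simp only [bits_pair]; omega
      have := eval_nat_mono pc h5
      simp only [bits, List.length_nil, zero_add, one_mul] at *
      omega
    | cons b l ih =>
      intro s h1 h2 h3
      obtain ⟨t, ht, ht'⟩ := hcond O (b :: l, s, a)
      obtain ⟨u, hu, hu'⟩ := hbody O ((b, l), s, a)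
      have hbl : bits l ≤ N := by rw [bits_cons] at h1; omega
      obtain ⟨v, hv, hv'⟩ := ih (step O a s b) hbl (fun k => h2 (k + 1)) h3
      have h4 : bits s ≤ N := h2 0
      have h5 : bits (b :: l, s, a) ≤ 2 + 3 * N := by
        simp only [bits_pair]; omega
      have e1 := eval_nat_mono pc h5
      have e2 := eval_nat_mono pb h5
      have := Runs.loop_step ht enc_bool_true hu hv
      refine ⟨_, this, ?_⟩
      have e3 : bits ((b, l), s, a) = bits (b :: l, s, a) := rfl
      rw [e3] at hu'
      rw [List.length_cons, add_mul _ 1, one_mul]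
      simp only [bits] at *
      omega
  have hloop : PolyQ (fun O (a : α) => (([] : List β), (l a).foldl (step O a) (s₀ a), a))
      (fun O a => foldlQ step q O a (l a) (s₀ a)) := by
    obtain ⟨ci, pi, hinit⟩ := hinit
    refine ⟨.seq ci (.loop cc cb), 1 + Polynomial.X + pi +
      (L + 1) * (1 + (2 + 3 * R) + pc.comp (2 + 3 * R) + pb.comp (2 + 3 * R)), fun O a => ?_⟩
    obtain ⟨t, ht, ht'⟩ := hinit O a
    obtain ⟨v, hv, hv'⟩ := loop O a (R.eval (bits a)) (l a) (s₀ a)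
      (by have := hL a; simp only [R, Polynomial.eval_add]; omega)
      (fun k => by have := hP O a k; simp only [R, Polynomial.eval_add]; omega)
      (by simp only [R, Polynomial.eval_add, Polynomial.eval_X]; omega)
    refine ⟨_, .seq ht hv, ?_⟩
    have h6 : (l a).length ≤ L.eval (bits a) := (length_le_bits _).le.trans (hL a)
    have h7 := Nat.mul_le_mul_right (1 + (2 + 3 * R.eval (bits a)) + pc.eval (2 + 3 * R.eval (bits a))
      + pb.eval (2 + 3 * R.eval (bits a))) (Nat.add_le_add_right h6 1)
    simp only [Polynomial.eval_add, Polynomial.eval_mul, Polynomial.eval_comp, Polynomial.eval_one,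
      Polynomial.eval_X, Polynomial.eval_ofNat]
    simp only [bits] at *
    omega
  simpa using PolyQ.comp hout hloop

theorem PolyO.foldl {l : α → List β} {s₀ : α → σ} {step : (Data → Bool) → α → σ → β → σ}
    (hl : Poly l) (hs : Poly s₀)
    (hstep : PolyO (fun O (x : α × σ × β) => step O x.1 x.2.1 x.2.2))
    (hB : ∃ P : Polynomial ℕ, ∀ O a k,
      bits (((l a).take k).foldl (step O a) (s₀ a)) ≤ P.eval (bits a)) :
    PolyO (fun O a => (l a).foldl (step O a) (s₀ a)) := by
  obtain ⟨q, hq⟩ := hstep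
  exact ⟨_, PolyQ.foldl hl hs hq hB⟩

theorem foldlQ_nil (step : (Data → Bool) → α → σ → β → σ) (O : Data → Bool) (a : α) (l : List β)
    (s : σ) : foldlQ step (fun _ _ => []) O a l s = [] := by
  induction l generalizing s with
  | nil => rfl
  | cons b l ih => simp [foldlQ, ih]

theorem Poly.foldl {l : α → List β} {s₀ : α → σ} {step : α → σ → β → σ}
    (hl : Poly l) (hs : Poly s₀)
    (hstep : Poly (fun (x : α × σ × β) => step x.1 x.2.1 x.2.2))
    (hB : ∃ P : Polynomial ℕ, ∀ a k,
      bits (((l a).take k).foldl (step a) (s₀ a)) ≤ P.eval (bits a)) :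
    Poly (fun a => (l a).foldl (step a) (s₀ a)) := by
  have := PolyQ.foldl (step := fun _ => step) hl hs hstep
    (by obtain ⟨P, hP⟩ := hB; exact ⟨P, fun _ => hP⟩)
  simp only [foldlQ_nil] at this
  exact this

/-- A bound for the state of a loop of which each step enlarges the state by a bounded amount. -/
theorem bits_foldl_le {l : List β} {step : σ → β → σ} {N : ℕ}
    (h : ∀ s, ∀ b ∈ l, bits (step s b) ≤ bits s + N) (s : σ) :
    bits (l.foldl step s) ≤ bits s + l.length * N := by
  induction l generalizing s with
  | nil => simp
  | cons b l ih =>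
    rw [List.foldl_cons, List.length_cons, add_mul, one_mul]
    have h1 := ih (fun s b hb => h s b (List.mem_cons_of_mem _ hb)) (step s b)
    have h2 := h s b List.mem_cons_self
    omega

/-- An increment that does not depend on the state keeps the state polynomial, since the number of
steps is at most the size of the list. -/
theorem foldl_bound {l : α → List β} {s₀ : α → σ} {step : (Data → Bool) → α → σ → β → σ}
    (hl : Poly l) (hs : Poly s₀)
    (h : ∃ P : Polynomial ℕ, ∀ O a s, ∀ b ∈ l a,
      bits (step O a s b) ≤ bits s + P.eval (bits a)) :
    ∃ P : Polynomial ℕ, ∀ O a k,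
      bits (((l a).take k).foldl (step O a) (s₀ a)) ≤ P.eval (bits a) := by
  obtain ⟨P, hP⟩ := h
  obtain ⟨L, hL⟩ := hl.bits_le
  obtain ⟨S, hS⟩ := hs.bits_le
  refine ⟨S + L * P, fun O a k => ?_⟩
  have h1 := bits_foldl_le (l := (l a).take k) (step := step O a) (N := P.eval (bits a))
    (fun s b hb => hP O a s b (List.mem_of_mem_take hb)) (s₀ a)
  have h2 : ((l a).take k).length ≤ L.eval (bits a) := by
    have := length_le_bits (l a)
    have := hL a
    rw [List.length_take]; omega
  have h3 := Nat.mul_le_mul_right (P.eval (bits a)) h2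
  have h4 := hS a
  simp only [Polynomial.eval_add, Polynomial.eval_mul]
  omega

theorem Poly.foldl_of_add {l : α → List β} {s₀ : α → σ} {step : α → σ → β → σ}
    (hl : Poly l) (hs : Poly s₀)
    (hstep : Poly (fun (x : α × σ × β) => step x.1 x.2.1 x.2.2))
    (h : ∃ P : Polynomial ℕ, ∀ a s, ∀ b ∈ l a,
      bits (step a s b) ≤ bits s + P.eval (bits a)) :
    Poly (fun a => (l a).foldl (step a) (s₀ a)) := by
  refine Poly.foldl hl hs hstep ?_
  obtain ⟨P, hP⟩ := foldl_bound (step := fun _ => step) hl hs (by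
    obtain ⟨P, hP⟩ := h; exact ⟨P, fun _ => hP⟩)
  exact ⟨P, hP fun _ => true⟩

@[fun_prop]
theorem Poly.reverse {l : α → List β} (hl : Poly l) : Poly (fun a => (l a).reverse) := by
  have := Poly.foldl_of_add (step := fun _ s b => b :: s) hl (Poly.const []) (by fun_prop) (by
    obtain ⟨L, hL⟩ := hl.bits_le
    refine ⟨L + 1, fun a s b hb => ?_⟩
    have h1 := (bits_le_of_mem hb).trans_le (hL a)
    simp only [bits_cons, Polynomial.eval_add, Polynomial.eval_one]
    omega)
  simpa using this

@[fun_prop]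
theorem Poly.append {l l' : α → List β} (hl : Poly l) (hl' : Poly l') :
    Poly (fun a => l a ++ l' a) := by
  have := Poly.foldl_of_add (step := fun _ s b => b :: s) hl.reverse hl' (by fun_prop) (by
    obtain ⟨L, hL⟩ := hl.reverse.bits_le
    refine ⟨L + 1, fun a s b hb => ?_⟩
    have h1 := (bits_le_of_mem hb).trans_le (hL a)
    simp only [bits_cons, Polynomial.eval_add, Polynomial.eval_one]
    omega)
  simpa using this

/-- A bound for the values of `f a b`, where `b` is a member of `l a`. -/
theorem Poly.bits_le_of_mem {l : α → List β} {f : α → β → γ} (hl : Poly l)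
    (hf : Poly (fun x : α × β => f x.1 x.2)) :
    ∃ P : Polynomial ℕ, ∀ a, ∀ b ∈ l a, bits (f a b) ≤ P.eval (bits a) := by
  obtain ⟨L, hL⟩ := hl.bits_le
  obtain ⟨F, hF⟩ := hf.bits_le
  refine ⟨F.comp (1 + Polynomial.X + L), fun a b hb => ?_⟩
  have h1 := (ColorfulLP.bits_le_of_mem hb).trans_le (hL a)
  have h2 := hF (a, b)
  refine h2.trans ?_
  rw [Polynomial.eval_comp]
  apply eval_nat_mono
  simp only [bits_pair, Polynomial.eval_add, Polynomial.eval_one, Polynomial.eval_X]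
  omega

@[fun_prop]
theorem Poly.map {l : α → List β} {f : α → β → γ} (hl : Poly l)
    (hf : Poly (fun x : α × β => f x.1 x.2)) : Poly (fun a => (l a).map (f a)) := by
  have := Poly.foldl_of_add (step := fun a s b => f a b :: s) hl (Poly.const []) (by
    have h1 : Poly (fun x : α × List γ × β => f x.1 x.2.2) :=
      Poly.comp hf (f := fun x : α × List γ × β => (x.1, x.2.2)) (by fun_prop)
    fun_prop) (by
    obtain ⟨L, hL⟩ := Poly.bits_le_of_mem hl hf
    refine ⟨L + 1, fun a s b hb => ?_⟩
    have h1 := hL a b hb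
    simp only [bits_cons, Polynomial.eval_add, Polynomial.eval_one]
    omega)
  have h2 := this.reverse
  simpa using h2

end

/-! ### Arithmetic -/

theorem size_le_size_add_size_of_le_mul {a b c : ℕ} (h : c ≤ a * b) :
    Nat.size c ≤ Nat.size a + Nat.size b := by
  rw [Nat.size_le, pow_add]
  have := Nat.lt_size_self a
  have := Nat.lt_size_self b
  calc c ≤ a * b := h
    _ < _ := by gcongr

theorem size_le_of_le_add {a b c : ℕ} (h : c ≤ a + b) :
    Nat.size c ≤ Nat.size a + Nat.size b + 1 := by
  rw [Nat.size_le, pow_succ, pow_add]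
  have h1 := Nat.lt_size_self a
  have h2 := Nat.lt_size_self b
  nlinarith [Nat.one_le_two_pow (n := a.size), Nat.one_le_two_pow (n := b.size)]

theorem bits_int_add_le (a b : ℤ) : bits (a + b) ≤ bits a + bits b := by
  have := size_le_of_le_add (Int.natAbs_add_le a b)
  simp only [bits_int]; omega

theorem bits_int_sub_le (a b : ℤ) : bits (a - b) ≤ bits a + bits b := by
  have := size_le_of_le_add (Int.natAbs_sub_le a b)
  simp only [bits_int]; omega

theorem bits_int_mul_le (a b : ℤ) : bits (a * b) ≤ bits a + bits b := by
  have := size_le_size_add_size_of_le_mul (Int.natAbs_mul a b).le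
  simp only [bits_int]; omega

theorem bits_int_div_le (a b : ℤ) : bits (a / b) ≤ bits a := by
  have h := Int.natAbs_ediv_le_natAbs a b
  have := Nat.size_le_size h
  simp only [bits_int]; omega

theorem bits_int_mod_le (a b : ℤ) : bits (a % b) ≤ bits a + bits b := by
  have h : (a % b).natAbs ≤ a.natAbs + b.natAbs := by
    rcases eq_or_ne b 0 with rfl | hb
    · simp
    · have h1 := Int.emod_nonneg a hb
      have h2 := Int.emod_lt a hb
      omega
  have := size_le_of_le_add h
  simp only [bits_int]; omega

section
variable {α β γ δ σ : Type} [HasEnc α] [HasEnc β] [HasEnc γ] [HasEnc δ] [HasEnc σ]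

theorem Poly.int_binary (p : Prim) (op : ℤ → ℤ → ℤ)
    (hop : ∀ a b : ℤ, p.eval (.node (.num a) (.num b)) = .num (op a b))
    (h : ∀ a b, bits (op a b) ≤ bits a + bits b) {f g : α → ℤ} (hf : Poly f) (hg : Poly g) :
    Poly (fun a => op (f a) (g a)) :=
  Poly.comp (Poly.prim p Polynomial.X (fun x : ℤ × ℤ => op x.1 x.2) (fun x => (hop _ _).symm)
    (fun x => by
      have := h x.1 x.2
      rw [Polynomial.eval_X, show bits x = 1 + bits x.1 + bits x.2 from rfl]; omega))
    (hf.pair hg)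

@[fun_prop]
theorem Poly.int_add {f g : α → ℤ} (hf : Poly f) (hg : Poly g) : Poly (fun a => f a + g a) :=
  Poly.int_binary .add _ (fun _ _ => rfl) bits_int_add_le hf hg

@[fun_prop]
theorem Poly.int_sub {f g : α → ℤ} (hf : Poly f) (hg : Poly g) : Poly (fun a => f a - g a) :=
  Poly.int_binary .sub _ (fun _ _ => rfl) bits_int_sub_le hf hg

@[fun_prop]
theorem Poly.int_mul {f g : α → ℤ} (hf : Poly f) (hg : Poly g) : Poly (fun a => f a * g a) :=
  Poly.int_binary .mul _ (fun _ _ => rfl) bits_int_mul_le hf hg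

@[fun_prop]
theorem Poly.int_div {f g : α → ℤ} (hf : Poly f) (hg : Poly g) : Poly (fun a => f a / g a) :=
  Poly.int_binary .div _ (fun _ _ => rfl)
    (fun a b => (bits_int_div_le a b).trans (Nat.le_add_right _ _)) hf hg

@[fun_prop]
theorem Poly.int_mod {f g : α → ℤ} (hf : Poly f) (hg : Poly g) : Poly (fun a => f a % g a) :=
  Poly.int_binary .mod _ (fun _ _ => rfl) bits_int_mod_le hf hg

@[fun_prop]
theorem Poly.int_neg {f : α → ℤ} (hf : Poly f) : Poly (fun a => -f a) := by
  simpa using Poly.int_sub (Poly.const 0) hf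

@[fun_prop]
theorem Poly.natCast {f : α → ℕ} (hf : Poly f) : Poly (fun a => (f a : ℤ)) :=
  Poly.comp (Poly.of_enc_eq (fun n : ℕ => (n : ℤ)) fun _ => rfl) hf

@[fun_prop]
theorem Poly.nat_add {f g : α → ℕ} (hf : Poly f) (hg : Poly g) : Poly (fun a => f a + g a) :=
  Poly.congr_enc (f := fun a => (f a : ℤ) + (g a : ℤ)) (by fun_prop) (fun a => a) (fun _ => rfl)
    fun a => by
      show Data.num _ = Data.num _
      push_cast; rfl

@[fun_prop]
theorem Poly.int_lt {f g : α → ℤ} (hf : Poly f) (hg : Poly g) :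
    Poly (fun a => decide (f a < g a)) :=
  Poly.comp (Poly.prim .lt 2 (fun x : ℤ × ℤ => decide (x.1 < x.2)) (fun x => by
      show Data.ofBool _ = Data.num _
      simp only [Data.ofBool, decide_eq_true_eq])
    (fun x => by simpa using bits_bool _)) (hf.pair hg)

/-- Types with an injective encoding. -/
class InjEnc (α : Type) [HasEnc α] : Prop where
  inj : ∀ a b : α, enc a = enc b → a = b

instance : InjEnc ℤ := ⟨fun a b h => by simpa [enc, HasEnc.enc] using h⟩
instance : InjEnc ℕ := ⟨fun a b h => by simpa [enc, HasEnc.enc] using h⟩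
instance : InjEnc ℚ := ⟨fun a b h => by
  simp only [enc, HasEnc.enc, encRat, Data.node.injEq, Data.num.injEq] at h
  exact Rat.ext h.1 (by exact_mod_cast h.2)⟩
instance [InjEnc α] : InjEnc (Option α) := ⟨fun a b h => by
  cases a <;> cases b <;> simp only [enc, HasEnc.enc, encOption] at h
  · rfl
  · simp at h
  · simp at h
  · rw [Data.node.injEq] at h
    rw [InjEnc.inj _ _ h.2]⟩
instance [InjEnc α] : InjEnc (List α) := ⟨fun a => by
  induction a with
  | nil =>
    intro b h
    cases b with
    | nil => rfl
    | cons b l => simp [enc, HasEnc.enc, encList] at h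
  | cons a l ih =>
    intro b h
    cases b with
    | nil => simp [enc, HasEnc.enc, encList] at h
    | cons b l' =>
      rw [enc_cons, enc_cons, Data.node.injEq] at h
      rw [InjEnc.inj _ _ h.1, ih _ h.2]⟩

@[fun_prop]
theorem Poly.decide_eq [DecidableEq β] [InjEnc β] {f g : α → β} (hf : Poly f) (hg : Poly g) :
    Poly (fun a => decide (f a = g a)) :=
  Poly.comp (Poly.prim .eq 2 (fun x : β × β => decide (x.1 = x.2)) (fun x => by
      show Data.ofBool _ = Data.ofBool _
      congr 1
      simp only [decide_eq_decide]
      exact ⟨fun h => by rw [h], fun h => InjEnc.inj _ _ h⟩)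
    (fun x => by simpa using bits_bool _)) (hf.pair hg)

/-! ### More on lists -/

theorem enc_map_enc (l : List α) : enc (l.map enc) = enc l := by
  induction l with
  | nil => rfl
  | cons a l ih => rw [List.map_cons, enc_cons, enc_cons, ih]; rfl

theorem enc_map_congr {l : List γ} {f : γ → α} {g : γ → β} (h : ∀ c ∈ l, enc (f c) = enc (g c)) :
    enc (l.map f) = enc (l.map g) := by
  induction l with
  | nil => rfl
  | cons a l ih =>
    rw [List.map_cons, List.map_cons, enc_cons, enc_cons, h a List.mem_cons_self,
      ih fun c hc => h c (List.mem_cons_of_mem _ hc)]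

/-- Zipping as one loop over `l`: the state carries the unread part of `l'` and stays idle once that
is exhausted. -/
theorem zip_foldl {β γ : Type} (l : List β) (l' : List γ) (d : γ) (acc : List (β × γ)) :
    (l.foldl (fun (s : List γ × List (β × γ)) b =>
      if s.1.isEmpty then s else (s.1.tail, (b, s.1.headD d) :: s.2)) (l', acc)).2
      = (l.zip l').reverse ++ acc := by
  induction l generalizing l' acc with
  | nil => simp
  | cons b l ih =>
    cases l' with
    | nil =>
      have : ∀ l : List β, (l.foldl (fun (s : List γ × List (β × γ)) b =>
        if s.1.isEmpty then s else (s.1.tail, (b, s.1.headD d) :: s.2)) ([], acc)) = ([], acc) := by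
        intro l
        induction l with
        | nil => rfl
        | cons b l ih => simpa using ih
      rw [this]
      simp
    | cons c l' =>
      show (List.foldl _ (l', (b, c) :: acc) l).2 = _
      rw [ih]
      simp

theorem Poly.zip_data {l l' : α → List Data} (hl : Poly l) (hl' : Poly l') :
    Poly (fun a => (l a).zip (l' a)) := by
  have h0 : Poly (fun l : List Data => l.headD (.num 0)) := Poly.headD_zero _ rfl
  have := Poly.foldl_of_add (α := α) (l := l)
    (step := fun (_ : α) (s : List Data × List (Data × Data)) b =>
      if s.1.isEmpty then s else (s.1.tail, (b, s.1.headD (.num 0)) :: s.2)) hl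
    (s₀ := fun a => (l' a, [])) (by fun_prop) (by
      have : Poly (fun x : α × (List Data × List (Data × Data)) × Data =>
        x.2.1.1.headD (.num 0)) := h0.comp (by fun_prop)
      fun_prop) (by
    obtain ⟨L, hL⟩ := hl.bits_le
    refine ⟨L + 4, fun a s b hb => ?_⟩
    have h1 := (ColorfulLP.bits_le_of_mem hb).trans_le (hL a)
    obtain ⟨s1, s2⟩ := s
    cases s1 with
    | nil => simp
    | cons c s1 =>
      simp only [List.isEmpty_cons, Bool.false_eq_true, if_false, List.tail_cons, List.headD_cons]
      simp only [bits_pair, bits_cons, Polynomial.eval_add, Polynomial.eval_ofNat]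
      omega)
  have h2 := this.snd'.reverse
  simp only [zip_foldl, List.append_nil, List.reverse_reverse] at h2
  exact h2

@[fun_prop]
theorem Poly.zip {l : α → List β} {l' : α → List γ} (hl : Poly l) (hl' : Poly l') :
    Poly (fun a => (l a).zip (l' a)) := by
  have h : Poly (fun a => ((l a).map enc).zip ((l' a).map enc)) :=
    Poly.zip_data (hl.congr_enc (fun a => a) (fun _ => rfl) fun _ => enc_map_enc _)
      (hl'.congr_enc (fun a => a) (fun _ => rfl) fun _ => enc_map_enc _)
  refine h.congr_enc (fun a => a) (fun _ => rfl) fun a => ?_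
  rw [List.zip_map]
  have : enc (((l a).zip (l' a)).map fun x => x) = _ :=
    enc_map_congr (g := Prod.map (enc (α := β)) (enc (α := γ))) fun c _ => rfl
  rw [List.map_id'] at this
  exact this

theorem zipIdx_foldl {β : Type} (l : List β) (k : ℕ) (acc : List (β × ℕ)) :
    (l.foldl (fun (s : ℕ × List (β × ℕ)) b => (s.1 + 1, (b, s.1) :: s.2)) (k, acc)).2
      = (l.zipIdx k).reverse ++ acc := by
  induction l generalizing k acc with
  | nil => simp
  | cons b l ih => simp [ih]

theorem bits_nat_le (n : ℕ) : bits n ≤ 1 + n := by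
  rw [bits_nat]
  have : n.size ≤ n := by rw [Nat.size_le]; exact Nat.lt_two_pow_self
  omega

theorem bits_nat_mono {m n : ℕ} (h : m ≤ n) : bits m ≤ bits n := by
  rw [bits_nat, bits_nat]; have := Nat.size_le_size h; omega

-- `Poly.foldl_of_add` does not apply: it wants a bound for arbitrary states, while here each step
-- copies the counter from the state into the list. The bound uses that the counter never exceeds
-- the length of the list.
@[fun_prop]
theorem Poly.zipIdx {l : α → List β} (hl : Poly l) : Poly (fun a => (l a).zipIdx) := by
  have := Poly.foldl (α := α) (l := l)
    (step := fun (_ : α) (s : ℕ × List (β × ℕ)) b => (s.1 + 1, (b, s.1) :: s.2)) hl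
    (s₀ := fun a => (0, [])) (by fun_prop) (by fun_prop) (by
    obtain ⟨L, hL⟩ := hl.bits_le
    have key : ∀ (N : ℕ) (l : List β) (s : ℕ × List (β × ℕ)), s.1 + l.length ≤ N →
        (∀ b ∈ l, bits b ≤ N) →
        bits (l.foldl (fun (s : ℕ × List (β × ℕ)) b => (s.1 + 1, (b, s.1) :: s.2)) s)
          ≤ 2 + N + bits s.2 + l.length * (3 + 2 * N) := by
      intro N l
      induction l with
      | nil =>
        intro s hs _
        have := bits_nat_le s.1
        rw [show bits (List.foldl _ s []) = 1 + bits s.1 + bits s.2 from rfl]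
        simp at hs ⊢; omega
      | cons b l ih =>
        intro s hs hb
        rw [List.length_cons] at hs
        have h1 := ih (s.1 + 1, (b, s.1) :: s.2) (by simp only; omega)
          (fun b hb' => hb b (List.mem_cons_of_mem _ hb'))
        have h2 := hb b List.mem_cons_self
        have h3 := bits_nat_le s.1
        rw [List.foldl_cons, List.length_cons, add_mul, one_mul]
        simp only [bits_cons, bits_pair] at h1 ⊢
        omega
    refine ⟨3 + L + L * (3 + 2 * L), fun a k => ?_⟩
    have hk : ((l a).take k).length ≤ L.eval (bits a) := by
      have := length_le_bits (l a)
      have := hL a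
      rw [List.length_take]; omega
    refine (key (L.eval (bits a)) _ _ (by simpa using hk) fun b hb => ?_).trans ?_
    · exact ((ColorfulLP.bits_le_of_mem (List.mem_of_mem_take hb)).trans_le (hL a)).le
    · have h3 := Nat.mul_le_mul_right (3 + 2 * L.eval (bits a)) hk
      simp only [bits_nil, Polynomial.eval_add, Polynomial.eval_mul, Polynomial.eval_ofNat]
      omega)
  have h2 := this.snd'.reverse
  simpa [zipIdx_foldl] using h2

/-- Overwriting an entry by comparison of indices. The offset `k` is needed for the induction only.
-/
theorem map_zipIdx_ite {β : Type} (l : List β) (k i : ℕ) (v : β) :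
    (l.zipIdx k).map (fun x => if decide (x.2 = i + k) then v else x.1) = l.set i v := by
  induction l generalizing k i with
  | nil => rfl
  | cons b l ih =>
    cases i with
    | zero =>
      simp only [List.zipIdx_cons, List.map_cons, zero_add, decide_true, if_true, List.set_cons_zero]
      congr 1
      have : ∀ x ∈ l.zipIdx (k + 1), (if decide (x.2 = k) then v else x.1) = x.1 := by
        intro x hx
        have := List.le_snd_of_mem_zipIdx hx
        rw [if_neg (by simp; omega)]
      rw [List.map_congr_left this]
      simp
    | succ i =>
      simp only [List.zipIdx_cons, List.map_cons, List.set_cons_succ]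
      rw [← ih (k + 1) i]
      congr 1
      · rw [if_neg (by simp)]
      · simp only [add_assoc, add_comm 1]

@[fun_prop]
theorem Poly.set {l : α → List β} {i : α → ℕ} {v : α → β} (hl : Poly l) (hi : Poly i)
    (hv : Poly v) : Poly (fun a => (l a).set (i a) (v a)) := by
  have : Poly (fun a => (l a).zipIdx.map fun x => if decide (x.2 = i a) then v a else x.1) := by
    fun_prop
  simpa only [← map_zipIdx_ite _ 0, add_zero] using this

@[fun_prop]
theorem Poly.flatten {l : α → List (List β)} (hl : Poly l) : Poly (fun a => (l a).flatten) := by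
  have := Poly.foldl_of_add (step := fun _ s b => b.reverse ++ s) (l := l) (s₀ := fun _ => []) hl
    (by fun_prop) (by fun_prop) (by
    obtain ⟨L, hL⟩ := hl.bits_le
    refine ⟨L, fun a s b hb => ?_⟩
    have h1 := (ColorfulLP.bits_le_of_mem hb).trans_le (hL a)
    have h2 := bits_append b.reverse s
    rw [bits_reverse] at h2
    omega)
  have h2 := this.reverse
  have key : ∀ (l : List (List β)) s, (l.foldl (fun s b => b.reverse ++ s) s)
      = l.flatten.reverse ++ s := by
    intro l
    induction l with
    | nil => simp
    | cons b l ih => intro s; simp [ih]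
  simpa [key] using h2

@[fun_prop]
theorem Poly.sum {l : α → List ℤ} (hl : Poly l) : Poly (fun a => (l a).sum) := by
  have := Poly.foldl_of_add (step := fun _ s b => s + b) (l := l) (s₀ := fun _ => 0) hl
    (by fun_prop) (by fun_prop) (by
    obtain ⟨L, hL⟩ := hl.bits_le
    refine ⟨L, fun a s b hb => ?_⟩
    have h1 := (ColorfulLP.bits_le_of_mem hb).trans_le (hL a)
    have h2 := bits_int_add_le s b
    omega)
  simpa only [List.sum_eq_foldl] using this

@[fun_prop]
theorem Poly.prod {l : α → List ℤ} (hl : Poly l) : Poly (fun a => (l a).prod) := by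
  have := Poly.foldl_of_add (step := fun _ s b => s * b) (l := l) (s₀ := fun _ => 1) hl
    (by fun_prop) (by fun_prop) (by
    obtain ⟨L, hL⟩ := hl.bits_le
    refine ⟨L, fun a s b hb => ?_⟩
    have h1 := (ColorfulLP.bits_le_of_mem hb).trans_le (hL a)
    have h2 := bits_int_mul_le s b
    omega)
  simpa only [List.prod_eq_foldl] using this

end

/-! ### Loops with a decreasing measure; Euclid's algorithm and rational numbers. -/

section
variable {α β γ δ σ : Type} [HasEnc α] [HasEnc β] [HasEnc γ] [HasEnc δ] [HasEnc σ]

/-- A loop that does not enlarge its state, with polynomially many iterations. -/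
theorem Poly.while {c : σ → Bool} {f r : σ → σ} (hc : Poly c) (hf : Poly f)
    (h0 : ∀ s, c s = false → r s = s) (h1 : ∀ s, c s = true → r s = r (f s))
    (hB : ∀ s, c s = true → bits (f s) ≤ bits s) (μ : σ → ℕ)
    (hμ : ∀ s, c s = true → μ (f s) < μ s) (P : Polynomial ℕ)
    (hP : ∀ s, μ s ≤ P.eval (bits s)) : Poly r := by
  obtain ⟨cc, pc, hc⟩ := hc
  obtain ⟨cf, pf, hf⟩ := hf
  refine ⟨.loop cc cf, (P + 1) * (1 + Polynomial.X + pc + pf), fun O a => ?_⟩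
  suffices h : ∀ (n N : ℕ) (s : σ), μ s ≤ n → bits s ≤ N → ∃ t,
      Runs O (.loop cc cf) (enc s) (enc (r s)) t [] ∧ t ≤ (n + 1) * (1 + N + pc.eval N + pf.eval N) by
    simpa using h _ _ a (hP a) le_rfl
  intro n N
  induction n with
  | zero =>
    intro s hs hN
    have hcs : c s = false := by
      by_contra h
      have := hμ s (by simpa using h)
      omega
    obtain ⟨t, ht, ht'⟩ := hc O s
    simp only [hcs, enc_bool_false] at ht
    refine ⟨_, by rw [h0 s hcs]; exact Runs.loop_stop ht, ?_⟩
    have := eval_nat_mono pc hN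
    simp only [bits] at *
    omega
  | succ n ih =>
    intro s hs hN
    obtain ⟨t, ht, ht'⟩ := hc O s
    have e1 := eval_nat_mono pc hN
    have e2 := eval_nat_mono pf hN
    cases hcs : c s with
    | false =>
      simp only [hcs, enc_bool_false] at ht
      refine ⟨_, by rw [h0 s hcs]; exact Runs.loop_stop ht, ?_⟩
      rw [add_mul, one_mul]
      simp only [bits] at *
      omega
    | true =>
      obtain ⟨u, hu, hu'⟩ := hf O s
      obtain ⟨v, hv, hv'⟩ := ih (f s) (by have := hμ s hcs; omega) ((hB s hcs).trans hN)
      simp only [hcs] at ht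
      refine ⟨_, by rw [h1 s hcs]; exact .loop_step ht enc_bool_true hu hv, ?_⟩
      rw [add_mul _ 1, one_mul]
      simp only [bits] at *
      omega

@[fun_prop]
theorem Poly.not {b : α → Bool} (h : Poly b) : Poly (fun a => !b a) := by
  have : Poly (fun a => if b a then false else true) := by fun_prop
  refine this.congr_enc (fun a => a) (fun _ => rfl) fun a => ?_
  cases b a <;> rfl

@[fun_prop]
theorem Poly.nat_mod {f g : α → ℕ} (hf : Poly f) (hg : Poly g) : Poly (fun a => f a % g a) :=
  Poly.congr_enc (f := fun a => (f a : ℤ) % (g a : ℤ)) (by fun_prop) (fun a => a) (fun _ => rfl)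
    fun a => by
      show Data.num _ = Data.num _
      push_cast; rfl

@[fun_prop]
theorem Poly.nat_div {f g : α → ℕ} (hf : Poly f) (hg : Poly g) : Poly (fun a => f a / g a) :=
  Poly.congr_enc (f := fun a => (f a : ℤ) / (g a : ℤ)) (by fun_prop) (fun a => a) (fun _ => rfl)
    fun a => by
      show Data.num _ = Data.num _
      push_cast; rfl

@[fun_prop]
theorem Poly.natAbs {f : α → ℤ} (hf : Poly f) : Poly (fun a => (f a).natAbs) :=
  Poly.congr_enc (f := fun a => if decide (f a < 0) then -f a else f a) (by fun_prop)
    (fun a => a) (fun _ => rfl) fun a => by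
      show Data.num _ = Data.num _
      simp only [decide_eq_true_eq]
      split <;> congr 1 <;> omega

@[fun_prop]
theorem Poly.sign {f : α → ℤ} (hf : Poly f) : Poly (fun a => (f a).sign) := by
  have : Poly (fun a => if decide (f a < 0) then (-1 : ℤ) else if decide (0 < f a) then 1 else 0) := by
    fun_prop
  refine this.congr_enc (fun a => a) (fun _ => rfl) fun a => ?_
  congr 1
  simp only [decide_eq_true_eq]
  split_ifs with h h'
  · exact Int.sign_eq_neg_one_of_neg h
  · exact Int.sign_eq_one_of_pos h'
  · rw [show f a = 0 by omega]; rfl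

/-- Euclid's algorithm takes logarithmically many steps: for b ≤ a one has 2(a mod b) ≤ a, so the
product of the pair is at least halved and its binary length drops. A step with a < b only swaps the
pair and is paid for by the second summand of the measure. -/
theorem Poly.gcd_pair : Poly (fun s : ℕ × ℕ => (s.1.gcd s.2, 0)) := by
  refine Poly.while (c := fun s : ℕ × ℕ => !decide (s.2 = 0)) (f := fun s => (s.2, s.1 % s.2))
    (by fun_prop) (by fun_prop) ?_ ?_ ?_
    (fun s => (s.1 * s.2).size + (if s.1 < s.2 then 1 else 0) + (if s.2 = 0 then 0 else 1)) ?_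
    (Polynomial.X + 2) ?_
  · rintro ⟨a, b⟩ h
    simp only [Bool.not_eq_false', decide_eq_true_eq] at h
    simp [h]
  · rintro ⟨a, b⟩ h
    simp only [Prod.mk.injEq, and_true]
    rw [Nat.gcd_comm, Nat.gcd_rec, Nat.gcd_comm]
  · rintro ⟨a, b⟩ h
    have := bits_nat_mono (Nat.mod_le a b)
    simp only [bits_pair]; omega
  · rintro ⟨a, b⟩ h
    simp only [Bool.not_eq_true', decide_eq_false_iff_not] at h
    have hb : 0 < b := Nat.pos_of_ne_zero h
    have h1 := Nat.mod_lt a hb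
    simp only [if_neg h, if_neg (show ¬ b < a % b by omega)]
    by_cases hab : a < b
    · rw [Nat.mod_eq_of_lt hab, if_pos hab, mul_comm]
      split <;> omega
    · rw [if_neg hab]
      have h2 : 2 * (a % b) ≤ a := by
        have h4 := Nat.mod_add_div a b
        have h5 : 1 ≤ a / b := Nat.div_pos (by omega) hb
        have : b ≤ b * (a / b) := Nat.le_mul_of_pos_right _ h5
        omega
      have h3 : (b * (a % b)).size < (a * b).size := by
        rcases Nat.eq_zero_or_pos (a % b) with h0 | h0
        · rw [h0, mul_zero, Nat.size_zero, Nat.size_pos]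
          exact Nat.mul_pos (by omega) hb
        · have h6 : ((b * (a % b)).size + 1) ≤ (2 * (b * (a % b))).size := by
            rw [Nat.succ_le_iff, Nat.lt_size]
            obtain ⟨k, hk⟩ := Nat.exists_eq_succ_of_ne_zero
              (Nat.size_pos.2 (Nat.mul_pos hb h0)).ne'
            have : 2 ^ k ≤ b * (a % b) := Nat.lt_size.1 (by omega)
            rw [hk, Nat.succ_eq_add_one, pow_succ']
            omega
          refine lt_of_lt_of_le (Nat.lt_of_succ_le h6) (Nat.size_le_size ?_)
          nlinarith
      split <;> omega
  · rintro ⟨a, b⟩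
    have := size_le_size_add_size_of_le_mul (le_refl (a * b))
    simp only [bits_pair, bits_nat, Polynomial.eval_add, Polynomial.eval_X, Polynomial.eval_ofNat]
    split <;> split <;> omega

@[fun_prop]
theorem Poly.gcd {f g : α → ℕ} (hf : Poly f) (hg : Poly g) : Poly (fun a => (f a).gcd (g a)) :=
  (Poly.comp Poly.gcd_pair (hf.pair hg)).fst'

-- Encodings are reduced fractions, so a division has to produce the normal form: sign and gcd yield
-- it, and the denominator is 1 on division by zero.
@[fun_prop]
theorem Poly.rat_div {f g : α → ℤ} (hf : Poly f) (hg : Poly g) :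
    Poly (fun a => (f a : ℚ) / (g a : ℚ)) := by
  have : Poly (fun a => ((g a).sign * f a / (((g a).natAbs.gcd (f a).natAbs : ℕ) : ℤ),
      if decide (g a = 0) then 1 else (g a).natAbs / (g a).natAbs.gcd (f a).natAbs)) := by
    fun_prop
  refine this.congr_enc (fun a => a) (fun _ => rfl) fun a => ?_
  rw [← Rat.divInt_eq_div]
  show Data.node _ _ = Data.node _ _
  rw [Rat.num_divInt, Rat.den_divInt]
  simp only [decide_eq_true_eq]
  rfl

@[fun_prop]
theorem Poly.intCast_rat {f : α → ℤ} (hf : Poly f) : Poly (fun a => ((f a : ℤ) : ℚ)) := by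
  have : Poly (fun a => (f a, (1 : ℤ))) := by fun_prop
  exact this.congr_enc (fun a => a) (fun _ => rfl) fun a => rfl

@[fun_prop]
theorem Poly.num {f : α → ℚ} (hf : Poly f) : Poly (fun a => (f a).num) := by
  have : Poly (fun a => ((f a).num, ((f a).den : ℤ))) :=
    hf.congr_enc (fun a => a) (fun _ => rfl) fun _ => rfl
  exact this.fst'

@[fun_prop]
theorem Poly.den {f : α → ℚ} (hf : Poly f) : Poly (fun a => (f a).den) := by
  have : Poly (fun a => ((f a).num, (f a).den)) :=
    hf.congr_enc (fun a => a) (fun _ => rfl) fun _ => rfl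
  exact this.snd'

end

/-! ## A second colorful simplex -/

section Octahedron

open MeasureTheory Set

/-- The exponential distribution. -/
noncomputable def expLaw : Measure ℝ :=
  (volume.restrict (Ioi 0)).withDensity fun x => ENNReal.ofReal (Real.exp (-x))

theorem expLaw_apply_Iic : expLaw (Iic 0) = 0 := by
  rw [expLaw]
  refine withDensity_absolutelyContinuous _ _ ?_
  rw [Measure.restrict_apply measurableSet_Iic, Iic_inter_Ioi, Ioc_self, measure_empty]

theorem expLaw_pos {s : Set ℝ} (hs : IsOpen s) {x : ℝ} (hx : 0 < x) (hxs : x ∈ s) :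
    0 < expLaw s := by
  rw [pos_iff_ne_zero, expLaw, Ne, withDensity_apply_eq_zero (by fun_prop)]
  have : {x | ENNReal.ofReal (Real.exp (-x)) ≠ 0} ∩ s = s := by
    ext x
    simp [Real.exp_pos]
  rw [this, Measure.restrict_apply hs.measurableSet]
  exact ((hs.inter isOpen_Ioi).measure_pos volume ⟨x, hxs, hx⟩).ne'

instance : IsFiniteMeasure expLaw := by
  refine isFiniteMeasure_withDensity_ofReal ?_
  exact (integrableOn_exp_neg_Ioi 0).2

/-- The choice of the exponential law is due to this formula: the characteristic function is the
reciprocal of an affine function of t, so relations between laws of cones become determinant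
identities. -/
theorem integral_expLaw (t : ℝ) :
    ∫ x, Complex.exp ((x * t : ℝ) * Complex.I) ∂expLaw = (1 - t * Complex.I)⁻¹ := by
  rw [expLaw, integral_withDensity_eq_integral_toReal_smul (by fun_prop) (by simp)]
  have h := integral_exp_mul_complex_Ioi (a := -(1 - t * Complex.I)) (by simp) 0
  have h2 : ∀ x : ℝ, (ENNReal.ofReal (Real.exp (-x))).toReal •
      Complex.exp ((x * t : ℝ) * Complex.I) = Complex.exp (-(1 - t * Complex.I) * x) := by
    intro x
    rw [ENNReal.toReal_ofReal (Real.exp_pos _).le, Complex.real_smul, Complex.ofReal_exp,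
      ← Complex.exp_add]
    congr 1
    push_cast
    ring
  simp_rw [h2]
  rw [h]
  simp only [Complex.ofReal_zero, mul_zero, Complex.exp_zero]
  rw [neg_div_neg_eq, one_div]

variable {ι : Type} [Fintype ι] [DecidableEq ι]

/-- The linear map that sends the basis vectors to the given vectors. -/
noncomputable def combine (c : ι → ι → ℝ) : (ι → ℝ) →L[ℝ] (ι → ℝ) :=
  LinearMap.toContinuousLinearMap (Fintype.linearCombination ℝ c)

theorem combine_apply (c : ι → ι → ℝ) (w : ι → ℝ) : combine c w = ∑ i, w i • c i := rfl

/-- The law of a combination of given vectors with exponentially distributed coefficients. -/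
noncomputable def coneLaw (c : ι → ι → ℝ) : Measure (ι → ℝ) :=
  (Measure.pi fun _ : ι => expLaw).map (combine c)

instance (c : ι → ι → ℝ) : IsFiniteMeasure (coneLaw c) := by
  unfold coneLaw; infer_instance

theorem charFunDual_coneLaw (c : ι → ι → ℝ) (L : StrongDual ℝ (ι → ℝ)) :
    charFunDual (coneLaw c) L = ∏ i, (1 - L (c i) * Complex.I)⁻¹ := by
  rw [coneLaw, charFunDual_map, charFunDual_pi]
  refine Finset.prod_congr rfl fun i _ => ?_
  rw [← integral_expLaw, charFunDual_apply]
  congr 1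
  ext x
  congr 3
  simp [combine_apply, Pi.single_apply, ite_smul]

/-- The exponential density is positive on the positive axis, so the law of the coefficients charges
every box that meets the open positive orthant. -/
theorem coneLaw_pos (c : ι → ι → ℝ) {U : Set (ι → ℝ)} (hU : IsOpen U) {w : ι → ℝ}
    (hw : ∀ i, 0 ≤ w i) (h : ∑ i, w i • c i ∈ U) : 0 < coneLaw c U := by
  rw [coneLaw, Measure.map_apply (combine c).continuous.measurable hU.measurableSet]
  have hV : IsOpen (combine c ⁻¹' U) := hU.preimage (combine c).continuous
  obtain ⟨ε, hε, hb⟩ := Metric.isOpen_iff.1 hV w h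
  have hsub : (univ.pi fun i => Metric.ball (w i) ε) ⊆ combine c ⁻¹' U := by
    rwa [← ball_pi _ hε]
  refine lt_of_lt_of_le ?_ (measure_mono hsub)
  rw [Measure.pi_pi]
  rw [pos_iff_ne_zero, Finset.prod_ne_zero_iff]
  intro i _
  -- A coefficient `w i` may be 0, on the boundary of the support; w i + ε / 2 is a positive point
  -- of the same ball.
  refine (expLaw_pos Metric.isOpen_ball (x := w i + ε / 2) (by linarith [hw i]) ?_).ne'
  rw [Metric.mem_ball, Real.dist_eq]
  rw [add_sub_cancel_left, abs_of_pos (by linarith)]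
  linarith

/-- The coefficients are almost surely positive, so the law is carried by the cone. -/
theorem coneLaw_eq_zero (c : ι → ι → ℝ) {U : Set (ι → ℝ)} (hU : IsOpen U)
    (h : ∀ w : ι → ℝ, (∀ i, 0 ≤ w i) → ∑ i, w i • c i ∉ U) : coneLaw c U = 0 := by
  rw [coneLaw, Measure.map_apply (combine c).continuous.measurable hU.measurableSet]
  refine measure_mono_null (t := ⋃ i, (fun w : ι → ℝ => w i) ⁻¹' (Iic 0)) ?_ ?_
  · intro w hw
    by_contra hc
    simp only [mem_iUnion, mem_preimage, mem_Iic, not_exists, not_le] at hc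
    exact h w (fun i => (hc i).le) hw
  · rw [measure_iUnion_null_iff]
    intro i
    exact Measure.pi_eval_preimage_null _ expLaw_apply_Iic

/-- The signed sum of the densities of the colorful cones vanishes. -/
theorem sum_det_mul_charFunDual [Nonempty ι] (a b : ι → ι → ℝ) (h : (ι → ℝ) →ₗ[ℝ] ℝ)
    (ha : ∀ i, h (a i) = 1) (hb : ∀ i, h (b i) = 1) (L : StrongDual ℝ (ι → ℝ)) :
    ∑ s : Finset ι, (((-1) ^ sᶜ.card * Matrix.det (s.piecewise a b) : ℝ) : ℂ) *
      charFunDual (coneLaw (s.piecewise a b)) L = 0 := by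
  have hne : ∀ x : ℝ, (1 - x * Complex.I : ℂ) ≠ 0 := by
    intro x hx
    have := congrArg Complex.re hx
    simp at this
  -- The determinant of m + m' is evaluated in two ways: a kernel vector makes it 0, and its
  -- expansion in the rows is the signed sum. The scalars at the rows are the factors of the
  -- characteristic functions.
  let m : ι → ι → ℂ := fun i j => (1 - L (a i) * Complex.I)⁻¹ * (a i j : ℂ)
  let m' : ι → ι → ℂ := fun i j => -(1 - L (b i) * Complex.I)⁻¹ * (b i j : ℂ)
  -- The coordinates of the functional h - iL. It takes the value 1 - iL(x) at each x among the `a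
  -- i` and `b i`, hence 1 at the rows of m and -1 at those of m'.
  let v : ι → ℂ := fun j => (h (Pi.single j 1) : ℂ) - L (Pi.single j 1) * Complex.I
  have hv : ∀ x : ι → ℝ, ∑ j, (x j : ℂ) * v j = h x - L x * Complex.I := by
    intro x
    have hx : x = ∑ j, x j • (Pi.single j 1 : ι → ℝ) := pi_eq_sum_univ' x
    have h1 : h x = ∑ j, x j * h (Pi.single j 1) := by
      conv_lhs => rw [hx]
      simp [map_sum]
    have h2 : L x = ∑ j, x j * L (Pi.single j 1) := by
      conv_lhs => rw [hx]
      simp [map_sum]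
    rw [h1, h2]
    push_cast
    rw [Finset.sum_mul, ← Finset.sum_sub_distrib]
    exact Finset.sum_congr rfl fun j _ => by simp only [v]; ring
  have hdet : Matrix.det (m + m' : Matrix ι ι ℂ) = 0 := by
    refine Matrix.exists_mulVec_eq_zero_iff.1 ⟨v, ?_, ?_⟩
    · intro h0
      obtain ⟨i⟩ := ‹Nonempty ι›
      have := hv (a i)
      simp only [h0, Pi.zero_apply, mul_zero, Finset.sum_const_zero, ha, Complex.ofReal_one] at this
      exact hne _ this.symm
    · ext i
      have h1 := hv (a i)
      have h2 := hv (b i)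
      rw [ha, Complex.ofReal_one] at h1
      rw [hb, Complex.ofReal_one] at h2
      simp only [Matrix.mulVec, dotProduct, Pi.add_apply, add_mul,
        Finset.sum_add_distrib, m, m', mul_assoc, ← Finset.mul_sum, h1, h2, Pi.zero_apply]
      rw [inv_mul_cancel₀ (hne _), neg_mul, inv_mul_cancel₀ (hne _)]
      ring
  -- Multilinear expansion over the set s of the rows taken from m; the signs in m' multiply to (-1)
  -- to the power |sᶜ|.
  have hexp := (Matrix.detRowAlternating (R := ℂ) (n := ι)).toMultilinearMap.map_add_univ m m'
  change Matrix.det (m + m' : Matrix ι ι ℂ) = _ at hexp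
  rw [hdet] at hexp
  rw [hexp]
  refine Finset.sum_congr rfl fun s _ => ?_
  have hs : s.piecewise m m' = fun i => (if i ∈ s then (1 : ℂ) else -1) •
      ((1 - L (s.piecewise a b i) * Complex.I)⁻¹ • fun j => ((s.piecewise a b i j : ℝ) : ℂ)) := by
    ext i j
    by_cases hi : i ∈ s <;> simp [hi, m, m']
  rw [hs, AlternatingMap.coe_multilinearMap, AlternatingMap.map_smul_univ, AlternatingMap.map_smul_univ]
  rw [charFunDual_coneLaw]
  have h3 : ∏ i, (if i ∈ s then (1 : ℂ) else -1) = (-1) ^ sᶜ.card := by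
    rw [Finset.prod_ite]
    simp only [Finset.prod_const_one, one_mul, Finset.prod_const]
    congr 2
    ext; simp
  have h4 : Matrix.detRowAlternating (fun i j => ((s.piecewise a b i j : ℝ) : ℂ)) =
      ((Matrix.det (s.piecewise a b) : ℝ) : ℂ) := by
    have := RingHom.map_det Complex.ofRealHom (s.piecewise a b : Matrix ι ι ℝ)
    exact this.symm
  rw [h3, h4]
  push_cast
  simp only [smul_eq_mul]
  ring

theorem charFunDual_sum_smul {κ : Type} (t : Finset κ) (f : κ → ℝ) (μ : κ → Measure (ι → ℝ))
    [∀ k, IsFiniteMeasure (μ k)] (L : StrongDual ℝ (ι → ℝ)) :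
    charFunDual (∑ k ∈ t, ENNReal.ofReal (f k) • μ k) L =
      ∑ k ∈ t, ((max (f k) 0 : ℝ) : ℂ) * charFunDual (μ k) L := by
  simp only [charFunDual_apply]
  rw [integral_finsetSum_measure]
  · refine Finset.sum_congr rfl fun k _ => ?_
    rw [integral_smul_measure, ENNReal.toReal_ofReal', Complex.real_smul]
  · intro k _
    refine Integrable.smul_measure ?_ ENNReal.ofReal_ne_top
    refine Integrable.of_bound (C := 1) (by fun_prop) ?_
    exact Filter.Eventually.of_forall fun x => by simp [Complex.norm_exp]

/-- The vanishing of a signed measure, expressed as equality of two positive ones: `ENNReal.ofReal`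
cuts off negative coefficients, so the two sides collect the positive and the negative parts. Finite
measures are determined by their characteristic functions, and those of the two sides differ by the
sum in `sum_det_mul_charFunDual`. -/
theorem signed_sum_coneLaw [Nonempty ι] (a b : ι → ι → ℝ) (h : (ι → ℝ) →ₗ[ℝ] ℝ)
    (ha : ∀ i, h (a i) = 1) (hb : ∀ i, h (b i) = 1) :
    ∑ s : Finset ι, ENNReal.ofReal ((-1) ^ sᶜ.card * Matrix.det (s.piecewise a b)) •
        coneLaw (s.piecewise a b) =
      ∑ s : Finset ι, ENNReal.ofReal (-((-1) ^ sᶜ.card * Matrix.det (s.piecewise a b))) •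
        coneLaw (s.piecewise a b) := by
  have hfin : ∀ f : Finset ι → ℝ,
      IsFiniteMeasure (∑ s, ENNReal.ofReal (f s) • coneLaw (s.piecewise a b)) := by
    intro f
    refine ⟨?_⟩
    rw [Measure.finsetSum_apply]
    exact ENNReal.sum_lt_top.2 fun s _ =>
      ENNReal.mul_lt_top ENNReal.ofReal_lt_top (measure_lt_top _ _)
  have := hfin fun s => (-1) ^ sᶜ.card * Matrix.det (s.piecewise a b)
  have := hfin fun s => -((-1) ^ sᶜ.card * Matrix.det (s.piecewise a b))
  refine Measure.ext_of_charFunDual ?_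
  ext L
  rw [charFunDual_sum_smul, charFunDual_sum_smul, ← sub_eq_zero, ← Finset.sum_sub_distrib,
    ← sum_det_mul_charFunDual a b h ha hb L]
  refine Finset.sum_congr rfl fun s _ => ?_
  rw [← sub_mul]
  congr 1
  rw [← Complex.ofReal_sub]
  congr 1
  generalize (-1 : ℝ) ^ sᶜ.card * Matrix.det (s.piecewise a b) = x
  rcases le_total x 0 with hx | hx
  · rw [max_eq_right hx, max_eq_left (by linarith)]; ring
  · rw [max_eq_left hx, max_eq_right (by linarith)]; ring

end Octahedron

/-! ### Removing a vector from a dependent conic combination. -/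

section
variable {ι E : Type} [Fintype ι] [AddCommGroup E] [Module ℝ E]

/-- A nonnegative combination of dependent vectors in an affine hyperplane can be written without
one of the vectors. -/
theorem exists_weight_eq_zero (c : ι → E) (h : E →ₗ[ℝ] ℝ) (hc : ∀ i, h (c i) = 1)
    (hdep : ¬ LinearIndependent ℝ c) (w : ι → ℝ) (hw : ∀ i, 0 ≤ w i) :
    ∃ w' : ι → ℝ, (∀ i, 0 ≤ w' i) ∧ (∃ i, w' i = 0) ∧ ∑ i, w' i • c i = ∑ i, w i • c i := by
  obtain ⟨m, hm, i₀, hi₀⟩ := Fintype.not_linearIndependent_iff.1 hdep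
  -- Evaluated by h, the relation shows that its coefficients sum to 0; as they are not all 0, one
  -- is positive.
  have hsum : ∑ i, m i = 0 := by
    have := congrArg h hm
    simpa [hc] using this
  obtain ⟨i₁, -, hi₁⟩ : ∃ i ∈ Finset.univ, 0 < m i := by
    by_contra! hcon
    have := (Finset.sum_eq_zero_iff_of_nonpos hcon).1 hsum i₀ (Finset.mem_univ _)
    exact hi₀ this
  -- The ratio at j is the largest multiple of the relation that can be subtracted without making a
  -- weight negative; it makes the weight of j vanish.
  obtain ⟨j, hj, hmin⟩ := Finset.exists_min_image (Finset.univ.filter fun i => 0 < m i)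
    (fun i => w i / m i) ⟨i₁, by simpa using hi₁⟩
  have hj : 0 < m j := by simpa using hj
  refine ⟨fun i => w i - w j / m j * m i, fun i => ?_, ⟨j, ?_⟩, ?_⟩
  · rcases le_or_gt (m i) 0 with hi | hi
    · have h1 : 0 ≤ w j / m j := div_nonneg (hw j) hj.le
      nlinarith [hw i]
    · have := hmin i (by simpa using hi)
      rw [le_div_iff₀ hi] at this
      linarith
  · simp only
    field_simp
    ring
  · simp only [sub_smul, Finset.sum_sub_distrib, mul_smul, ← Finset.smul_sum, hm, smul_zero, sub_zero]

end

section
open MeasureTheory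

variable {ι : Type} [Fintype ι] [DecidableEq ι]

/-- A vector in the cone of the vectors `a i` is also in one of the cones that arise from the
exchange of some of the `a i` against the `b i`. -/
theorem exists_other_cone [Nonempty ι] (a b : ι → ι → ℝ) (h : (ι → ℝ) →ₗ[ℝ] ℝ)
    (ha : ∀ i, h (a i) = 1) (hb : ∀ i, h (b i) = 1) (w : ι → ℝ) (hw : ∀ i, 0 ≤ w i) :
    ∃ s : Finset ι, s ≠ Finset.univ ∧ ∃ w' : ι → ℝ, (∀ i, 0 ≤ w' i) ∧
      ∑ i, w' i • s.piecewise a b i = ∑ i, w i • a i := by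
  by_cases hdep : LinearIndependent ℝ a
  swap
  -- For dependent `a i` some weight can be made 0, and the vector with this index is exchanged at
  -- no cost.
  · obtain ⟨w', h1, ⟨j, hj⟩, h2⟩ := exists_weight_eq_zero a h ha hdep w hw
    refine ⟨Finset.univ.erase j, by simp, w', h1, ?_⟩
    rw [← h2]
    refine Finset.sum_congr rfl fun i _ => ?_
    by_cases hij : i = j
    · rw [hij, hj, zero_smul, zero_smul]
    · rw [Finset.piecewise_eq_of_mem _ _ _ (by simpa using hij)]
  by_contra! hcon
  have hdet : Matrix.det (a : Matrix ι ι ℝ) ≠ 0 := by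
    have h1 : IsUnit (Matrix.of a) :=
      (Matrix.linearIndependent_rows_iff_isUnit (A := Matrix.of a)).1 hdep
    exact ((Matrix.isUnit_iff_isUnit_det (Matrix.of a)).1 h1).ne_zero
  have hhc : ∀ (s : Finset ι) i, h (s.piecewise a b i) = 1 := by
    intro s i
    by_cases hi : i ∈ s <;> simp [hi, ha, hb]
  have hh : ∀ (s : Finset ι) (u : ι → ℝ), h (∑ i, u i • s.piecewise a b i) = ∑ i, u i := by
    intro s u
    simp [map_sum, hhc]
  have hcont : Continuous h := LinearMap.continuous_of_finiteDimensional h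
  set p := ∑ i, w i • a i with hp
  -- All spanning vectors have height 1, so a point of a cone below height R has coefficients at
  -- most R. Thus below this height each other cone lies in a compact set `K s` that misses p, and U
  -- is a neighborhood of p which meets none of these cones.
  let R := h p + 1
  let K : Finset ι → Set (ι → ℝ) := fun s =>
    combine (s.piecewise a b) '' Set.Icc 0 (fun _ => R)
  have hK : ∀ s, IsCompact (K s) := fun s =>
    isCompact_Icc.image (combine (s.piecewise a b)).continuous
  let U : Set (ι → ℝ) := {q | h q < R} ∩ ⋂ s ∈ {s : Finset ι | s ≠ Finset.univ}, (K s)ᶜ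
  have hU : IsOpen U := (isOpen_lt hcont continuous_const).inter
    ((Set.toFinite _).isOpen_biInter fun s _ => (hK s).isClosed.isOpen_compl)
  have hpU : p ∈ U := by
    refine ⟨by simp [R], ?_⟩
    simp only [Set.mem_iInter, Set.mem_ofPred_eq]
    rintro s hs ⟨u, hu, hu'⟩
    exact hcon s hs u (fun i => hu.1 i) hu'
  have hpos : 0 < coneLaw a U := coneLaw_pos a hU hw hpU
  have hzero : ∀ s : Finset ι, s ≠ Finset.univ → coneLaw (s.piecewise a b) U = 0 := by
    intro s hs
    refine coneLaw_eq_zero _ hU fun u hu hmem => ?_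
    have h1 := hmem.2
    simp only [Set.mem_iInter, Set.mem_ofPred_eq] at h1
    refine h1 s hs ⟨u, ⟨fun i => hu i, fun i => ?_⟩, rfl⟩
    have h2 := hmem.1
    simp only [Set.mem_ofPred_eq, hh] at h2
    exact (Finset.single_le_sum (fun i _ => hu i) (Finset.mem_univ i)).trans h2.le
  -- On U only the summand of `univ` survives, with coefficient det a on one side and -det a on the
  -- other, each cut off at 0. As det a ≠ 0, exactly one of them vanishes.
  have key := congrArg (fun μ : Measure (ι → ℝ) => μ U) (signed_sum_coneLaw a b h ha hb)
  simp only [Measure.finsetSum_apply, Measure.smul_apply, smul_eq_mul] at key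
  rw [Finset.sum_eq_single Finset.univ (fun s _ hs => by rw [hzero s hs, mul_zero]) (by simp),
    Finset.sum_eq_single Finset.univ (fun s _ hs => by rw [hzero s hs, mul_zero]) (by simp)] at key
  have huniv : (Finset.univ : Finset ι).piecewise a b = a := by ext i; simp
  simp only [huniv, Finset.compl_univ, Finset.card_empty, pow_zero, one_mul] at key
  rw [ENNReal.mul_left_inj hpos.ne' (measure_lt_top _ _).ne] at key
  rcases lt_or_gt_of_ne hdet with hd | hd
  · rw [ENNReal.ofReal_of_nonpos hd.le] at key
    have := ENNReal.ofReal_eq_zero.1 key.symm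
    linarith
  · rw [ENNReal.ofReal_of_nonpos (p := -_) (by linarith)] at key
    have := ENNReal.ofReal_eq_zero.1 key
    linarith

end

/-! ## Positive dependence in terms of weights -/

/-- `w` is the family of coefficients of a convex combination of the `c i` that vanishes. -/
structure IsBalance {κ E : Type} [Fintype κ] [AddCommGroup E] [Module ℝ E] (c : κ → E)
    (w : κ → ℝ) : Prop where
  nonneg : ∀ i, 0 ≤ w i
  sum_eq_one : ∑ i, w i = 1
  sum_smul : ∑ i, w i • c i = 0

/-- Weights are attached to indices and not to points, so coinciding points of different colors need
no special care. -/
theorem zero_mem_convexHull_image {κ E : Type} [Fintype κ] [AddCommGroup E] [Module ℝ E]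
    (c : κ → E) (I : Set κ) :
    (0 : E) ∈ convexHull ℝ (c '' I) ↔ ∃ w, IsBalance c w ∧ ∀ i ∉ I, w i = 0 := by
  classical
  constructor
  · intro h
    let K : Set E := {x | ∃ w : κ → ℝ, (∀ i, 0 ≤ w i) ∧ ∑ i, w i = 1 ∧ (∀ i ∉ I, w i = 0) ∧
      ∑ i, w i • c i = x}
    have hK : convexHull ℝ (c '' I) ⊆ K := by
      refine convexHull_min ?_ ?_
      · rintro _ ⟨i, hi, rfl⟩
        refine ⟨Pi.single i 1, fun j => ?_, by simp, fun j hj => ?_, by simp [Pi.single_apply, ite_smul]⟩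
        · by_cases hji : j = i <;> simp [hji]
        · have : j ≠ i := fun h => hj (h ▸ hi)
          simp [this]
      · rintro x ⟨w, h1, h2, h3, rfl⟩ y ⟨w', h1', h2', h3', rfl⟩ s t hs ht hst
        refine ⟨fun i => s * w i + t * w' i, fun i => ?_, ?_, fun i hi => ?_, ?_⟩
        · have := h1 i; have := h1' i; positivity
        · rw [Finset.sum_add_distrib, ← Finset.mul_sum, ← Finset.mul_sum, h2, h2']; linarith
        · simp only [h3 i hi, h3' i hi]; ring
        · simp only [add_smul, mul_smul, Finset.sum_add_distrib, ← Finset.smul_sum]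
    obtain ⟨w, h1, h2, h3, h4⟩ := hK h
    exact ⟨w, ⟨h1, h2, h4⟩, h3⟩
  · rintro ⟨w, ⟨h1, h2, h3⟩, h4⟩
    have e1 : ∑ i with i ∈ I, w i = 1 := by
      rw [← h2, Finset.sum_filter]
      exact Finset.sum_congr rfl fun i _ => by by_cases hi : i ∈ I <;> simp [hi, h4]
    have e2 : ∑ i with i ∈ I, w i • c i = 0 := by
      rw [← h3, Finset.sum_filter]
      exact Finset.sum_congr rfl fun i _ => by by_cases hi : i ∈ I <;> simp [hi, h4]
    rw [← e2]
    refine (convex_convexHull ℝ _).sum_mem (fun i _ => h1 i) e1 fun i hi => ?_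
    exact subset_convexHull _ _ ⟨i, by simpa using hi, rfl⟩

/-- The octahedron lemma: in a family of `d + 1` pairs of points, a positively dependent selection
is not the only one. -/
theorem exists_other_balance {d : ℕ} (a b : Fin (d + 1) → Fin d → ℝ) (w : Fin (d + 1) → ℝ)
    (hw : IsBalance a w) : ∃ s : Finset (Fin (d + 1)), s ≠ Finset.univ ∧
      ∃ w', IsBalance (s.piecewise a b) w' := by
  -- The lift to height 1: the first coordinate records the sum of the weights, so convex
  -- combinations become linear ones.
  let H : (Fin d → ℝ) → Fin (d + 1) → ℝ := fun x => Fin.cons 1 x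
  have hH : ∀ (c : Fin (d + 1) → Fin d → ℝ) (u : Fin (d + 1) → ℝ),
      ∑ i, u i • H (c i) = Fin.cons (∑ i, u i) (∑ i, u i • c i) := by
    intro c u
    ext j
    refine Fin.cases ?_ (fun j => ?_) j <;> simp [H, Finset.sum_apply]
  obtain ⟨s, hs, w', h1, h2⟩ := exists_other_cone (fun i => H (a i)) (fun i => H (b i))
    (LinearMap.proj 0) (fun i => rfl) (fun i => rfl) w hw.nonneg
  refine ⟨s, hs, w', ?_⟩
  have h3 : ∀ i, s.piecewise (fun i => H (a i)) (fun i => H (b i)) i = H (s.piecewise a b i) := by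
    intro i; by_cases hi : i ∈ s <;> simp [hi]
  simp only [h3] at h2
  rw [hH, hH, hw.sum_eq_one, hw.sum_smul, Fin.cons_inj] at h2
  exact ⟨h1, h2.1, h2.2⟩

/-! ## The colorful Carathéodory theorem -/

section
variable {E : Type} [NormedAddCommGroup E] [InnerProductSpace ℝ E]

open scoped RealInnerProductSpace

/-- If no point of the segment from `z` to `v` is closer to the origin than `z`, then `v` lies in
the half-space beyond `z`. -/
theorem norm_sq_le_inner {z v : E}
    (h : ∀ t : ℝ, 0 ≤ t → t ≤ 1 → ‖z‖ ≤ ‖(1 - t) • z + t • v‖) : ‖z‖ ^ 2 ≤ ⟪z, v⟫ := by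
  have h1 : ∀ t : ℝ, 0 ≤ t → t ≤ 1 →
      ‖z‖ ^ 2 ≤ (1 - t) ^ 2 * ‖z‖ ^ 2 + 2 * ((1 - t) * t * ⟪z, v⟫) + t ^ 2 * ‖v‖ ^ 2 := by
    intro t h0 h1
    have h2 := pow_le_pow_left₀ (norm_nonneg _) (h t h0 h1) 2
    rw [norm_add_sq_real, norm_smul, norm_smul, mul_pow, mul_pow, real_inner_smul_left,
      real_inner_smul_right, Real.norm_eq_abs, Real.norm_eq_abs, sq_abs, sq_abs] at h2
    linarith
  by_contra! hlt
  set δ := ‖z‖ ^ 2 - ⟪z, v⟫ with hδ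
  have hδ0 : 0 < δ := by linarith
  -- Here M = ‖z - v‖² + δ, and the squared norm at t is ‖z‖² - 2tδ + t²(M - δ). This is less than
  -- ‖z‖² at t = δ / M, and δ ≤ M gives t ≤ 1.
  set M := ‖z‖ ^ 2 + ‖v‖ ^ 2 - 2 * ⟪z, v⟫ + δ with hM
  have hM0 : δ ≤ M := by
    have := norm_sub_sq_real z v
    have := sq_nonneg ‖z - v‖
    linarith
  have hM1 : 0 < M := lt_of_lt_of_le hδ0 hM0
  have ht := h1 (δ / M) (by positivity) ((div_le_one hM1).2 hM0)
  have hts : 0 < δ / M := by positivity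
  have htM : δ / M * M = δ := by field_simp
  nlinarith [mul_pos hts hts, mul_pos hts hδ0]

/-- More points than the dimension are linearly dependent, and all lie in the hyperplane where ⟪z,
·⟫ = ‖z‖², so one of them can be dropped. Pairing the combination with z shows that the new weights
sum to 1. -/
theorem exists_weight_eq_zero_of_inner [FiniteDimensional ℝ E] {κ : Type} [Fintype κ] (c : κ → E)
    (hcard : Module.finrank ℝ E < Fintype.card κ) {z : E} (hz : z ≠ 0)
    (hc : ∀ i, ⟪z, c i⟫ = ‖z‖ ^ 2) {w : κ → ℝ} (hw : ∀ i, 0 ≤ w i)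
    (hwz : ∑ i, w i • c i = z) : ∃ w' : κ → ℝ, (∀ i, 0 ≤ w' i) ∧ ∑ i, w' i = 1 ∧
      (∃ i, w' i = 0) ∧ ∑ i, w' i • c i = z := by
  have hz2 : ‖z‖ ^ 2 ≠ 0 := by simpa using hz
  have hdep : ¬ LinearIndependent ℝ c := by
    intro hli
    exact absurd (hli.fintype_card_le_finrank) (by omega)
  obtain ⟨w', h1, h2, h3⟩ := exists_weight_eq_zero c
    ((‖z‖ ^ 2)⁻¹ • (innerₗ E z)) (fun i => by simp [hc, hz]) hdep w hw
  refine ⟨w', h1, ?_, h2, h3.trans hwz⟩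
  have h4 := congrArg (fun x => ⟪z, x⟫) (h3.trans hwz)
  simp only [inner_sum, real_inner_smul_right, hc, real_inner_self_eq_norm_sq,
    ← Finset.sum_mul] at h4
  exact mul_right_cancel₀ hz2 (h4.trans (one_mul _).symm)

/-- The colorful Carathéodory theorem, for families of points. -/
theorem exists_colorful_balance_of_finrank [FiniteDimensional ℝ E] {ι κ : Type} [Fintype ι]
    [Fintype κ] [DecidableEq ι] (hcard : Module.finrank ℝ E < Fintype.card ι)
    (I : ι → Set κ) (c : ι → κ → E)
    (hc : ∀ i, ∃ w, IsBalance (c i) w ∧ ∀ k ∉ I i, w k = 0) :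
    ∃ (f : ι → κ) (w : ι → ℝ), (∀ i, f i ∈ I i) ∧ IsBalance (fun i => c i (f i)) w := by
  -- A color with the origin in its convex hull cannot lie strictly on the positive side of z.
  have hI : ∀ (i : ι) (z : E), ∃ k ∈ I i, ⟪z, c i k⟫ ≤ 0 := by
    intro i z
    obtain ⟨w, hw, hw0⟩ := hc i
    have h0 := (zero_mem_convexHull_image (c i) (I i)).2 ⟨w, hw, hw0⟩
    by_contra! hcon
    have h1 : convexHull ℝ (c i '' I i) ⊆ {x | 0 < ⟪z, x⟫} := by
      refine convexHull_min ?_ ?_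
      · rintro _ ⟨k, hk, rfl⟩
        exact hcon k hk
      · exact convex_halfSpace_gt (IsLinearMap.mk (inner_add_right z)
          (fun r x => real_inner_smul_right z x r)) 0
    have h2 := h1 h0
    simp at h2
  have hne : Nonempty ι := Fintype.card_pos_iff.1 (by omega)
  let F : Set (ι → κ) := {f | ∀ i, f i ∈ I i}
  let comb : (ι → κ) → (ι → ℝ) → E := fun f w => ∑ i, w i • c i (f i)
  have hmin : ∀ f : ι → κ, ∃ w ∈ stdSimplex ℝ ι, ∀ u ∈ stdSimplex ℝ ι,
      ‖comb f w‖ ≤ ‖comb f u‖ := by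
    intro f
    obtain ⟨i⟩ := hne
    obtain ⟨w, hw, hw'⟩ := (isCompact_stdSimplex ℝ ι).exists_isMinOn
      (f := fun w => ‖comb f w‖) ⟨_, single_mem_stdSimplex ℝ i⟩
      (by simp only [comb]; fun_prop)
    exact ⟨w, hw, fun u hu => hw' hu⟩
  choose W hW hWmin using hmin
  have hF : F.Nonempty := by
    choose f hf using fun i => hI i 0
    exact ⟨f, fun i => (hf i).1⟩
  -- Bárány's argument: among all colorful choices, take one whose simplex comes nearest to the
  -- origin.
  obtain ⟨f, hf, hfmin⟩ := Set.exists_min_image F (fun f => ‖comb f (W f)‖) (Set.toFinite F) hF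
  have hall : ∀ g ∈ F, ∀ u ∈ stdSimplex ℝ ι, ‖comb f (W f)‖ ≤ ‖comb g u‖ :=
    fun g hg u hu => (hfmin g hg).trans (hWmin g u hu)
  -- In any colorful simplex through the nearest point, moving towards a vertex cannot reduce the
  -- distance, so every vertex lies in the half-space beyond that point.
  have hmove : ∀ g ∈ F, ∀ u ∈ stdSimplex ℝ ι, comb g u = comb f (W f) → ∀ i,
      ‖comb f (W f)‖ ^ 2 ≤ ⟪comb f (W f), c i (g i)⟫ := by
    intro g hg u hu hgu i
    refine norm_sq_le_inner fun t h0 h1 => ?_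
    have hmem : (1 - t) • u + t • Pi.single i 1 ∈ stdSimplex ℝ ι :=
      convex_stdSimplex ℝ ι hu (single_mem_stdSimplex ℝ i) (by linarith) h0 (by ring)
    refine (hall g hg _ hmem).trans (le_of_eq ?_)
    congr 1
    rw [← hgu]
    simp only [comb, Pi.add_apply, Pi.smul_apply, smul_eq_mul, add_smul, mul_smul,
      Finset.sum_add_distrib, ← Finset.smul_sum]
    congr 2
    rw [Finset.sum_eq_single i] <;> simp +contextual
  refine ⟨f, W f, hf, (hW f).1, (hW f).2, ?_⟩
  by_contra hz
  change comb f (W f) ≠ 0 at hz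
  set z := comb f (W f) with hzdef
  -- The nearest point does not need all vertices: if all weights are positive, all vertices lie on
  -- the supporting hyperplane, because their weighted mean does, and there are too many of them to
  -- be independent.
  obtain ⟨w', h1, h2, ⟨j, hj⟩, h3⟩ : ∃ w' : ι → ℝ, (∀ i, 0 ≤ w' i) ∧ ∑ i, w' i = 1 ∧
      (∃ i, w' i = 0) ∧ ∑ i, w' i • c i (f i) = z := by
    by_cases h0 : ∃ i, W f i = 0
    · exact ⟨W f, (hW f).1, (hW f).2, h0, rfl⟩
    push Not at h0
    refine exists_weight_eq_zero_of_inner (fun i => c i (f i)) hcard hz ?_ (hW f).1 rfl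
    have hge := hmove f hf (W f) (hW f) rfl
    have hsum : ∑ i, W f i * (⟪z, c i (f i)⟫ - ‖z‖ ^ 2) = 0 := by
      simp only [mul_sub, Finset.sum_sub_distrib, ← Finset.sum_mul]
      rw [(hW f).2, one_mul, ← real_inner_self_eq_norm_sq, sub_eq_zero]
      calc _ = ⟪z, comb f (W f)⟫ := by simp only [comb, inner_sum, real_inner_smul_right]
        _ = ⟪z, z⟫ := rfl
    intro i
    have h4 := (Finset.sum_eq_zero_iff_of_nonneg fun i _ =>
      mul_nonneg ((hW f).1 i) (sub_nonneg.2 (hge i))).1 hsum i (Finset.mem_univ i)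
    rcases mul_eq_zero.1 h4 with h | h
    · exact absurd h (h0 i)
    · linarith
  -- The unused vertex of color j is exchanged for a point with ⟪z, ·⟫ ≤ 0; the nearest point is
  -- still in the simplex, against `hmove`.
  obtain ⟨k, hk, hk'⟩ := hI j z
  have h5 := hmove (Function.update f j k) (fun i => by
      by_cases hij : i = j
      · subst hij; simpa using hk
      · simpa [hij] using hf i) w' ⟨h1, h2⟩ (by
      rw [← h3]
      refine Finset.sum_congr rfl fun i _ => ?_
      by_cases hij : i = j
      · rw [hij, hj, zero_smul, zero_smul]
      · rw [Function.update_of_ne hij]) j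
  rw [Function.update_self] at h5
  have h6 : 0 < ‖z‖ ^ 2 := by positivity
  linarith

end

/-- The colorful Carathéodory theorem. -/
theorem exists_colorful_balance {d : ℕ} {κ : Type} [Fintype κ] (I : Fin (d + 1) → Set κ)
    (c : Fin (d + 1) → κ → Fin d → ℝ)
    (hc : ∀ i, ∃ w, IsBalance (c i) w ∧ ∀ k ∉ I i, w k = 0) :
    ∃ (f : Fin (d + 1) → κ) (w : Fin (d + 1) → ℝ), (∀ i, f i ∈ I i) ∧
      IsBalance (fun i => c i (f i)) w := by
  -- The type `Fin d → ℝ` carries the sup norm, while the argument needs the Euclidean inner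
  -- product.
  let e := (WithLp.linearEquiv 2 ℝ (Fin d → ℝ)).symm
  obtain ⟨f, w, hf, hw⟩ := exists_colorful_balance_of_finrank (E := EuclideanSpace ℝ (Fin d))
    (ι := Fin (d + 1)) (by simp) I (fun i k => e (c i k)) (fun i => by
      obtain ⟨w, hw, hw0⟩ := hc i
      refine ⟨w, ⟨hw.nonneg, hw.sum_eq_one, ?_⟩, hw0⟩
      simp only [← map_smul, ← map_sum, hw.sum_smul, map_zero])
  refine ⟨f, w, hf, hw.nonneg, hw.sum_eq_one, ?_⟩
  have := hw.sum_smul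
  simp only [← map_smul, ← map_sum] at this
  exact (LinearEquiv.map_eq_zero_iff e).1 this

/-! ## Positively dependent colorful sets -/

theorem PositivelyDependent.mono {d : ℕ} {X Y : Set (Point d)} (h : PositivelyDependent X)
    (hXY : X ⊆ Y) : PositivelyDependent Y :=
  ⟨h.1.mono hXY, convexHull_mono (Set.image_mono hXY) h.2⟩

theorem positivelyDependent_iff {d : ℕ} {X : Set (Point d)} :
    PositivelyDependent X ↔ (0 : Fin d → ℝ) ∈ convexHull ℝ (toReal '' X) := by
  refine ⟨fun h => h.2, fun h => ⟨?_, h⟩⟩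
  by_contra hX
  rw [Set.not_nonempty_iff_eq_empty] at hX
  simp [hX] at h

theorem positivelyDependent_image_iff {d : ℕ} {κ : Type} [Fintype κ] (c : κ → Point d)
    (I : Set κ) : PositivelyDependent (c '' I) ↔
      ∃ w, IsBalance (fun i => toReal (c i)) w ∧ ∀ i ∉ I, w i = 0 := by
  rw [positivelyDependent_iff, Set.image_image, zero_mem_convexHull_image]

theorem positivelyDependent_range_iff {d : ℕ} {κ : Type} [Fintype κ] (c : κ → Point d) :
    PositivelyDependent (Set.range c) ↔ ∃ w, IsBalance (fun i => toReal (c i)) w := by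
  rw [← Set.image_univ, positivelyDependent_image_iff]
  simp

theorem Selection.points_some {d k : ℕ} (σ : Fin k → Point d) :
    Selection.points (fun i => some (σ i)) = Set.range σ := by
  ext x
  simp [Selection.points]

/-- A positively dependent colorful set can be completed. -/
theorem IsPDCS.exists_full {d k : ℕ} {S : Config d k} {T : Selection d k} (h : IsPDCS S T)
    {σ₀ : Fin k → Point d} (hσ₀ : ∀ i, σ₀ i ∈ S i) :
    ∃ σ : Fin k → Point d, (∀ i, σ i ∈ S i) ∧ PositivelyDependent (Set.range σ) ∧
      ∀ i x, T i = some x → σ i = x := by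
  refine ⟨fun i => (T i).getD (σ₀ i), fun i => ?_, h.2.mono ?_, fun i x hx => by simp [hx]⟩
  · cases hi : T i with
    | none => simpa [hi] using hσ₀ i
    | some x => simpa [hi] using h.1 i x hi
  · rintro x ⟨i, hi⟩
    exact ⟨i, by simp [hi]⟩

theorem IsPDCS.of_full {d k : ℕ} {S : Config d k} {σ : Fin k → Point d}
    (hσ : ∀ i, σ i ∈ S i) (h : PositivelyDependent (Set.range σ)) :
    IsPDCS S fun i => some (σ i) :=
  ⟨fun i x hx => by rw [← Option.some_inj.1 hx]; exact hσ i, by rwa [Selection.points_some]⟩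

namespace AnotherInstance

variable (I : AnotherInstance)

theorem some_preferred_ne (i : Fin (I.d + 1)) : some (I.preferred i) ≠ I.T i := by
  unfold preferred
  split_ifs with h
  · rw [h]
    exact fun h => I.distinct i (Option.some_inj.1 h).symm
  · exact fun h' => h h'.symm

theorem mem_config_iff {i : Fin (I.d + 1)} {x : Point I.d} :
    x ∈ I.config i ↔ x = I.preferred i ∨ x = I.fallback i := by
  unfold config preferred fallback
  split_ifs <;> simp [or_comm]

/-- `L` contains a positively dependent set of points of all colors, different from `T`. -/
def HasOther (L : Config I.d (I.d + 1)) : Prop :=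
  ∃ σ : Fin (I.d + 1) → Point I.d, (∀ i, σ i ∈ L i) ∧ PositivelyDependent (Set.range σ) ∧
    (fun i => some (σ i)) ≠ I.T

/-- If T misses a color, its completion already differs from T. Otherwise the octahedron lemma is
applied to the points of T paired with the preferred points; these are all outside T, so exchanging
at least one of them suffices. -/
theorem hasOther_config : I.HasOther I.config := by
  obtain ⟨σ, h1, h2, h3⟩ := IsPDCS.exists_full (S := I.config) I.isPDCS (σ₀ := I.preferred)
    fun i => I.mem_config_iff.2 (Or.inl rfl)
  by_cases hT : (fun i => some (σ i)) = I.T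
  swap
  · exact ⟨σ, h1, h2, hT⟩
  obtain ⟨w, hw⟩ := (positivelyDependent_range_iff σ).1 h2
  obtain ⟨s, hs, w', hw'⟩ := exists_other_balance _ (fun i => toReal (I.preferred i)) w hw
  refine ⟨s.piecewise σ I.preferred, fun i => ?_, ?_, fun h => ?_⟩
  · by_cases hi : i ∈ s
    · simpa [hi] using h1 i
    · simpa [hi] using I.mem_config_iff.2 (Or.inl rfl)
  · rw [positivelyDependent_range_iff]
    refine ⟨w', ?_⟩
    convert hw' using 1
    ext i : 1
    by_cases hi : i ∈ s <;> simp [hi]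
  · apply hs
    rw [Finset.eq_univ_iff_forall]
    intro i
    by_contra hi
    have := congrFun h i
    simp only [Finset.piecewise_eq_of_notMem _ _ _ hi] at this
    exact I.some_preferred_ne i this

variable {O : Data → Bool}

/-- After the answer "yes", any solution can be completed with the preferred point at color i, and
this point alone makes it differ from T. After "no", the selection σ known before cannot use the
preferred point, so it uses the remaining one and survives. -/
theorem hasOther_step (hO : Decides O colorfulLP) {st : Config I.d (I.d + 1) × List Data}
    {i : Fin (I.d + 1)} (hi : st.1 i = I.config i) (h : I.HasOther st.1) :
    I.HasOther (I.step O st i).1 := by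
  obtain ⟨σ, h1, h2, h3⟩ := h
  have hmem : ∀ x, σ i = x → ∀ j, σ j ∈ Function.update st.1 i [x] j := by
    intro x hx j
    by_cases hj : j = i
    · subst hj; simp [hx]
    · simpa [hj] using h1 j
  have hOi := hO ⟨I.d, I.d + 1, Function.update st.1 i [I.preferred i]⟩
  change O (encConfig _) = true ↔ ∃ T : Selection I.d (I.d + 1), IsPDCS _ T at hOi
  simp only [step]
  split_ifs with hq
  · obtain ⟨T, hT⟩ := hOi.1 hq
    obtain ⟨τ, g1, g2, -⟩ := hT.exists_full (σ₀ := Function.update σ i (I.preferred i)) (by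
      intro j
      by_cases hj : j = i
      · subst hj; simp
      · simpa [hj] using h1 j)
    refine ⟨τ, g1, g2, fun h => ?_⟩
    have g3 := g1 i
    simp only [Function.update_self, List.mem_singleton] at g3
    have := congrFun h i
    simp only [g3] at this
    exact I.some_preferred_ne i this
  · have h4 := h1 i
    rw [hi, mem_config_iff] at h4
    rcases h4 with h4 | h4
    · exact absurd (hOi.2 ⟨_, IsPDCS.of_full (hmem _ h4) h2⟩) hq
    · exact ⟨σ, hmem _ h4, h2, h3⟩

/-- Colors are treated once each, so a color still holds its pair when its turn comes, as
`hasOther_step` requires, and its single point is not touched afterwards. -/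
theorem foldl_step (hO : Decides O colorfulLP) (l : List (Fin (I.d + 1))) (hl : l.Nodup)
    (st : Config I.d (I.d + 1) × List Data) (hst : ∀ i ∈ l, st.1 i = I.config i)
    (h : I.HasOther st.1) :
    I.HasOther (l.foldl (I.step O) st).1 ∧
      (∀ i ∈ l, ∃ x ∈ I.config i, (l.foldl (I.step O) st).1 i = [x]) ∧
      ∀ i ∉ l, (l.foldl (I.step O) st).1 i = st.1 i := by
  induction l generalizing st with
  | nil => exact ⟨h, by simp, by simp⟩
  | cons j l ih =>
    rw [List.nodup_cons] at hl
    have hne : ∀ i, i ≠ j → (I.step O st j).1 i = st.1 i := by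
      intro i hi
      simp only [step]
      split_ifs <;> rw [Function.update_of_ne hi]
    obtain ⟨h1, h2, h3⟩ := ih hl.2 (I.step O st j)
      (fun i hi => by
        rw [hne i fun h => hl.1 (h ▸ hi)]
        exact hst i (List.mem_cons_of_mem _ hi))
      (I.hasOther_step hO (hst j List.mem_cons_self) h)
    refine ⟨h1, fun i hi => ?_, fun i hi => ?_⟩
    · rcases List.mem_cons.1 hi with rfl | hi
      · rw [List.foldl_cons, h3 _ hl.1]
        simp only [step]
        split_ifs
        · exact ⟨_, I.mem_config_iff.2 (Or.inl rfl), Function.update_self ..⟩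
        · exact ⟨_, I.mem_config_iff.2 (Or.inr rfl), Function.update_self ..⟩
      · exact h2 i hi
    · rw [List.mem_cons, not_or] at hi
      rw [List.foldl_cons, h3 i hi.2, hne i hi.1]

/-- At the end, every color has exactly one point; together they are positively dependent. -/
theorem exists_output (hO : Decides O colorfulLP) : ∃ σ : Fin (I.d + 1) → Point I.d,
    (∀ i, σ i ∈ I.config i) ∧ (∀ i, (I.run O).1 i = [σ i]) ∧ PositivelyDependent (Set.range σ) ∧
      I.output O = (fun i => some (σ i)) ∧ I.output O ≠ I.T := by
  obtain ⟨⟨σ, h1, h2, h3⟩, h4, -⟩ := I.foldl_step hO (List.finRange (I.d + 1))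
    (List.nodup_finRange _) (I.config, []) (fun _ _ => rfl) I.hasOther_config
  choose x hx hx' using fun i => h4 i (List.mem_finRange i)
  have hσ : ∀ i, σ i = x i := fun i => by
    have := h1 i
    rwa [hx', List.mem_singleton] at this
  have hrun : ∀ i, (I.run O).1 i = [σ i] := fun i => by rw [hσ]; exact hx' i
  have hout : I.output O = fun i => some (σ i) := by
    ext i : 1
    simp [output, hrun]
  exact ⟨σ, fun i => by rw [hσ]; exact hx i, hrun, h2, hout, by rwa [hout]⟩

theorem length_queries (O : Data → Bool) : (I.queries O).length = I.d + 1 := by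
  have : ∀ (l : List (Fin (I.d + 1))) st,
      (l.foldl (I.step O) st).2.length = st.2.length + l.length := by
    intro l
    induction l with
    | nil => simp
    | cons j l ih =>
      intro st
      rw [List.foldl_cons, ih]
      simp [step]
      omega
  exact (this (List.finRange (I.d + 1)) (I.config, [])).trans (by simp)

end AnotherInstance

/-! ## Greedy replacements -/

/-- Replace a color by the given list of points, if this does not destroy all positively
dependent colorful sets. -/
def tryReplace {d k : ℕ} (O : Data → Bool) (L : Config d k) (e : Fin k × List (Point d)) :
    Config d k :=
  if O (encConfig (Function.update L e.1 e.2)) then Function.update L e.1 e.2 else L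

/-- There is a positively dependent colorful set. -/
def Feasible {d k : ℕ} (L : Config d k) : Prop := ∃ T : Selection d k, IsPDCS L T

theorem Decides.feasible {O : Data → Bool} (hO : Decides O colorfulLP) {d k : ℕ} (L : Config d k) :
    O (encConfig L) = true ↔ Feasible L := hO ⟨d, k, L⟩

section
variable {O : Data → Bool} {d k : ℕ}

theorem feasible_tryReplace (hO : Decides O colorfulLP) {L : Config d k} (h : Feasible L)
    (e : Fin k × List (Point d)) : Feasible (tryReplace O L e) := by
  unfold tryReplace
  split_ifs with hq
  · exact (hO.feasible _).1 hq
  · exact h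

theorem feasible_foldl_tryReplace (hO : Decides O colorfulLP) (es : List (Fin k × List (Point d)))
    {L : Config d k} (h : Feasible L) : Feasible (es.foldl (tryReplace O) L) := by
  induction es generalizing L with
  | nil => exact h
  | cons e es ih => exact ih (feasible_tryReplace hO h e)

/-- Each trial overwrites color i entirely, so its outcome depends on the other colors only and not
on earlier trials. Hence either some trial succeeds or every single point of the list is infeasible
for `L₀`. -/
theorem foldl_tryReplace_singletons (hO : Decides O colorfulLP) (i : Fin k)
    (xs : List (Point d)) (L L₀ : Config d k) (hL : L = L₀ ∨ ∃ x, L = Function.update L₀ i [x]) :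
    (∃ x, (xs.map fun x => (i, [x])).foldl (tryReplace O) L = Function.update L₀ i [x]) ∨
      (xs.map fun x => (i, [x])).foldl (tryReplace O) L = L₀ ∧
        ∀ x ∈ xs, ¬ Feasible (Function.update L₀ i [x]) := by
  induction xs generalizing L with
  | nil => rcases hL with h | h <;> simp [h]
  | cons x xs ih =>
    have hup : Function.update L i [x] = Function.update L₀ i [x] := by
      rcases hL with rfl | ⟨y, rfl⟩ <;> simp
    have hst : tryReplace O L (i, [x]) = Function.update L₀ i [x] ∨
        tryReplace O L (i, [x]) = L ∧ ¬ Feasible (Function.update L₀ i [x]) := by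
      unfold tryReplace
      simp only [hup]
      split_ifs with hq
      · exact Or.inl rfl
      · exact Or.inr ⟨rfl, fun h => hq ((hO.feasible _).2 h)⟩
    rw [List.map_cons, List.foldl_cons]
    rcases hst with h | ⟨h, h'⟩
    · rw [h]
      rcases ih (Function.update L₀ i [x]) (Or.inr ⟨x, rfl⟩) with h1 | ⟨h1, h2⟩
      · exact Or.inl h1
      · left
        -- Once a trial has succeeded, color i remains a single point whatever happens later.
        have hLL : ∀ (xs : List (Point d)) (L : Config d k),
            (∃ y, L = Function.update L₀ i [y]) →
            ∃ y, (xs.map fun x => (i, [x])).foldl (tryReplace O) L = Function.update L₀ i [y] := by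
          intro xs
          induction xs with
          | nil => intro L hL; exact hL
          | cons z xs ih =>
            rintro L ⟨y, rfl⟩
            refine ih _ ?_
            unfold tryReplace
            split_ifs
            · exact ⟨z, by simp⟩
            · exact ⟨y, rfl⟩
        exact hLL xs _ ⟨x, rfl⟩
    · rw [h]
      rcases ih L hL with h1 | ⟨h1, h2⟩
      · exact Or.inl h1
      · exact Or.inr ⟨h1, by simpa [h'] using h2⟩

/-- A colorful set uses at most one point of color i, so reducing the color to this point, or to any
point if none is used, cannot be refused. -/
theorem exists_foldl_tryReplace_singletons (hO : Decides O colorfulLP) (i : Fin k)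
    (L : Config d k) (hne : L i ≠ []) (hL : Feasible L) :
    ∃ x, ((L i).map fun x => (i, [x])).foldl (tryReplace O) L = Function.update L i [x] := by
  rcases foldl_tryReplace_singletons hO i (L i) L L (Or.inl rfl) with h | ⟨-, h⟩
  · exact h
  exfalso
  obtain ⟨T, hT⟩ := hL
  obtain ⟨x, hx, hTx⟩ : ∃ x ∈ L i, ∀ y, T i = some y → y = x := by
    cases hi : T i with
    | none =>
      obtain ⟨x, hx⟩ := List.exists_mem_of_ne_nil _ hne
      exact ⟨x, hx, by simp⟩
    | some x => exact ⟨x, hT.1 i x hi, by simp⟩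
  refine h x hx ⟨T, fun j y hj => ?_, hT.2⟩
  by_cases hji : j = i
  · subst hji; simp [hTx y hj]
  · simpa [hji] using hT.1 j y hj

/-- After all replacements by single points, every color has exactly one point. -/
theorem foldl_tryReplace_flatMap (hO : Decides O colorfulLP) (S : Config d k)
    (l : List (Fin k)) (hl : l.Nodup) (L : Config d k) (hne : ∀ i ∈ l, S i ≠ [])
    (hLS : ∀ i ∈ l, L i = S i) (hL : Feasible L) :
    (∀ i ∈ l, ∃ x, (l.flatMap fun i => (S i).map fun x => (i, [x])).foldl (tryReplace O) L i = [x]) ∧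
      ∀ i ∉ l, (l.flatMap fun i => (S i).map fun x => (i, [x])).foldl (tryReplace O) L i = L i := by
  induction l generalizing L with
  | nil => simp
  | cons j l ih =>
    rw [List.nodup_cons] at hl
    rw [List.flatMap_cons, List.foldl_append]
    obtain ⟨x, hx⟩ := exists_foldl_tryReplace_singletons hO j L
      (by rw [hLS j List.mem_cons_self]; exact hne j List.mem_cons_self) hL
    have hfeas := feasible_foldl_tryReplace hO ((L j).map fun x => (j, [x])) hL
    rw [hx] at hfeas
    rw [hLS j List.mem_cons_self] at hx
    rw [hx]
    obtain ⟨h1, h2⟩ := ih hl.2 (Function.update L j [x])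
      (fun i hi => hne i (List.mem_cons_of_mem _ hi))
      (fun i hi => by
        have hij : i ≠ j := fun h => hl.1 (h ▸ hi)
        rw [Function.update_of_ne hij]
        exact hLS i (List.mem_cons_of_mem _ hi)) hfeas
    refine ⟨fun i hi => ?_, fun i hi => ?_⟩
    · rcases List.mem_cons.1 hi with rfl | hi
      · exact ⟨x, by rw [h2 _ hl.1, Function.update_self]⟩
      · exact h1 i hi
    · rw [List.mem_cons, not_or] at hi
      rw [h2 i hi.2, Function.update_of_ne hi.1]

end

/-- The existence theorem behind the TFNP version. -/
theorem TFNPInstance.feasible (I : TFNPInstance) : Feasible I.S := by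
  -- The colorful Carathéodory theorem is about families over one finite index type; the union of
  -- the colors serves for all of them.
  let F : Finset (Point I.d) := Finset.univ.biUnion fun i => (I.S i).toFinset
  have hF : ∀ i, {x | x ∈ I.S i} = (fun x : F => x.1) '' {x | x.1 ∈ I.S i} := by
    intro i
    ext x
    simp only [Set.mem_ofPred_eq, Set.mem_image, Subtype.exists, exists_and_right, exists_eq_right]
    refine ⟨fun h => ⟨?_, h⟩, fun h => h.2⟩
    simpa [F] using ⟨i, h⟩
  obtain ⟨f, w, hf, hw⟩ := exists_colorful_balance (fun i => {x : F | x.1 ∈ I.S i})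
    (fun _ x => toReal x.1) fun i => by
      have := I.dependent i
      rwa [hF, positivelyDependent_image_iff] at this
  exact ⟨_, IsPDCS.of_full hf ((positivelyDependent_range_iff _).2 ⟨w, hw⟩)⟩

/-! ## Configurations as lists -/

/-- Programs work on types that do not depend on the instance. These lemmas replace the families of
an instance by nested lists with the same encoding. -/
theorem encList_eq {α β : Type} [HasEnc β] (e : α → Data) (g : α → β) (h : ∀ a, e a = enc (g a))
    (l : List α) : encList e l = enc (l.map g) := by
  induction l with
  | nil => rfl
  | cons a l ih => rw [List.map_cons, enc_cons, encList, ih, h]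

theorem encFamily_eq {α β : Type} [HasEnc β] {n : ℕ} (e : α → Data) (g : α → β)
    (h : ∀ a, e a = enc (g a)) (v : Fin n → α) :
    encFamily e v = enc (List.ofFn fun i => g (v i)) := by
  rw [encFamily, encList_eq e g h, List.map_ofFn]
  rfl

/-- The points of a configuration as lists of rational numbers. -/
def configList {d k : ℕ} (L : Config d k) : List (List (List ℚ)) :=
  List.ofFn fun i => (L i).map List.ofFn

theorem encConfig_eq {d k : ℕ} (L : Config d k) : encConfig L = enc (d, configList L) := by
  rw [encConfig, encFamily_eq (encList encPoint) (List.map List.ofFn) fun l =>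
    encList_eq encPoint List.ofFn (fun _ => rfl) l]
  rfl

theorem encOption_eq {α β : Type} [HasEnc β] (e : α → Data) (g : α → β) (h : ∀ a, e a = enc (g a))
    (x : Option α) : encOption e x = enc (x.map g) := by
  cases x with
  | none => rfl
  | some x => rw [encOption, h]; rfl

theorem encSelection_eq {d k : ℕ} (T : Selection d k) :
    encSelection T = enc (List.ofFn fun i => (T i).map List.ofFn) :=
  encFamily_eq _ _ (fun x => encOption_eq encPoint List.ofFn (fun _ => rfl) x) T

theorem ofFn_update {α : Type} {n : ℕ} (v : Fin n → α) (i : Fin n) (x : α) :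
    List.ofFn (Function.update v i x) = (List.ofFn v).set i x := by
  apply List.ext_getElem
  · simp
  · intro j h1 h2
    rw [List.getElem_ofFn, List.getElem_set, List.getElem_ofFn]
    by_cases h : (i : ℕ) = j
    · rw [if_pos h]
      have : (⟨j, by simpa using h1⟩ : Fin n) = i := Fin.ext h.symm
      rw [this, Function.update_self]
    · rw [if_neg h, Function.update_of_ne]
      intro h'
      exact h (by rw [← h'])

theorem configList_update {d k : ℕ} (L : Config d k) (i : Fin k) (v : List (Point d)) :
    configList (Function.update L i v) = (configList L).set i (v.map List.ofFn) := by
  rw [configList, configList, ← ofFn_update]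
  congr 1
  ext j : 1
  by_cases hj : j = i
  · subst hj; simp
  · simp [hj]

/-! ## Programs for greedy replacements -/

/-- Replace the color `e.1` by the first list of points if the oracle agrees, and by the second
otherwise. -/
def replaceStep (O : Data → Bool) (d : ℕ) (L : List (List (List ℚ)))
    (e : ℕ × List (List ℚ) × List (List ℚ)) : List (List (List ℚ)) :=
  if O (enc (d, L.set e.1 e.2.1)) then L.set e.1 e.2.1 else L.set e.1 e.2.2

/-- Replace the color `e.1` by the given list of points if the oracle agrees. -/
def tryStep (O : Data → Bool) (d : ℕ) (L : List (List (List ℚ)))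
    (e : ℕ × List (List ℚ)) : List (List (List ℚ)) :=
  if O (enc (d, L.set e.1 e.2)) then L.set e.1 e.2 else L

theorem bits_set_le {α : Type} [HasEnc α] (l : List α) (i : ℕ) (v : α) :
    bits (l.set i v) ≤ bits l + bits v := by
  induction l generalizing i with
  | nil => simp
  | cons a l ih =>
    cases i with
    | zero => rw [List.set_cons_zero, bits_cons, bits_cons]; omega
    | succ i => rw [List.set_cons_succ, bits_cons, bits_cons]; have := ih i; omega

theorem Poly.toData {α β : Type} [HasEnc α] [HasEnc β] {f : α → β} (hf : Poly f) :
    Poly (fun a => enc (f a)) := hf.congr_enc (fun a => a) (fun _ => rfl) fun _ => rfl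

/-- The input of the programs that follow: the dimension, the replacements, the configuration. -/
abbrev ReplaceInput (ε : Type) : Type := ℕ × List ε × List (List (List ℚ))

/-- One call per step, on the configuration with the first alternative. The question is recorded
exactly because part 1 prescribes the calls. -/
theorem polyQ_replaceStep : PolyQ
    (fun O (x : ReplaceInput (ℕ × List (List ℚ) × List (List ℚ)) × List (List (List ℚ)) ×
      (ℕ × List (List ℚ) × List (List ℚ))) => replaceStep O x.1.1 x.2.1 x.2.2)
    (fun _ x => [enc (x.1.1, x.2.1.set x.2.2.1 x.2.2.2.1)]) := by
  have h1 : Poly (fun x : ReplaceInput (ℕ × List (List ℚ) × List (List ℚ)) ×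
      List (List (List ℚ)) × (ℕ × List (List ℚ) × List (List ℚ)) =>
      (x.1.1, x.2.1.set x.2.2.1 x.2.2.2.1)) := by fun_prop
  have h2 : Poly (fun x : ReplaceInput (ℕ × List (List ℚ) × List (List ℚ)) ×
      List (List (List ℚ)) × (ℕ × List (List ℚ) × List (List ℚ)) =>
      x.2.1.set x.2.2.1 x.2.2.2.1) := by fun_prop
  have h3 : Poly (fun x : ReplaceInput (ℕ × List (List ℚ) × List (List ℚ)) ×
      List (List (List ℚ)) × (ℕ × List (List ℚ) × List (List ℚ)) =>
      x.2.1.set x.2.2.1 x.2.2.2.2) := by fun_prop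
  simpa [replaceStep] using PolyQ.ite (PolyQ.query.comp h1.toData) h2 h3

theorem replaceStep_bound : ∃ P : Polynomial ℕ, ∀ (O : Data → Bool)
    (a : ReplaceInput (ℕ × List (List ℚ) × List (List ℚ))) k,
    bits ((a.2.1.take k).foldl (fun L e => replaceStep O a.1 L e) a.2.2) ≤ P.eval (bits a) := by
  refine foldl_bound (by fun_prop) (by fun_prop) ⟨Polynomial.X, fun O a s b hb => ?_⟩
  have h1 := bits_le_of_mem hb
  have h2 := bits_set_le s b.1 b.2.1
  have h3 := bits_set_le s b.1 b.2.2
  obtain ⟨i, v, v'⟩ := b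
  obtain ⟨d, l, L⟩ := a
  simp only [bits_pair, Polynomial.eval_X, replaceStep] at *
  split <;> omega

/-- The loop of replacements. -/
theorem polyQ_replace : PolyQ
    (fun O (a : ReplaceInput (ℕ × List (List ℚ) × List (List ℚ))) =>
      a.2.1.foldl (fun L e => replaceStep O a.1 L e) a.2.2)
    (fun O a => foldlQ (fun O (a : ReplaceInput _) L e => replaceStep O a.1 L e)
      (fun _ x => [enc (x.1.1, x.2.1.set x.2.2.1 x.2.2.2.1)]) O a a.2.1 a.2.2) :=
  PolyQ.foldl (by fun_prop) (by fun_prop) polyQ_replaceStep replaceStep_bound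

theorem polyO_try : PolyO
    (fun O (a : ReplaceInput (ℕ × List (List ℚ))) =>
      a.2.1.foldl (fun L e => tryStep O a.1 L e) a.2.2) := by
  refine PolyO.foldl (by fun_prop) (by fun_prop) ?_ (foldl_bound (by fun_prop) (by fun_prop) ?_)
  · have h1 : Poly (fun x : ReplaceInput (ℕ × List (List ℚ)) ×
      List (List (List ℚ)) × (ℕ × List (List ℚ)) =>
      (x.1.1, x.2.1.set x.2.2.1 x.2.2.2)) := by fun_prop
    have h2 : Poly (fun x : ReplaceInput (ℕ × List (List ℚ)) ×
      List (List (List ℚ)) × (ℕ × List (List ℚ)) => x.2.1.set x.2.2.1 x.2.2.2) := by fun_prop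
    have h3 : Poly (fun x : ReplaceInput (ℕ × List (List ℚ)) ×
      List (List (List ℚ)) × (ℕ × List (List ℚ)) => x.2.1) := by fun_prop
    exact PolyO.ite ⟨_, PolyQ.query.comp h1.toData⟩ h2.polyO h3.polyO
  · refine ⟨Polynomial.X, fun O a s b hb => ?_⟩
    have h1 := bits_le_of_mem hb
    have h2 := bits_set_le s b.1 b.2
    obtain ⟨i, v⟩ := b
    obtain ⟨d, l, L⟩ := a
    simp only [bits_pair, Polynomial.eval_X, tryStep] at *
    split <;> omega

theorem configList_tryReplace {d k : ℕ} (O : Data → Bool) (L : Config d k)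
    (e : Fin k × List (Point d)) : configList (tryReplace O L e) =
      tryStep O d (configList L) (e.1, e.2.map List.ofFn) := by
  unfold tryReplace tryStep
  rw [encConfig_eq, configList_update]
  split_ifs
  · rw [configList_update]
  · rfl

theorem configList_foldl_tryReplace {d k : ℕ} (O : Data → Bool)
    (es : List (Fin k × List (Point d))) (L : Config d k) :
    configList (es.foldl (tryReplace O) L) =
      (es.map fun e => ((e.1 : ℕ), e.2.map List.ofFn)).foldl (fun L e => tryStep O d L e)
        (configList L) := by
  induction es generalizing L with
  | nil => rfl
  | cons e es ih => rw [List.foldl_cons, ih, configList_tryReplace]; rfl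

/-! ## The TFNP version -/

theorem zipIdx_ofFn {α : Type} {n : ℕ} (v : Fin n → α) :
    (List.ofFn v).zipIdx = List.ofFn fun i => (v i, (i : ℕ)) := by
  apply List.ext_getElem <;> simp

/-- The right side is computed from the encoded configuration; the left side is the list to which
the greedy argument applies. -/
theorem flatMap_finRange_eq {d k : ℕ} (S : Config d k) :
    ((List.finRange k).flatMap fun i => (S i).map fun x => (i, [x])).map
      (fun e => ((e.1 : ℕ), e.2.map List.ofFn)) =
    ((configList S).zipIdx.map fun x => x.1.map fun p => (x.2, [p])).flatten := by
  rw [configList, zipIdx_ofFn, List.map_ofFn, List.flatMap, List.map_flatten, List.map_map,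
    List.ofFn_eq_map]
  congr 1
  refine List.map_congr_left fun i _ => ?_
  simp

theorem mem_foldl_tryReplace {d k : ℕ} {O : Data → Bool} {es : List (Fin k × List (Point d))}
    {L : Config d k} {i : Fin k} {x : Point d} (hx : x ∈ es.foldl (tryReplace O) L i) :
    x ∈ L i ∨ ∃ e ∈ es, e.1 = i ∧ x ∈ e.2 := by
  induction es generalizing L with
  | nil => exact Or.inl hx
  | cons e es ih =>
    rcases ih hx with h | ⟨e', he', h⟩
    · unfold tryReplace at h
      split_ifs at h
      · by_cases hi : i = e.1
        · subst hi
          rw [Function.update_self] at h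
          exact Or.inr ⟨e, List.mem_cons_self, rfl, h⟩
        · rw [Function.update_of_ne hi] at h
          exact Or.inl h
      · exact Or.inl h
    · exact Or.inr ⟨e', List.mem_cons_of_mem _ he', h⟩

/-- The first points of the colors. -/
def heads {d k : ℕ} (L : Config d k) : Selection d k := fun i => (L i).head?

theorem encSelection_heads {d k : ℕ} (L : Config d k) :
    encSelection (heads L) = enc ((configList L).map fun l => l.head?) := by
  rw [encSelection_eq, configList, List.map_ofFn]
  congr 2
  ext i : 1
  simp [heads]

theorem Feasible.posDep_heads {d k : ℕ} {L : Config d k} (h : Feasible L)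
    (hL : ∀ i, (L i).length ≤ 1) : PositivelyDependent (heads L).points := by
  obtain ⟨T, hT⟩ := h
  refine hT.2.mono ?_
  rintro x ⟨i, hi⟩
  refine ⟨i, ?_⟩
  have h1 := hT.1 i x hi
  have h2 := hL i
  unfold heads
  match L i, h1, h2 with
  | [y], h1, _ => simpa using (List.mem_singleton.1 h1).symm

/-- Colorful Carathéodory guarantees feasibility at the start. Greedy replacements by single points
preserve it and leave one point per color, so the remaining points themselves are a solution. -/
theorem polyReducible_tfnp : PolyReducible colorfulLPTFNP colorfulLP := by
  have h0 : Poly (fun a : ℕ × List (List (List ℚ)) =>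
      ((a.1, (a.2.zipIdx.map fun x => x.1.map fun p => (x.2, [p])).flatten, a.2) :
        ReplaceInput (ℕ × List (List ℚ)))) := by fun_prop
  have h1 : Poly (fun L : List (List (List ℚ)) => L.map fun l => l.head?) := by fun_prop
  obtain ⟨q, c, p, h⟩ := h1.polyO.comp (polyO_try.comp h0.polyO)
  refine ⟨c, p, fun O hO (I : TFNPInstance) => ?_⟩
  let L := ((List.finRange (I.d + 1)).flatMap fun i => (I.S i).map fun x => (i, [x])).foldl
    (tryReplace O) I.S
  have hfeas : Feasible L := feasible_foldl_tryReplace hO _ I.feasible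
  obtain ⟨hs, -⟩ := foldl_tryReplace_flatMap hO I.S (List.finRange (I.d + 1))
    (List.nodup_finRange _) I.S (fun i _ hi => by
      obtain ⟨x, hx⟩ := (I.dependent i).1
      simp [hi] at hx) (fun _ _ => rfl) I.feasible
  have hsub : ∀ i, ∀ x ∈ L i, x ∈ I.S i := by
    intro i x hx
    rcases mem_foldl_tryReplace hx with h | ⟨e, he, hi, hxe⟩
    · exact h
    · obtain ⟨j, -, he⟩ := List.mem_flatMap.1 he
      obtain ⟨y, hy, rfl⟩ := List.mem_map.1 he
      subst hi
      rw [List.mem_singleton.1 hxe]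
      exact hy
  obtain ⟨t, h2, h3⟩ := h O (I.d, configList I.S)
  refine ⟨heads L, t, q O (I.d, configList I.S), ?_, ⟨fun i x hx => ?_, ?_⟩, ?_⟩
  · beta_reduce at h2
    rw [← flatMap_finRange_eq, ← configList_foldl_tryReplace, ← encSelection_heads,
      ← encConfig_eq] at h2
    exact h2
  · exact hsub i x (List.mem_of_mem_head? hx)
  · refine hfeas.posDep_heads fun i => ?_
    obtain ⟨x, hx⟩ := hs i (List.mem_finRange i)
    simp [L, hx]
  · rw [bits, ← encConfig_eq] at h3
    exact h3

/-! ## Finding Another Colorful Simplex -/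

@[fun_prop]
theorem Poly.some {α β : Type} [HasEnc α] [HasEnc β] {f : α → β} (hf : Poly f) :
    Poly (fun a => Option.some (f a)) := by
  have : Poly (fun a => ((1 : ℤ), f a)) := by fun_prop
  exact this.congr_enc (fun a => a) (fun _ => rfl) fun _ => rfl

/-- The instances of Finding Another Colorful Simplex as lists. -/
abbrev AnotherList : Type := ℕ × List (List ℚ × List ℚ) × List (Option (List ℚ))

/-- The lists that belong to an instance. -/
def AnotherInstance.toLists (I : AnotherInstance) : AnotherList :=
  (I.d, List.ofFn fun i => (List.ofFn (I.S i).1, List.ofFn (I.S i).2),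
    List.ofFn fun i => (I.T i).map List.ofFn)

theorem AnotherInstance.enc_eq (I : AnotherInstance) : I.enc = ColorfulLP.enc I.toLists := by
  rw [AnotherInstance.enc, encSelection_eq, encFamily_eq (fun s => .node (encPoint s.1) (encPoint s.2))
    (fun s : Point I.d × Point I.d => (List.ofFn s.1, List.ofFn s.2)) fun _ => rfl]
  rfl

/-- The replacements for an instance of Finding Another Colorful Simplex. -/
def anotherInput (a : AnotherList) : ReplaceInput (ℕ × List (List ℚ) × List (List ℚ)) :=
  (a.1, (a.2.1.zip a.2.2).zipIdx.map (fun x => (x.2,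
    [if decide (x.1.2 = some x.1.1.1) then x.1.1.2 else x.1.1.1],
    [if decide (x.1.2 = some x.1.1.1) then x.1.1.1 else x.1.1.2])),
    a.2.1.map fun s => [s.1, s.2])

theorem poly_anotherInput : Poly anotherInput := by
  unfold anotherInput
  fun_prop

theorem ofFn_zip {α β : Type} {n : ℕ} (v : Fin n → α) (w : Fin n → β) :
    (List.ofFn v).zip (List.ofFn w) = List.ofFn fun i => (v i, w i) := by
  apply List.ext_getElem <;> simp

theorem ofFn_eq_some_iff {d : ℕ} (t : Option (Point d)) (x : Point d) :
    t.map List.ofFn = some (List.ofFn x) ↔ t = some x := by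
  cases t with
  | none => simp
  | some y => simp [List.ofFn_inj]

theorem AnotherInstance.anotherInput_eq (I : AnotherInstance) : anotherInput I.toLists =
    (I.d, (List.finRange (I.d + 1)).map (fun i : Fin (I.d + 1) => ((i : ℕ), [List.ofFn (I.preferred i)],
      [List.ofFn (I.fallback i)])), configList I.config) := by
  simp only [anotherInput, toLists, ofFn_zip, zipIdx_ofFn, List.map_ofFn, configList]
  congr 2
  rw [List.ofFn_eq_map]
  refine List.map_congr_left fun i _ => ?_
  simp only [Function.comp, ofFn_eq_some_iff, decide_eq_true_eq, preferred, fallback]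
  split_ifs <;> rfl

/-- The program for Finding Another Colorful Simplex. -/
def anotherFinal (O : Data → Bool) (a : AnotherList) : List (List (List ℚ)) :=
  (anotherInput a).2.1.foldl (fun L e => replaceStep O (anotherInput a).1 L e) (anotherInput a).2.2

/-- The questions of the program for Finding Another Colorful Simplex. -/
def anotherQuestions (O : Data → Bool) (a : AnotherList) : List Data :=
  foldlQ (fun O (a : ReplaceInput _) L e => replaceStep O a.1 L e)
    (fun _ x => [enc (x.1.1, x.2.1.set x.2.2.1 x.2.2.2.1)]) O (anotherInput a)
    (anotherInput a).2.1 (anotherInput a).2.2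

theorem polyQ_anotherFinal : PolyQ anotherFinal anotherQuestions :=
  PolyQ.comp polyQ_replace poly_anotherInput

/-- The program on lists and `run` agree step by step, in the configurations and in the questions.
The questions use only the dimension from the input, so its other components `es` and `L₀` are
arbitrary. -/
theorem AnotherInstance.foldl_replaceStep (I : AnotherInstance) (O : Data → Bool)
    (es : List (ℕ × List (List ℚ) × List (List ℚ))) (L₀ : List (List (List ℚ)))
    (l : List (Fin (I.d + 1))) (st : Config I.d (I.d + 1) × List Data) :
    configList (l.foldl (I.step O) st).1 = (l.map (fun i : Fin (I.d + 1) => ((i : ℕ), [List.ofFn (I.preferred i)],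
      [List.ofFn (I.fallback i)]))).foldl (fun L e => replaceStep O I.d L e) (configList st.1) ∧
    (l.foldl (I.step O) st).2 = st.2 ++
      foldlQ (fun O (a : ReplaceInput _) L e => replaceStep O a.1 L e)
        (fun _ x => [ColorfulLP.enc (x.1.1, x.2.1.set x.2.2.1 x.2.2.2.1)]) O (I.d, es, L₀)
        (l.map (fun i : Fin (I.d + 1) => ((i : ℕ), [List.ofFn (I.preferred i)], [List.ofFn (I.fallback i)])))
        (configList st.1) := by
  induction l generalizing st with
  | nil => simp [foldlQ]
  | cons j l ih =>
    have hstep : configList (I.step O st j).1 = replaceStep O I.d (configList st.1)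
        ((j : ℕ), [List.ofFn (I.preferred j)], [List.ofFn (I.fallback j)]) := by
      simp only [step, replaceStep, encConfig_eq, configList_update, List.map_singleton]
      split_ifs <;> rw [configList_update] <;> rfl
    obtain ⟨h1, h2⟩ := ih (I.step O st j)
    rw [hstep] at h1 h2
    refine ⟨h1, ?_⟩
    rw [List.foldl_cons, h2, List.map_cons, foldlQ]
    simp only [step, encConfig_eq, configList_update, List.map_singleton, List.append_assoc]

theorem AnotherInstance.anotherFinal_eq (I : AnotherInstance) (O : Data → Bool) :
    anotherFinal O I.toLists = configList (I.run O).1 := by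
  rw [anotherFinal, anotherInput_eq, run, (I.foldl_replaceStep O [] [] _ _).1]

theorem AnotherInstance.anotherQuestions_eq (I : AnotherInstance) (O : Data → Bool) :
    anotherQuestions O I.toLists = I.queries O := by
  rw [anotherQuestions, anotherInput_eq, queries, run, (I.foldl_replaceStep O _ _ _ _).2]
  rfl

theorem another_program : ∃ (c : Code) (p : Polynomial ℕ), ∀ O : Data → Bool,
    Decides O colorfulLP → ∀ I : AnotherInstance,
      IsPDCS I.config (I.output O) ∧ I.output O ≠ I.T ∧ (I.queries O).length = I.d + 1 ∧
      ∃ t : ℕ, Runs O c I.enc (encSelection (I.output O)) t (I.queries O) ∧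
        t ≤ p.eval I.enc.size := by
  have h1 : Poly (fun L : List (List (List ℚ)) => L.map fun l => l.head?) := by fun_prop
  obtain ⟨c, p, h⟩ := PolyQ.comp h1 polyQ_anotherFinal
  refine ⟨c, p, fun O hO I => ?_⟩
  obtain ⟨σ, g1, g2, g3, g4, g5⟩ := I.exists_output hO
  refine ⟨by rw [g4]; exact IsPDCS.of_full g1 g3, g5, I.length_queries O, ?_⟩
  obtain ⟨t, ht, ht'⟩ := h O I.toLists
  refine ⟨t, ?_, by rw [I.enc_eq]; exact ht'⟩
  beta_reduce at ht
  rw [List.append_nil, I.anotherQuestions_eq, I.anotherFinal_eq, ← I.enc_eq,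
    ← encSelection_heads] at ht
  exact ht

/-! ## The method of Faddeev and LeVerrier -/

section

open Polynomial Matrix

variable {R : Type} [CommRing R] {n : ℕ}

/-- The values of the Horner scheme of the characteristic polynomial at the matrix itself. -/
noncomputable def horner (G : Matrix (Fin n) (Fin n) R) : ℕ → Matrix (Fin n) (Fin n) R
  | 0 => 1
  | k + 1 => G * horner G k + G.charpoly.coeff (n - 1 - k) • 1

theorem horner_eq_sum [Nontrivial R] (G : Matrix (Fin n) (Fin n) R) {k : ℕ} (hk : k ≤ n) :
    horner G k = ∑ j ∈ Finset.range (k + 1), G.charpoly.coeff (n - k + j) • G ^ j := by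
  induction k with
  | zero =>
    have : G.charpoly.coeff n = 1 := by
      have := G.charpoly_monic.coeff_natDegree
      rwa [G.charpoly_natDegree_eq_dim, Fintype.card_fin] at this
    simp [horner, this]
  | succ k ih =>
    rw [horner, ih (by omega), Finset.sum_range_succ' _ (k + 1), Finset.mul_sum]
    congr 1
    · refine Finset.sum_congr rfl fun j _ => ?_
      rw [mul_smul_comm, ← pow_succ', show n - (k + 1) + (j + 1) = n - k + j by omega]
    · rw [pow_zero, show n - (k + 1) + 0 = n - 1 - k by omega]

/-- This is the Cayley–Hamilton theorem: the complete Horner scheme evaluates the characteristic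
polynomial at G. -/
theorem horner_self [Nontrivial R] (G : Matrix (Fin n) (Fin n) R) : horner G n = 0 := by
  rw [horner_eq_sum G le_rfl, ← G.aeval_self_charpoly, aeval_eq_sum_range,
    G.charpoly_natDegree_eq_dim, Fintype.card_fin]
  simp

theorem mul_horner_sum [Nontrivial R] (G : Matrix (Fin n) (Fin n) R) (x : R) {k : ℕ} (hk : k ≤ n) :
    (x • 1 - G) * (∑ j ∈ Finset.range k, x ^ (k - 1 - j) • horner G j) + horner G k =
      (∑ j ∈ Finset.range (k + 1), G.charpoly.coeff (n - k + j) * x ^ j) • 1 := by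
  induction k with
  | zero =>
    have : G.charpoly.coeff n = 1 := by
      have := G.charpoly_monic.coeff_natDegree
      rwa [G.charpoly_natDegree_eq_dim, Fintype.card_fin] at this
    simp [horner, this]
  | succ k ih =>
    have h1 : ∑ j ∈ Finset.range (k + 1), x ^ (k + 1 - 1 - j) • horner G j =
        x • (∑ j ∈ Finset.range k, x ^ (k - 1 - j) • horner G j) + horner G k := by
      rw [Finset.sum_range_succ, Finset.smul_sum]
      congr 1
      · refine Finset.sum_congr rfl fun j hj => ?_
        have := Finset.mem_range.1 hj
        rw [smul_smul, ← pow_succ', show k - 1 - j + 1 = k + 1 - 1 - j by omega]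
      · simp
    have h2 : ∑ j ∈ Finset.range (k + 1 + 1), G.charpoly.coeff (n - (k + 1) + j) * x ^ j =
        x * (∑ j ∈ Finset.range (k + 1), G.charpoly.coeff (n - k + j) * x ^ j) +
          G.charpoly.coeff (n - 1 - k) := by
      rw [Finset.sum_range_succ' _ (k + 1), Finset.mul_sum]
      congr 1
      · refine Finset.sum_congr rfl fun j _ => ?_
        rw [show n - (k + 1) + (j + 1) = n - k + j by omega]
        ring
      · rw [pow_zero, mul_one, show n - (k + 1) + 0 = n - 1 - k by omega]
    rw [h1, h2, add_smul, mul_smul, ← ih (by omega), horner, mul_add, mul_smul_comm, smul_add,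
      sub_mul _ _ (horner G k), smul_mul_assoc, one_mul]
    abel

/-- The coefficients of the adjugate of the characteristic matrix. -/
theorem mul_horner_sum_self [Nontrivial R] (G : Matrix (Fin n) (Fin n) R) (x : R) :
    (x • 1 - G) * (∑ j ∈ Finset.range n, x ^ (n - 1 - j) • horner G j) =
      G.charpoly.eval x • 1 := by
  have := mul_horner_sum G x le_rfl
  rw [horner_self, add_zero] at this
  rw [this, eval_eq_sum_range, G.charpoly_natDegree_eq_dim, Fintype.card_fin]
  simp

/-- Jacobi's formula, with T in the role of the adjugate of x - G. Where p(x) ≠ 0, the determinant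
of x + r - G is p(x) times that of 1 + rT / p(x), and the linear coefficient of the latter in r is
tr T / p(x). -/
theorem eval_derivative_charpoly (G T : Matrix (Fin n) (Fin n) ℝ) (x : ℝ)
    (hx : G.charpoly.eval x ≠ 0) (hT : (x • 1 - G) * T = G.charpoly.eval x • 1) :
    G.charpoly.derivative.eval x = T.trace := by
  have heval : ∀ y : ℝ, G.charpoly.eval y = det (y • 1 - G) := by
    intro y
    rw [eval_charpoly, Matrix.scalar_apply, smul_one_eq_diagonal]
  set a := G.charpoly.eval x with ha
  obtain ⟨q, hq⟩ : ∃ q : ℝ[X], ∀ r : ℝ, G.charpoly.eval (x + r) =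
      a * (1 + (a⁻¹ * T.trace) * r + q.eval r * r ^ 2) := by
    refine ⟨(det (1 + (X : ℝ[X]) • (a⁻¹ • T).map C)).divX.divX, fun r => ?_⟩
    rw [← smul_eq_mul a⁻¹, ← trace_smul, ← det_one_add_smul, heval (x + r)]
    have h1 : (x + r) • 1 - G = (x • 1 - G) * (1 + r • a⁻¹ • T) := by
      rw [mul_add, mul_one, mul_smul_comm, mul_smul_comm, hT, smul_smul a⁻¹, inv_mul_cancel₀ hx,
        one_smul, add_smul]
      abel
    rw [h1, det_mul, ← heval]
  have h1 : HasDerivAt (fun r => G.charpoly.eval (x + r)) (G.charpoly.derivative.eval x) 0 := by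
    have := (G.charpoly.hasDerivAt (x + 0)).comp_const_add x 0
    simpa using this
  have h2 : HasDerivAt (fun r => a * (1 + (a⁻¹ * T.trace) * r + q.eval r * r ^ 2))
      (a * (a⁻¹ * T.trace)) 0 := by
    have h3 : HasDerivAt (fun r : ℝ => q.eval r * r ^ 2) 0 0 := by
      have h := (q.hasDerivAt 0).mul ((hasDerivAt_id (0 : ℝ)).pow 2)
      have h' : q.derivative.eval 0 * (id ^ 2 : ℝ → ℝ) 0 +
          q.eval 0 * (((2 : ℕ) : ℝ) * id (0 : ℝ) ^ (2 - 1) * 1) = 0 := by simp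
      rw [h'] at h
      exact h
    have h4 : HasDerivAt (fun r : ℝ => 1 + (a⁻¹ * T.trace) * r) (a⁻¹ * T.trace) 0 := by
      simpa using ((hasDerivAt_id (0 : ℝ)).const_mul (a⁻¹ * T.trace)).const_add 1
    simpa using (h4.add h3).const_mul a
  have h3 := h1.unique ((funext hq : (fun r => G.charpoly.eval (x + r)) = _) ▸ h2)
  rw [h3]
  field_simp

/-- The polynomial with coefficients tr (`horner` G j) equals the derivative of the characteristic
polynomial p: by Jacobi's formula they agree where p ≠ 0, and multiplication by p removes the
exception. Then coefficients are compared. -/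
theorem trace_horner_real (G : Matrix (Fin n) (Fin n) ℝ) {k : ℕ} (hk : k < n) :
    (horner G k).trace = (n - k : ℕ) * G.charpoly.coeff (n - k) := by
  let τ : ℝ[X] := ∑ j ∈ Finset.range n, C (horner G j).trace * X ^ (n - 1 - j)
  have hτ : τ = G.charpoly.derivative := by
    have h1 : (τ - G.charpoly.derivative) * G.charpoly = 0 := by
      refine Polynomial.funext fun x => ?_
      by_cases hx : G.charpoly.eval x = 0
      · simp [hx]
      · have := eval_derivative_charpoly G _ x hx (mul_horner_sum_self G x)
        rw [trace_sum] at this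
        rw [eval_mul, eval_sub, this]
        simp only [τ, eval_finsetSum, trace_smul, eval_mul, eval_C, eval_pow, eval_X, smul_eq_mul]
        rw [Finset.sum_congr rfl fun j _ => mul_comm (horner G j).trace (x ^ (n - 1 - j)),
          sub_self, zero_mul, eval_zero]
    rcases mul_eq_zero.1 h1 with h | h
    · exact sub_eq_zero.1 h
    · exact absurd h G.charpoly_monic.ne_zero
  have h2 := congrArg (fun p => p.coeff (n - 1 - k)) hτ
  simp only [τ, finsetSum_coeff, coeff_C_mul, coeff_X_pow, coeff_derivative] at h2
  rw [Finset.sum_eq_single k] at h2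
  · simp only [if_true, mul_one] at h2
    rw [h2, show n - k = n - 1 - k + 1 by omega]
    push_cast
    ring
  · intro j hj hjk
    have := Finset.mem_range.1 hj
    rw [if_neg (by omega), mul_zero]
  · intro h
    exact absurd (Finset.mem_range.2 hk) h

theorem horner_map (G : Matrix (Fin n) (Fin n) ℤ) (k : ℕ) :
    (horner G k).map (Int.castRingHom ℝ) = horner (G.map (Int.castRingHom ℝ)) k := by
  induction k with
  | zero => simp [horner]
  | succ k ih =>
    rw [horner, horner, ← ih, Matrix.charpoly_map, Polynomial.coeff_map, ← Matrix.map_mul]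
    ext i j
    simp only [Matrix.map_apply, Matrix.add_apply, Matrix.smul_apply, Matrix.one_apply, smul_eq_mul,
      map_add, mul_ite, mul_one, mul_zero]
    split_ifs <;> simp

/-- Traces in the Horner recursion, compared with `trace_horner_real`, express the next coefficient
by a trace. The detour through ℝ is due to the derivative. -/
theorem trace_mul_horner (G : Matrix (Fin n) (Fin n) ℤ) {k : ℕ} (hk : k + 1 < n) :
    (G * horner G k).trace = -((k + 1 : ℕ) * G.charpoly.coeff (n - 1 - k)) := by
  have h1 : (horner G (k + 1)).trace = (n - (k + 1) : ℕ) * G.charpoly.coeff (n - (k + 1)) := by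
    have := trace_horner_real (G.map (Int.castRingHom ℝ)) hk
    rw [← horner_map, charpoly_map, coeff_map] at this
    have h2 : (((horner G (k + 1)).trace : ℤ) : ℝ) =
      (((n - (k + 1) : ℕ) * G.charpoly.coeff (n - (k + 1)) : ℤ) : ℝ) := by
      push_cast
      rw [eq_intCast] at this
      rw [← this]
      simp [trace]
    exact_mod_cast h2
  rw [horner, trace_add, trace_smul, trace_one, Fintype.card_fin, smul_eq_mul] at h1
  rw [show n - 1 - k = n - (k + 1) by omega] at h1 ⊢
  have h3 : ((n - (k + 1) : ℕ) : ℤ) = n - (k + 1) := by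
    rw [Nat.cast_sub (by omega)]; push_cast; ring
  rw [h3] at h1
  push_cast
  linear_combination h1

/-- The recursion of Faddeev and LeVerrier. -/
def leVerrier (G : Matrix (Fin n) (Fin n) ℤ) : ℕ → Matrix (Fin n) (Fin n) ℤ × ℤ
  | 0 => (1, -G.trace)
  | k + 1 =>
    (G * (leVerrier G k).1 + (leVerrier G k).2 • 1,
      -(G * (G * (leVerrier G k).1 + (leVerrier G k).2 • 1)).trace / ((k + 1 : ℕ) + 1))

theorem leVerrier_eq (G : Matrix (Fin n) (Fin n) ℤ) {k : ℕ} (hk : k < n) :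
    (leVerrier G k).1 = horner G k ∧
      (k + 1 < n → (leVerrier G k).2 = G.charpoly.coeff (n - 1 - k)) := by
  induction k with
  | zero =>
    refine ⟨rfl, fun h => ?_⟩
    have := trace_mul_horner G h
    simp only [horner, mul_one] at this
    simp [leVerrier, this]
  | succ k ih =>
    obtain ⟨h1, h2⟩ := ih (by omega)
    have h3 : G * (leVerrier G k).1 + (leVerrier G k).2 • 1 = horner G (k + 1) := by
      rw [h1, h2 hk]; rfl
    refine ⟨h3, fun h => ?_⟩
    rw [leVerrier]
    simp only [h3]
    rw [trace_mul_horner G h, neg_neg]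
    -- The division in the recursion is exact, so all of it takes place in the integers.
    exact Int.mul_ediv_cancel_left _ (by positivity)

end

/-! ### The kernel of a symmetric matrix of corank one. -/

section

open Polynomial Matrix

variable {n : ℕ}

theorem commute_horner {R : Type} [CommRing R] (G : Matrix (Fin n) (Fin n) R) (k : ℕ) :
    Commute G (horner G k) := by
  induction k with
  | zero => exact Commute.one_right G
  | succ k ih =>
    exact ((Commute.refl G).mul_right ih).add_right ((Commute.one_right G).smul_right _)

theorem transpose_horner {R : Type} [CommRing R] {G : Matrix (Fin n) (Fin n) R} (hG : Gᵀ = G)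
    (k : ℕ) : (horner G k)ᵀ = horner G k := by
  induction k with
  | zero => exact transpose_one
  | succ k ih =>
    rw [horner, transpose_add, transpose_mul, ih, hG, transpose_smul, transpose_one,
      (commute_horner G k).eq]

/-- A symmetric matrix is diagonalizable, so a one-dimensional kernel makes 0 a simple eigenvalue;
the coefficient of X is, up to sign, the product of the other eigenvalues. -/
theorem coeff_one_charpoly_ne_zero {G : Matrix (Fin n) (Fin n) ℝ} (hG : Gᵀ = G) {w : Fin n → ℝ}
    (hw : w ≠ 0) (hker : ∀ μ, G *ᵥ μ = 0 ↔ ∃ s : ℝ, μ = s • w) : G.charpoly.coeff 1 ≠ 0 := by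
  have hH : G.IsHermitian := by
    rw [IsHermitian, conjTranspose_eq_transpose_of_trivial, hG]
  have hdet : G.det = 0 := exists_mulVec_eq_zero_iff.1 ⟨w, hw, (hker w).2 ⟨1, by simp⟩⟩
  rw [hH.det_eq_prod_eigenvalues] at hdet
  obtain ⟨i, -, hi⟩ := Finset.prod_eq_zero_iff.1 hdet
  have hi : hH.eigenvalues i = 0 := by simpa using hi
  have huniq : ∀ j, j ≠ i → hH.eigenvalues j ≠ 0 := by
    intro j hji hj
    have h1 := hH.mulVec_eigenvectorBasis i
    have h2 := hH.mulVec_eigenvectorBasis j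
    rw [hi, zero_smul] at h1
    rw [hj, zero_smul] at h2
    obtain ⟨s, hs⟩ := (hker _).1 h1
    obtain ⟨t, ht⟩ := (hker _).1 h2
    have hb := hH.eigenvectorBasis.orthonormal
    -- Two orthonormal eigenvectors for the eigenvalue 0 would both be multiples of w, hence
    -- parallel.
    have hcomb : t • hH.eigenvectorBasis i = s • hH.eigenvectorBasis j := by
      ext k
      have e1 : hH.eigenvectorBasis i k = s * w k := congrFun hs k
      have e2 : hH.eigenvectorBasis j k = t * w k := congrFun ht k
      rw [PiLp.smul_apply, PiLp.smul_apply, e1, e2, smul_eq_mul, smul_eq_mul]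
      ring
    have ht0 : t = 0 := by
      have := congrArg (fun v => inner ℝ (hH.eigenvectorBasis i) v) hcomb
      simpa [inner_smul_right, hb.inner_eq_zero hji.symm] using this
    rw [ht0, zero_smul] at ht
    have hz : hH.eigenvectorBasis j = 0 := by
      ext k
      exact congrFun ht k
    have := hb.norm_eq_one j
    rw [hz, norm_zero] at this
    exact zero_ne_one this
  rw [hH.charpoly_eq, ← Finset.mul_prod_erase _ _ (Finset.mem_univ i)]
  simp only [hi, map_zero, sub_zero]
  rw [coeff_X_mul, coeff_zero_eq_eval_zero, eval_prod, Finset.prod_ne_zero_iff]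
  intro j hj
  simpa using huniq j (Finset.ne_of_mem_erase hj)

/-- The row sums of the last matrix of the recursion are a vector in the kernel. -/
theorem exists_rowSum_leVerrier {G : Matrix (Fin n) (Fin n) ℤ} (hG : Gᵀ = G) {w : Fin n → ℝ}
    (hw0 : ∀ i, 0 ≤ w i) (hw : w ≠ 0)
    (hker : ∀ μ, G.map (Int.castRingHom ℝ) *ᵥ μ = 0 ↔ ∃ s : ℝ, μ = s • w) :
    ∃ s : ℝ, s ≠ 0 ∧ ∀ i, ((∑ j, (leVerrier G (n - 1)).1 i j : ℤ) : ℝ) = s * w i := by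
  have hn : 0 < n := by
    rcases Nat.eq_zero_or_pos n with rfl | h
    · exact absurd (Subsingleton.elim w 0) hw
    · exact h
  set Gr := G.map (Int.castRingHom ℝ) with hGr
  have hGrT : Grᵀ = Gr := by rw [hGr, ← transpose_map, hG]
  set H := horner Gr (n - 1) with hH
  have hHT : Hᵀ = H := transpose_horner hGrT _
  -- Cayley–Hamilton with vanishing constant coefficient. Hence every column of H is in the kernel,
  -- that is, a multiple of w.
  have hGH : Gr * H = 0 := by
    have h1 := horner_self Gr
    obtain ⟨m, rfl⟩ : ∃ m, n = m + 1 := ⟨n - 1, by omega⟩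
    rw [horner] at h1
    have hdet : Gr.det = 0 := exists_mulVec_eq_zero_iff.1 ⟨w, hw, (hker w).2 ⟨1, by simp⟩⟩
    have h2 : Gr.charpoly.coeff 0 = 0 := by
      rw [det_eq_sign_charpoly_coeff] at hdet
      simpa using hdet
    rw [show m + 1 - 1 - m = 0 by omega, h2, zero_smul, add_zero] at h1
    exact h1
  -- The trace of H is the linear coefficient of the characteristic polynomial, so H does not
  -- vanish.
  have htr : H.trace ≠ 0 := by
    rw [hH, trace_horner_real Gr (by omega), show n - (n - 1) = 1 by omega]
    simpa using coeff_one_charpoly_ne_zero hGrT hw hker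
  have hcol : ∀ j, ∃ u : ℝ, (fun i => H i j) = u • w := by
    intro j
    refine (hker _).1 ?_
    ext i
    exact congrFun (congrFun hGH i) j
  choose u hu using hcol
  have hHij : ∀ i j, H i j = u j * w i := fun i j => congrFun (hu j) i
  have hsymm : ∀ i j, u j * w i = u i * w j := fun i j => by
    rw [← hHij, ← hHij]
    exact congrFun (congrFun hHT j) i |>.symm ▸ rfl
  have hle : ∀ i j, (((leVerrier G (n - 1)).1 i j : ℤ) : ℝ) = H i j := by
    intro i j
    rw [(leVerrier_eq G (by omega)).1, hH, hGr, ← horner_map]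
    rfl
  obtain ⟨i₀, hi₀⟩ : ∃ i, w i ≠ 0 := Function.ne_iff.1 hw
  have hi₀pos : 0 < w i₀ := lt_of_le_of_ne (hw0 i₀) (Ne.symm hi₀)
  -- Row sums spare the search for a nonzero column. They do not cancel: by symmetry H is a multiple
  -- of w wᵀ, and w is nonnegative.
  refine ⟨∑ j, u j, fun hsum => ?_, fun i => ?_⟩
  · have h1 : u i₀ * ∑ j, w j = 0 := by
      rw [Finset.mul_sum, Finset.sum_congr rfl fun j _ => (hsymm i₀ j).symm, ← Finset.sum_mul,
        hsum, zero_mul]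
    have h2 : 0 < ∑ j, w j := Finset.sum_pos' (fun j _ => hw0 j) ⟨i₀, Finset.mem_univ _, hi₀pos⟩
    have h3 : u i₀ = 0 := by
      rcases mul_eq_zero.1 h1 with h | h
      · exact h
      · exact absurd h h2.ne'
    apply htr
    rw [trace]
    refine Finset.sum_eq_zero fun j _ => ?_
    rw [diag_apply, hHij]
    have := hsymm i₀ j
    rw [h3, zero_mul] at this
    rcases mul_eq_zero.1 this with h | h
    · rw [h, zero_mul]
    · exact absurd h hi₀
  · push_cast
    rw [Finset.sum_mul]
    exact Finset.sum_congr rfl fun j _ => by rw [hle, hHij]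

end

/-! ## The recursion of Faddeev and LeVerrier on lists -/

/-- The scalar product of two lists. -/
def dot (x y : List ℤ) : ℤ := ((x.zip y).map fun p => p.1 * p.2).sum

/-- The scalar products of the rows of `G` with the rows of `M`. -/
def mulRows (G M : List (List ℤ)) : List (List ℤ) := G.map fun r => M.map fun s => dot r s

/-- Add a scalar matrix. -/
def addDiag (c : ℤ) (M : List (List ℤ)) : List (List ℤ) :=
  M.zipIdx.map fun r => r.1.zipIdx.map fun x => if decide (x.2 = r.2) then x.1 + c else x.1

/-- The sum of the scalar products of corresponding rows. -/
def traceMul (G M : List (List ℤ)) : ℤ := ((G.zip M).map fun p => dot p.1 p.2).sum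

/-- One step of the recursion. -/
def leVerrierStep (G : List (List ℤ)) (s : ℕ × ℤ × List (List ℤ)) : ℕ × ℤ × List (List ℤ) :=
  (s.1 + 1, -(traceMul G (addDiag s.2.1 (mulRows G s.2.2))) / ((s.1 + 1 : ℕ) + 1),
    addDiag s.2.1 (mulRows G s.2.2))

/-- The start of the recursion. -/
def leVerrierInit (G : List (List ℤ)) : ℕ × ℤ × List (List ℤ) :=
  (0, -(traceMul G (addDiag 1 (G.map fun r => r.map fun _ => 0))),
    addDiag 1 (G.map fun r => r.map fun _ => 0))

/-- The row sums of the last matrix of the recursion. -/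
def leVerrierRowSums (G : List (List ℤ)) : List ℤ :=
  (G.tail.foldl (fun s _ => leVerrierStep G s) (leVerrierInit G)).2.2.map List.sum

section
variable {α : Type} [HasEnc α]

@[fun_prop]
theorem Poly.dot {x y : α → List ℤ} (hx : Poly x) (hy : Poly y) :
    Poly (fun a => dot (x a) (y a)) := by
  unfold ColorfulLP.dot
  fun_prop

@[fun_prop]
theorem Poly.mulRows {x y : α → List (List ℤ)} (hx : Poly x) (hy : Poly y) :
    Poly (fun a => mulRows (x a) (y a)) := by
  unfold ColorfulLP.mulRows
  fun_prop

@[fun_prop]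
theorem Poly.traceMul {x y : α → List (List ℤ)} (hx : Poly x) (hy : Poly y) :
    Poly (fun a => traceMul (x a) (y a)) := by
  unfold ColorfulLP.traceMul
  fun_prop

@[fun_prop]
theorem Poly.addDiag {c : α → ℤ} {x : α → List (List ℤ)} (hc : Poly c) (hx : Poly x) :
    Poly (fun a => addDiag (c a) (x a)) := by
  unfold ColorfulLP.addDiag
  fun_prop

end

theorem natAbs_sum_le {l : List ℤ} {B : ℕ} (h : ∀ z ∈ l, z.natAbs ≤ B) :
    l.sum.natAbs ≤ l.length * B := by
  induction l with
  | nil => simp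
  | cons a l ih =>
    rw [List.sum_cons, List.length_cons, add_mul, one_mul]
    have h1 := h a List.mem_cons_self
    have h2 := ih fun z hz => h z (List.mem_cons_of_mem _ hz)
    have h3 := Int.natAbs_add_le a l.sum
    omega

theorem natAbs_dot_le {x y : List ℤ} {S a b : ℕ} (hS : x.length ≤ S)
    (hx : ∀ z ∈ x, z.natAbs ≤ a) (hy : ∀ z ∈ y, z.natAbs ≤ b) : (dot x y).natAbs ≤ S * (a * b) := by
  refine (natAbs_sum_le (B := a * b) ?_).trans ?_
  · intro z hz
    obtain ⟨p, hp, rfl⟩ := List.mem_map.1 hz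
    obtain ⟨h1, h2⟩ := List.of_mem_zip hp
    rw [Int.natAbs_mul]
    exact Nat.mul_le_mul (hx _ h1) (hy _ h2)
  · refine Nat.mul_le_mul_right _ ?_
    rw [List.length_map, List.length_zip]
    omega

/-- The matrix has at most `S` rows of length at most `S`, with entries of size at most `E`. -/
def MatrixBound (S E : ℕ) (M : List (List ℤ)) : Prop :=
  M.length ≤ S ∧ ∀ r ∈ M, r.length ≤ S ∧ ∀ z ∈ r, z.natAbs ≤ E

theorem matrixBound_bits (G : List (List ℤ)) : MatrixBound (bits G) (2 ^ bits G) G := by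
  refine ⟨(length_le_bits G).le, fun r hr => ⟨?_, fun z hz => ?_⟩⟩
  · exact ((length_le_bits r).trans (bits_le_of_mem hr)).le
  · have h1 := (bits_le_of_mem hz).trans (bits_le_of_mem hr)
    rw [bits_int] at h1
    exact (Nat.lt_size_self _).le.trans (Nat.pow_le_pow_right (by norm_num) (by omega))

theorem MatrixBound.mulRows {S a b : ℕ} {G M : List (List ℤ)} (hG : MatrixBound S a G)
    (hM : MatrixBound S b M) : MatrixBound S (S * (a * b)) (mulRows G M) := by
  refine ⟨by simpa [ColorfulLP.mulRows] using hG.1, fun r hr => ?_⟩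
  obtain ⟨g, hg, rfl⟩ := List.mem_map.1 hr
  refine ⟨by simpa using hM.1, fun z hz => ?_⟩
  obtain ⟨s, hs, rfl⟩ := List.mem_map.1 hz
  exact natAbs_dot_le (hG.2 g hg).1 (hG.2 g hg).2 (hM.2 s hs).2

theorem MatrixBound.addDiag {S a : ℕ} {c : ℤ} {M : List (List ℤ)} (hM : MatrixBound S a M) :
    MatrixBound S (a + c.natAbs) (addDiag c M) := by
  refine ⟨by simpa [ColorfulLP.addDiag] using hM.1, fun r hr => ?_⟩
  obtain ⟨g, hg, rfl⟩ := List.mem_map.1 hr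
  have hg' := hM.2 g.1 (List.fst_mem_of_mem_zipIdx hg)
  refine ⟨by simpa using hg'.1, fun z hz => ?_⟩
  obtain ⟨s, hs, rfl⟩ := List.mem_map.1 hz
  have h1 := hg'.2 s.1 (List.fst_mem_of_mem_zipIdx hs)
  have h2 := Int.natAbs_add_le s.1 c
  split <;> omega

theorem MatrixBound.natAbs_traceMul_le {S a b : ℕ} {G M : List (List ℤ)} (hG : MatrixBound S a G)
    (hM : MatrixBound S b M) : (traceMul G M).natAbs ≤ S * (S * (a * b)) := by
  refine (natAbs_sum_le (B := S * (a * b)) ?_).trans ?_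
  · intro z hz
    obtain ⟨p, hp, rfl⟩ := List.mem_map.1 hz
    obtain ⟨h1, h2⟩ := List.of_mem_zip hp
    exact natAbs_dot_le (hG.2 _ h1).1 (hG.2 _ h1).2 (hM.2 _ h2).2
  · refine Nat.mul_le_mul_right _ ?_
    rw [List.length_map, List.length_zip]
    have := hG.1
    omega

/-- A step multiplies the bound by at most 2^(5S): numbers of summands are absorbed by S ≤ 2^S, and
division only decreases absolute values. So bit lengths grow by a fixed amount per step. -/
theorem leVerrierStep_bound {S E k : ℕ} {G : List (List ℤ)} (hG : MatrixBound S (2 ^ S) G)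
    {s : ℕ × ℤ × List (List ℤ)} (h1 : s.1 ≤ k) (h2 : s.2.1.natAbs ≤ E)
    (h3 : MatrixBound S E s.2.2) :
    (leVerrierStep G s).1 ≤ k + 1 ∧ (leVerrierStep G s).2.1.natAbs ≤ 2 ^ (5 * S) * E ∧
      MatrixBound S (2 ^ (5 * S) * E) (leVerrierStep G s).2.2 := by
  have hS : S + 1 ≤ 2 ^ S := Nat.lt_two_pow_self
  have hE : S * (2 ^ S * E) + s.2.1.natAbs ≤ 2 ^ (2 * S) * E := by
    have : 1 ≤ 2 ^ S := Nat.one_le_two_pow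
    calc S * (2 ^ S * E) + s.2.1.natAbs ≤ S * (2 ^ S * E) + 2 ^ S * E := by nlinarith
      _ = (S + 1) * (2 ^ S * E) := by ring
      _ ≤ 2 ^ S * (2 ^ S * E) := Nat.mul_le_mul_right _ hS
      _ = 2 ^ (2 * S) * E := by ring
  have hM : MatrixBound S (2 ^ (2 * S) * E) (leVerrierStep G s).2.2 := by
    have := (hG.mulRows h3).addDiag (c := s.2.1)
    exact ⟨this.1, fun r hr => ⟨(this.2 r hr).1, fun z hz => ((this.2 r hr).2 z hz).trans hE⟩⟩
  have hle : 2 ^ (2 * S) * E ≤ 2 ^ (5 * S) * E :=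
    Nat.mul_le_mul_right _ (Nat.pow_le_pow_right (by norm_num) (by omega))
  refine ⟨Nat.add_le_add_right h1 1, ?_,
    hM.1, fun r hr => ⟨(hM.2 r hr).1, fun z hz => ((hM.2 r hr).2 z hz).trans hle⟩⟩
  refine (Int.natAbs_ediv_le_natAbs _ _).trans ?_
  rw [Int.natAbs_neg]
  refine (hG.natAbs_traceMul_le hM).trans ?_
  calc S * (S * (2 ^ S * (2 ^ (2 * S) * E))) ≤ 2 ^ S * (2 ^ S * (2 ^ S * (2 ^ (2 * S) * E))) := by
        gcongr <;> omega
    _ = 2 ^ (5 * S) * E := by ring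

theorem leVerrierInit_bound {S : ℕ} {G : List (List ℤ)} (hG : MatrixBound S (2 ^ S) G) :
    (leVerrierInit G).2.1.natAbs ≤ 2 ^ (3 * S) ∧ MatrixBound S (2 ^ (3 * S)) (leVerrierInit G).2.2 := by
  have hS : S ≤ 2 ^ S := Nat.lt_two_pow_self.le
  have h0 : MatrixBound S 0 (G.map fun r => r.map fun _ => 0) := by
    refine ⟨by simpa using hG.1, fun r hr => ?_⟩
    obtain ⟨g, hg, rfl⟩ := List.mem_map.1 hr
    exact ⟨by simpa using (hG.2 g hg).1, by simp⟩
  have h1 : MatrixBound S 1 (leVerrierInit G).2.2 := by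
    have h2 := h0.addDiag (c := 1)
    rwa [Int.natAbs_one, zero_add] at h2
  constructor
  · rw [leVerrierInit]
    simp only [Int.natAbs_neg]
    refine (hG.natAbs_traceMul_le h1).trans ?_
    calc S * (S * (2 ^ S * 1)) ≤ 2 ^ S * (2 ^ S * (2 ^ S * 1)) := by gcongr
      _ = 2 ^ (3 * S) := by ring
  · exact ⟨h1.1, fun r hr => ⟨(h1.2 r hr).1, fun z hz =>
      ((h1.2 r hr).2 z hz).trans Nat.one_le_two_pow⟩⟩

theorem bits_list_le {α : Type} [HasEnc α] {l : List α} {S b : ℕ} (hS : l.length ≤ S)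
    (h : ∀ a ∈ l, bits a ≤ b) : bits l ≤ 1 + S * (1 + b) := by
  refine le_trans ?_ (Nat.add_le_add_left (Nat.mul_le_mul_right (1 + b) hS) 1)
  induction l with
  | nil => simp [bits_nil]
  | cons a l ih =>
    have h1 := h a List.mem_cons_self
    have h2 := ih (by simp at hS; omega) fun a ha => h a (List.mem_cons_of_mem _ ha)
    rw [bits_cons, List.length_cons, add_mul, one_mul]
    omega

theorem bits_int_le_of_natAbs_le {z : ℤ} {e : ℕ} (h : z.natAbs ≤ 2 ^ e) : bits z ≤ e + 2 := by
  rw [bits_int]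
  have : z.natAbs.size ≤ e + 1 := by
    rw [Nat.size_le, pow_succ]
    have : 1 ≤ 2 ^ e := Nat.one_le_two_pow
    omega
  omega

theorem MatrixBound.bits_le {S e : ℕ} {M : List (List ℤ)} (hM : MatrixBound S (2 ^ e) M) :
    bits M ≤ 1 + S * (1 + (1 + S * (1 + (e + 2)))) :=
  bits_list_le hM.1 fun r hr => bits_list_le (hM.2 r hr).1 fun z hz =>
    bits_int_le_of_natAbs_le ((hM.2 r hr).2 z hz)

@[fun_prop]
theorem Poly.leVerrierRowSums {α : Type} [HasEnc α] {G : α → List (List ℤ)} (hG : Poly G) :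
    Poly (fun a => leVerrierRowSums (G a)) := by
  refine Poly.comp (g := ColorfulLP.leVerrierRowSums) ?_ hG
  have h1 : Poly leVerrierInit := by
    unfold leVerrierInit
    fun_prop
  have h2 : Poly (fun x : List (List ℤ) × (ℕ × ℤ × List (List ℤ)) × List ℤ =>
      leVerrierStep x.1 x.2.1) := by
    unfold leVerrierStep
    fun_prop
  have h3 : Poly (fun G : List (List ℤ) =>
      G.tail.foldl (fun s _ => leVerrierStep G s) (leVerrierInit G)) := by
    refine Poly.foldl (step := fun G s _ => leVerrierStep G s) (by fun_prop) h1 h2 ?_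
    -- With S the size of G, all numbers after j steps are at most 2^(3S + 5Sj) in absolute value.
    -- As j ≤ S, their bit length is quadratic in S.
    have key : ∀ (G l : List (List ℤ)),
        (l.foldl (fun s _ => leVerrierStep G s) (leVerrierInit G)).1 ≤ l.length ∧
        (l.foldl (fun s _ => leVerrierStep G s) (leVerrierInit G)).2.1.natAbs ≤
          2 ^ (3 * bits G + 5 * bits G * l.length) ∧
        MatrixBound (bits G) (2 ^ (3 * bits G + 5 * bits G * l.length))
          (l.foldl (fun s _ => leVerrierStep G s) (leVerrierInit G)).2.2 := by
      intro G l
      have hG := matrixBound_bits G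
      induction l using List.reverseRecOn with
      | nil => simpa using ⟨rfl, leVerrierInit_bound hG⟩
      | append_singleton l r ih =>
        have := leVerrierStep_bound hG ih.1 ih.2.1 ih.2.2
        rw [List.foldl_append, List.foldl_cons, List.foldl_nil, List.length_append,
          List.length_singleton]
        have e : 2 ^ (5 * bits G) * 2 ^ (3 * bits G + 5 * bits G * l.length) =
          2 ^ (3 * bits G + 5 * bits G * (l.length + 1)) := by ring
        rw [e] at this
        exact this
    refine ⟨2 + (1 + Polynomial.X) + (3 * Polynomial.X + 5 * Polynomial.X * Polynomial.X + 2) +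
      (1 + Polynomial.X * (1 + (1 + Polynomial.X *
        (1 + (3 * Polynomial.X + 5 * Polynomial.X * Polynomial.X + 2))))), fun G k => ?_⟩
    obtain ⟨e1, e2, e3⟩ := key G (G.tail.take k)
    set st := (G.tail.take k).foldl (fun s _ => leVerrierStep G s) (leVerrierInit G)
    have hlen : (G.tail.take k).length ≤ bits G := by
      have := length_le_bits G
      rw [List.length_take, List.length_tail]
      omega
    have hexp : 2 ^ (3 * bits G + 5 * bits G * (G.tail.take k).length) ≤
        2 ^ (3 * bits G + 5 * bits G * bits G) :=
      Nat.pow_le_pow_right (by norm_num) (Nat.add_le_add_left (Nat.mul_le_mul_left _ hlen) _)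
    have f1 : bits st.1 ≤ 1 + bits G := (bits_nat_le _).trans (by omega)
    have f2 := bits_int_le_of_natAbs_le (e2.trans hexp)
    have f3 : MatrixBound (bits G) (2 ^ (3 * bits G + 5 * bits G * bits G)) st.2.2 :=
      ⟨e3.1, fun r hr => ⟨(e3.2 r hr).1, fun z hz => ((e3.2 r hr).2 z hz).trans hexp⟩⟩
    have f4 := f3.bits_le
    have f5 : bits st = 2 + bits st.1 + bits st.2.1 + bits st.2.2 := by
      show 1 + bits st.1 + (1 + bits st.2.1 + bits st.2.2) = _
      omega
    rw [f5]
    simp only [Polynomial.eval_add, Polynomial.eval_mul, Polynomial.eval_one, Polynomial.eval_X,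
      Polynomial.eval_ofNat]
    omega
  unfold ColorfulLP.leVerrierRowSums
  fun_prop

/-! ### Lists and matrices -/

/-- The rows of a matrix. -/
def matrixList {m n : ℕ} (A : Matrix (Fin m) (Fin n) ℤ) : List (List ℤ) :=
  List.ofFn fun i => List.ofFn (A i)

theorem dot_ofFn {n : ℕ} (x y : Fin n → ℤ) : dot (List.ofFn x) (List.ofFn y) = x ⬝ᵥ y := by
  rw [dot, ofFn_zip, List.map_ofFn, List.sum_ofFn]
  rfl

section
variable {n : ℕ}

theorem mulRows_matrixList (G M : Matrix (Fin n) (Fin n) ℤ) :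
    mulRows (matrixList G) (matrixList M) = matrixList (G * M.transpose) := by
  simp only [mulRows, matrixList, List.map_ofFn, Function.comp_def, dot_ofFn]
  rfl

theorem addDiag_matrixList (c : ℤ) (M : Matrix (Fin n) (Fin n) ℤ) :
    addDiag c (matrixList M) = matrixList (M + c • 1) := by
  simp only [addDiag, matrixList, zipIdx_ofFn, List.map_ofFn, Function.comp_def, decide_eq_true_eq]
  congr 1
  ext i : 1
  congr 1
  ext j
  by_cases h : i = j
  · subst h
    simp only [Matrix.add_apply, Matrix.smul_apply, Matrix.one_apply_eq, smul_eq_mul, mul_one,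
      if_true]
  · have : ¬ (j : ℕ) = i := fun h' => h (Fin.ext h'.symm)
    simp only [Matrix.add_apply, Matrix.smul_apply, Matrix.one_apply_ne h, smul_eq_mul, mul_zero,
      add_zero, if_neg this]

theorem traceMul_matrixList (G M : Matrix (Fin n) (Fin n) ℤ) :
    traceMul (matrixList G) (matrixList M) = (G * M.transpose).trace := by
  simp only [traceMul, matrixList, ofFn_zip, List.map_ofFn, Function.comp_def, dot_ofFn,
    List.sum_ofFn]
  rfl

/-- `mulRows` and `traceMul` multiply rows by rows and so involve a transpose. Symmetry of all
iterates makes the result the product wanted in the recursion. -/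
theorem transpose_leVerrier {G : Matrix (Fin n) (Fin n) ℤ} (hG : G.transpose = G) {k : ℕ}
    (hk : k < n) : (leVerrier G k).1.transpose = (leVerrier G k).1 := by
  rw [(leVerrier_eq G hk).1, transpose_horner hG]

theorem leVerrierRowSums_matrixList {G : Matrix (Fin n) (Fin n) ℤ} (hG : G.transpose = G) :
    leVerrierRowSums (matrixList G) = List.ofFn fun i => ∑ j, (leVerrier G (n - 1)).1 i j := by
  have hinit : leVerrierInit (matrixList G) =
      (0, (leVerrier G 0).2, matrixList (leVerrier G 0).1) := by
    have h1 : (matrixList G).map (fun r => r.map fun _ => (0 : ℤ)) =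
        matrixList (0 : Matrix (Fin n) (Fin n) ℤ) := by
      simp only [matrixList, List.map_ofFn, Function.comp_def]
      rfl
    rw [leVerrierInit, h1, addDiag_matrixList, traceMul_matrixList, zero_add, one_smul,
      Matrix.transpose_one, mul_one]
    rfl
  have key : ∀ l : List (List ℤ), l.length < n ∨ l = [] →
      l.foldl (fun s _ => leVerrierStep (matrixList G) s) (leVerrierInit (matrixList G)) =
        (l.length, (leVerrier G l.length).2, matrixList (leVerrier G l.length).1) := by
    intro l
    induction l using List.reverseRecOn with
    | nil => intro _; exact hinit
    | append_singleton l r ih =>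
      intro h
      have hl : l.length + 1 < n := by simpa using h
      rw [List.foldl_append, List.foldl_cons, List.foldl_nil, ih (Or.inl (by omega)),
        List.length_append, List.length_singleton, leVerrierStep]
      simp only [mulRows_matrixList, transpose_leVerrier hG (show l.length < n by omega),
        addDiag_matrixList, traceMul_matrixList]
      have hT : (G * (leVerrier G l.length).1 + (leVerrier G l.length).2 • 1).transpose =
          G * (leVerrier G l.length).1 + (leVerrier G l.length).2 • 1 :=
        transpose_leVerrier hG hl
      rw [hT]
      rfl
  have hlen : (matrixList G).tail.length = n - 1 := by simp [matrixList]
  rw [leVerrierRowSums, key _ (by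
    rw [hlen]
    rcases Nat.eq_zero_or_pos n with rfl | h
    · right; simp [matrixList]
    · left; omega), hlen]
  simp only [matrixList, List.map_ofFn, Function.comp_def, List.sum_ofFn]

end

/-! ## Equilibria from complementary vectors -/

/-- Changing payoffs by a positive factor and a constant does not alter best responses. The
hypotheses say that x and y put weight only on pure strategies whose payoff attains the upper bound
t. -/
theorem isNash_of_complementary {m n : ℕ} {A B P Q : Matrix (Fin m) (Fin n) ℝ} {a b t : ℝ}
    (ha : 0 < a) (hP : ∀ i j, P i j = a * A i j + b) (hQ : ∀ i j, Q i j = a * B i j + b)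
    {x : Fin m → ℝ} {y : Fin n → ℝ} (hx : ∀ i, 0 ≤ x i) (hy : ∀ j, 0 ≤ y j)
    (hX : 0 < ∑ i, x i) (hY : 0 < ∑ j, y j)
    (h1 : ∀ i, ∑ j, P i j * y j ≤ t) (h1' : ∀ i, x i ≠ 0 → ∑ j, P i j * y j = t)
    (h2 : ∀ j, ∑ i, Q i j * x i ≤ t) (h2' : ∀ j, y j ≠ 0 → ∑ i, Q i j * x i = t) :
    IsNash A B (fun i => x i / ∑ i, x i) (fun j => y j / ∑ j, y j) := by
  have key : ∀ {p q : ℕ} {M R : Matrix (Fin p) (Fin q) ℝ} (_ : ∀ i j, R i j = a * M i j + b)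
      {u : Fin p → ℝ} {v : Fin q → ℝ} (_ : ∀ i, 0 ≤ u i) (_ : 0 < ∑ i, u i) (_ : 0 < ∑ j, v j)
      (_ : ∀ i, ∑ j, R i j * v j ≤ t) (_ : ∀ i, u i ≠ 0 → ∑ j, R i j * v j = t),
      ∀ u' ∈ stdSimplex ℝ (Fin p), u' ⬝ᵥ M.mulVec (fun j => v j / ∑ j, v j) ≤
        (fun i => u i / ∑ i, u i) ⬝ᵥ M.mulVec (fun j => v j / ∑ j, v j) := by
    intro p q M R hR u v hu hU hV g g' u' hu'
    have hM : ∀ i, M.mulVec (fun j => v j / ∑ j, v j) i =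
        ((∑ j, R i j * v j) / (∑ j, v j) - b) / a := by
      intro i
      simp only [hR, add_mul, Finset.sum_add_distrib, ← Finset.mul_sum, mul_assoc]
      rw [Matrix.mulVec, dotProduct]
      simp only [← mul_div_assoc, ← Finset.sum_div]
      field_simp
      ring
    have hc : ∀ i, M.mulVec (fun j => v j / ∑ j, v j) i ≤ (t / (∑ j, v j) - b) / a := by
      intro i
      rw [hM]
      gcongr
      exact g i
    have hl : (fun i => u i / ∑ i, u i) ⬝ᵥ M.mulVec (fun j => v j / ∑ j, v j) =
        (t / (∑ j, v j) - b) / a := by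
      have : ∀ i, u i / (∑ i, u i) * M.mulVec (fun j => v j / ∑ j, v j) i =
          u i / (∑ i, u i) * ((t / (∑ j, v j) - b) / a) := by
        intro i
        by_cases hi : u i = 0
        · simp [hi]
        · rw [hM, g' i hi]
      rw [dotProduct, Finset.sum_congr rfl fun i _ => this i, ← Finset.sum_mul, ← Finset.sum_div,
        div_self hU.ne', one_mul]
    rw [hl]
    calc u' ⬝ᵥ M.mulVec (fun j => v j / ∑ j, v j) ≤ ∑ i, u' i * ((t / (∑ j, v j) - b) / a) :=
          Finset.sum_le_sum fun i _ => mul_le_mul_of_nonneg_left (hc i) (hu'.1 i)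
      _ = (t / (∑ j, v j) - b) / a := by rw [← Finset.sum_mul, hu'.2, one_mul]
  refine ⟨⟨fun i => div_nonneg (hx i) hX.le, ?_⟩, ⟨fun j => div_nonneg (hy j) hY.le, ?_⟩,
    key hP hx hX hY h1 h1', fun z' hz' => ?_⟩
  · rw [← Finset.sum_div, div_self hX.ne']
  · rw [← Finset.sum_div, div_self hY.ne']
  -- The second player is the first player of the transposed game.
  · have e : ∀ (u : Fin n → ℝ) (v : Fin m → ℝ), u ⬝ᵥ B.transpose.mulVec v = v ⬝ᵥ B.mulVec u := by
      intro u v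
      rw [Matrix.mulVec_transpose, dotProduct_comm, Matrix.dotProduct_mulVec]
    have := key (M := B.transpose) (R := Q.transpose) (fun i j => hQ j i) hy hY hX h2 h2' z' hz'
    rwa [e, e] at this

/-! ## Complementarity and colorful sets -/

section
variable {d : ℕ}

/-- The projection along the diagonal. -/
def projDiag (x : Fin (d + 1) → ℤ) : Point d := fun i => ((x i.succ - x 0 : ℤ) : ℚ)

theorem toReal_projDiag (x : Fin (d + 1) → ℤ) (i : Fin d) :
    toReal (projDiag x) i = (x i.succ : ℝ) - x 0 := by
  simp [toReal, projDiag]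

/-- The projection has the diagonal as its kernel, so a relation among projected vectors only says
that the combination has equal coordinates. -/
theorem sum_smul_projDiag_eq_zero_iff {κ : Type} [Fintype κ] (v : κ → Fin (d + 1) → ℤ)
    (w : κ → ℝ) : ∑ k, w k • toReal (projDiag (v k)) = 0 ↔
      ∀ i, ∑ k, w k * v k i = ∑ k, w k * v k 0 := by
  rw [funext_iff]
  simp only [Finset.sum_apply, Pi.smul_apply, toReal_projDiag, smul_eq_mul, mul_sub,
    Finset.sum_sub_distrib, Pi.zero_apply, sub_eq_zero]
  refine ⟨fun h i => ?_, fun h i => h i.succ⟩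
  cases i using Fin.cases with
  | zero => rfl
  | succ i => exact h i

/-- The instance of Finding Another Colorful Simplex for a linear complementarity problem: the
pairs consist of a column of the matrix and a unit vector. -/
def complementarityInstance (hd : 0 < d) (C : Matrix (Fin (d + 1)) (Fin (d + 1)) ℤ)
    (hC : ∀ k i, 0 ≤ C k i) (hdiag : ∀ k, C k k = 0) : AnotherInstance where
  d := d
  S k := (projDiag (C k), projDiag ((1 : Matrix (Fin (d + 1)) (Fin (d + 1)) ℤ) k))
  -- Equal projections would make the difference of C k and the unit vector constant. Its entry at k
  -- is -1, while another entry, which exists since d > 0, is nonnegative.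
  distinct k h := by
    have h1 : ∀ i, C k i - C k 0 = (1 : Matrix (Fin (d + 1)) (Fin (d + 1)) ℤ) k i -
        (1 : Matrix (Fin (d + 1)) (Fin (d + 1)) ℤ) k 0 := by
      intro i
      cases i using Fin.cases with
      | zero => simp
      | succ i => exact Rat.intCast_injective (congrFun h i)
    have : Nontrivial (Fin (d + 1)) := Fin.nontrivial_iff_two_le.2 (by omega)
    obtain ⟨i, hi⟩ := exists_ne k
    have h2 := h1 i
    have h3 := h1 k
    rw [Matrix.one_apply_ne hi.symm] at h2
    rw [Matrix.one_apply_eq, hdiag] at h3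
    have := hC k i
    omega
  T k := some (projDiag ((1 : Matrix (Fin (d + 1)) (Fin (d + 1)) ℤ) k))
  isPDCS := by
    refine IsPDCS.of_full (fun i => by simp) ?_
    rw [positivelyDependent_range_iff]
    -- With equal weights the unit vectors combine to a vector of the diagonal, which is projected
    -- to 0.
    refine ⟨fun _ => (d + 1 : ℝ)⁻¹, fun _ => by positivity, ?_, ?_⟩
    · simp
      field_simp
    · refine (sum_smul_projDiag_eq_zero_iff
        (fun k => (1 : Matrix (Fin (d + 1)) (Fin (d + 1)) ℤ) k) _).2 fun i => ?_
      simp [Matrix.one_apply]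

/-- The weights of the selected columns form z, and those of the selected unit vectors are slack
variables. The combination has all coordinates equal to some t, and color i supplies either its
column or its slack; this is complementarity. -/
theorem IsBalance.complementary {C : Matrix (Fin (d + 1)) (Fin (d + 1)) ℤ}
    (hC : ∀ k i, 0 ≤ C k i) (hne : ∀ k, ∃ i, C k i ≠ 0) {σ : Fin (d + 1) → Point d}
    (hσ : ∀ k, σ k = projDiag (C k) ∨
      σ k = projDiag ((1 : Matrix (Fin (d + 1)) (Fin (d + 1)) ℤ) k))
    (hT : ∃ k, σ k = projDiag (C k)) {w : Fin (d + 1) → ℝ}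
    (hw : IsBalance (fun k => toReal (σ k)) w) {z : Fin (d + 1) → ℝ}
    (hz : ∀ k, z k = if σ k = projDiag (C k) then w k else 0) :
    ∃ t : ℝ, 0 < t ∧ (∃ k, z k ≠ 0) ∧ ∀ i, ∑ k, z k * C k i ≤ t ∧
      (z i ≠ 0 → ∑ k, z k * C k i = t) := by
  let v : Fin (d + 1) → Fin (d + 1) → ℤ := fun k =>
    if σ k = projDiag (C k) then C k else (1 : Matrix (Fin (d + 1)) (Fin (d + 1)) ℤ) k
  have hv : ∀ k, σ k = projDiag (v k) := by
    intro k
    simp only [v]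
    split_ifs with h
    · exact h
    · exact (hσ k).resolve_left h
  have hv0 : ∀ k i, 0 ≤ v k i := by
    intro k i
    simp only [v]
    split_ifs with h
    · exact hC k i
    · rw [Matrix.one_apply]; split_ifs <;> simp
  have hvne : ∀ k, ∃ i, v k i ≠ 0 := by
    intro k
    simp only [v]
    split_ifs with h
    · exact hne k
    · exact ⟨k, by simp⟩
  have hw' := hw.sum_smul
  simp only [hv] at hw'
  have ht := (sum_smul_projDiag_eq_zero_iff v w).1 hw'
  set t := ∑ k, w k * (v k 0 : ℝ)
  have hterm : ∀ k i, 0 ≤ w k * (v k i : ℝ) := fun k i =>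
    mul_nonneg (hw.nonneg k) (by exact_mod_cast hv0 k i)
  -- The vectors are nonnegative and nonzero, so one with positive weight makes some coordinate
  -- positive, and all coordinates equal t.
  have htpos : 0 < t := by
    obtain ⟨k, hk⟩ : ∃ k, w k ≠ 0 := by
      by_contra! h
      have := hw.sum_eq_one
      simp [h] at this
    obtain ⟨i, hi⟩ := hvne k
    rw [← ht i]
    refine Finset.sum_pos' (fun k _ => hterm k i) ⟨k, Finset.mem_univ _, ?_⟩
    exact lt_of_le_of_ne (hterm k i) (Ne.symm (mul_ne_zero hk (by exact_mod_cast hi)))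
  have hsplit : ∀ i, ∑ k, z k * (C k i : ℝ) + (if σ i = projDiag (C i) then 0 else w i) = t := by
    intro i
    rw [← ht i, ← Finset.sum_erase_add _ _ (Finset.mem_univ i),
      ← Finset.sum_erase_add (Finset.univ) (fun k => w k * (v k i : ℝ)) (Finset.mem_univ i),
      add_assoc]
    congr 1
    · refine Finset.sum_congr rfl fun k hk => ?_
      simp only [hz, v]
      split_ifs with h
      · rfl
      · rw [Matrix.one_apply_ne (Finset.ne_of_mem_erase hk)]
        simp
    · simp only [hz, v]
      split_ifs with h <;> simp
  refine ⟨t, htpos, ?_, fun i => ⟨?_, fun hi => ?_⟩⟩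
  · by_contra! h
    obtain ⟨k, hk⟩ := hT
    have := hsplit k
    simp [h, hk] at this
    exact htpos.ne this
  · have := hsplit i
    have h0 : 0 ≤ (if σ i = projDiag (C i) then 0 else w i) := by
      split_ifs
      · exact le_rfl
      · exact hw.nonneg i
    linarith
  · have := hsplit i
    rw [hz] at hi
    have hi' : σ i = projDiag (C i) := by
      by_contra h
      simp [h] at hi
    rwa [if_pos hi', add_zero] at this

end

/-! ## Minimal positively dependent sets -/

theorem Feasible.mono {d k : ℕ} {L L' : Config d k} (h : Feasible L) (hL : ∀ i, L i ⊆ L' i) :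
    Feasible L' := by
  obtain ⟨T, hT⟩ := h
  exact ⟨T, fun i x hx => hL i (hT.1 i x hx), hT.2⟩

/-- A color that is kept was indispensable when it was tested. Configurations only shrink afterwards
and feasibility is monotone, so it is still indispensable at the end. -/
theorem foldl_tryReplace_nil {d k : ℕ} {O : Data → Bool} (hO : Decides O colorfulLP)
    (l : List (Fin k)) (L : Config d k) :
    (∀ i, (l.map fun i => (i, [])).foldl (tryReplace O) L i = L i ∨
      (l.map fun i => (i, [])).foldl (tryReplace O) L i = []) ∧
    ∀ i ∈ l, (l.map fun i => (i, [])).foldl (tryReplace O) L i = [] ∨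
      ¬ Feasible (Function.update ((l.map fun i => (i, [])).foldl (tryReplace O) L) i []) := by
  induction l generalizing L with
  | nil => simp
  | cons j l ih =>
    rw [List.map_cons, List.foldl_cons]
    obtain ⟨h1, h2⟩ := ih (tryReplace O L (j, []))
    set R := (l.map fun i => (i, [])).foldl (tryReplace O) (tryReplace O L (j, [])) with hR
    have h3 : tryReplace O L (j, []) = Function.update L j [] ∨
        tryReplace O L (j, []) = L ∧ ¬ Feasible (Function.update L j []) := by
      unfold tryReplace
      split_ifs with hq
      · exact Or.inl rfl
      · exact Or.inr ⟨rfl, fun h => hq ((hO.feasible _).2 h)⟩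
    have h4 : ∀ i, tryReplace O L (j, []) i = L i ∨ tryReplace O L (j, []) i = [] := by
      intro i
      rcases h3 with h | ⟨h, -⟩ <;> rw [h]
      · by_cases hi : i = j
        · subst hi; simp
        · simp [hi]
      · exact Or.inl rfl
    have h5 : ∀ i, R i = L i ∨ R i = [] := by
      intro i
      rcases h1 i with h | h
      · rcases h4 i with h' | h' <;> rw [h, h'] <;> simp
      · exact Or.inr h
    refine ⟨h5, fun i hi => ?_⟩
    rcases List.mem_cons.1 hi with rfl | hi
    · rcases h3 with h | ⟨-, h⟩
      · rcases h1 i with h' | h'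
        · left; rw [h', h, Function.update_self]
        · exact Or.inl h'
      · right
        refine fun hf => h (hf.mono fun i' => ?_)
        by_cases hii : i' = i
        · subst hii; simp
        · rw [Function.update_of_ne hii, Function.update_of_ne hii]
          rcases h5 i' with h' | h' <;> rw [h'] <;> simp
    · exact h2 i hi

/-- If μ is not a multiple of w, subtracting the multiple with the same sum leaves a relation ν with
coefficient sum 0 and some positive coefficient. Moving from w along -ν until a weight vanishes
gives a balance on a smaller support, against minimality. -/
theorem IsBalance.unique_of_minimal {κ E : Type} [Fintype κ] [AddCommGroup E] [Module ℝ E]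
    {c : κ → E} {J : Set κ}
    (hmin : ∀ i ∈ J, ¬ ∃ w, IsBalance c w ∧ ∀ k ∉ J \ {i}, w k = 0) {w : κ → ℝ}
    (hw : IsBalance c w) (hwJ : ∀ k ∉ J, w k = 0) {μ : κ → ℝ} (hμJ : ∀ k ∉ J, μ k = 0)
    (hμ : ∑ k, μ k • c k = 0) : ∃ s : ℝ, μ = s • w := by
  refine ⟨∑ k, μ k, ?_⟩
  by_contra hne
  set ν := μ - (∑ k, μ k) • w with hν
  have hν0 : ν ≠ 0 := fun h => hne (sub_eq_zero.1 h)
  have hsum : ∑ k, ν k = 0 := by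
    simp [hν, Finset.sum_sub_distrib, ← Finset.mul_sum, hw.sum_eq_one]
  have hsmul : ∑ k, ν k • c k = 0 := by
    simp [hν, sub_smul, Finset.sum_sub_distrib, hμ, mul_smul, ← Finset.smul_sum, hw.sum_smul]
  have hνJ : ∀ k ∉ J, ν k = 0 := fun k hk => by simp [hν, hμJ k hk, hwJ k hk]
  obtain ⟨k₀, hk₀⟩ : ∃ k, 0 < ν k := by
    by_contra! h
    exact hν0 (funext fun k =>
      (Finset.sum_eq_zero_iff_of_nonpos fun k _ => h k).1 hsum k (Finset.mem_univ k))
  obtain ⟨k, hk, hmin'⟩ := Finset.exists_min_image (Finset.univ.filter fun k => 0 < ν k)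
    (fun k => w k / ν k) ⟨k₀, by simpa using hk₀⟩
  have hk0 : 0 < ν k := by simpa using hk
  refine hmin k ?_ ⟨w - (w k / ν k) • ν, ⟨fun i => ?_, ?_, ?_⟩, fun i hi => ?_⟩
  · by_contra h
    exact hk0.ne' (hνJ k h)
  · simp only [Pi.sub_apply, Pi.smul_apply, smul_eq_mul, sub_nonneg]
    rcases le_or_gt (ν i) 0 with h | h
    · exact (mul_nonpos_of_nonneg_of_nonpos (div_nonneg (hw.nonneg k) hk0.le) h).trans (hw.nonneg i)
    · exact (le_div_iff₀ h).1 (hmin' i (by simpa using h))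
  · simp [Finset.sum_sub_distrib, ← Finset.mul_sum, hw.sum_eq_one, hsum]
  · simp [sub_smul, Finset.sum_sub_distrib, mul_smul, ← Finset.smul_sum, hw.sum_smul, hsmul]
  · by_cases hiJ : i ∈ J
    · have : i = k := by
        by_contra h
        exact hi ⟨hiJ, h⟩
      subst this
      simp [hk0.ne']
    · simp [hwJ i hiJ, hνJ i hiJ]

theorem feasible_iff_of_singletons {d k : ℕ} {L : Config d k} {σ : Fin k → Point d}
    (hL : ∀ i, L i = [σ i] ∨ L i = []) :
    Feasible L ↔ ∃ w, IsBalance (fun i => toReal (σ i)) w ∧ ∀ i ∉ {i | L i ≠ []}, w i = 0 := by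
  rw [← positivelyDependent_image_iff]
  constructor
  · rintro ⟨T, hT⟩
    refine hT.2.mono ?_
    rintro x ⟨i, hi⟩
    have h1 := hT.1 i x hi
    rcases hL i with h | h
    · rw [h, List.mem_singleton] at h1
      exact ⟨i, by simp [h], h1.symm⟩
    · simp [h] at h1
  · intro h
    classical
    refine ⟨fun i => if L i ≠ [] then some (σ i) else none, fun i x hx => ?_, h.mono ?_⟩
    · dsimp only at hx
      split_ifs at hx with hi
      rcases hL i with h | h
      · rw [h, ← Option.some_inj.1 hx, List.mem_singleton]
      · exact absurd h hi
    · rintro _ ⟨i, hi, rfl⟩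
      exact ⟨i, if_pos hi⟩

/-- Greedy deletions lead to a balance that is unique up to a factor. -/
theorem exists_unique_balance {d k : ℕ} {O : Data → Bool} (hO : Decides O colorfulLP)
    {σ : Fin k → Point d} (hσ : PositivelyDependent (Set.range σ)) {R : Config d k}
    (hR : R = ((List.finRange k).map fun i => (i, [])).foldl (tryReplace O) fun i => [σ i]) :
    (∀ i, R i = [σ i] ∨ R i = []) ∧ ∃ w, IsBalance (fun i => toReal (σ i)) w ∧
      (∀ i, R i = [] → w i = 0) ∧ ∀ μ : Fin k → ℝ, (∀ i, R i = [] → μ i = 0) →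
        ∑ i, μ i • toReal (σ i) = 0 → ∃ s : ℝ, μ = s • w := by
  obtain ⟨h1, h2⟩ := foldl_tryReplace_nil hO (List.finRange k) fun i => [σ i]
  rw [← hR] at h1 h2
  have hf : Feasible R := by
    rw [hR]
    exact feasible_foldl_tryReplace hO _ ⟨_, IsPDCS.of_full (fun i => List.mem_singleton_self _) hσ⟩
  obtain ⟨w, hw, hwJ⟩ := (feasible_iff_of_singletons h1).1 hf
  refine ⟨h1, w, hw, fun i hi => hwJ i (by simpa using hi), fun μ hμ hμ' =>
    hw.unique_of_minimal (J := {i | R i ≠ []}) ?_ hwJ (fun i hi => hμ i (by simpa using hi)) hμ'⟩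
  intro i hi h
  refine (h2 i (List.mem_finRange i)).elim hi fun h3 => h3 ?_
  have h4 : ∀ j, Function.update R i [] j = [σ j] ∨ Function.update R i [] j = [] := by
    intro j
    by_cases hj : j = i
    · subst hj; simp
    · rw [Function.update_of_ne hj]; exact h1 j
  rw [feasible_iff_of_singletons h4]
  convert h using 6 with w' j
  by_cases hj : j = i
  · subst hj; simp
  · simp [hj]

/-! ## Gram matrices -/

/-- The quadratic form of the matrix at μ is the square of the length of ∑ μ j • U j plus the sum of
the squares of the μ i with δ i, so it vanishes only if all of these do. -/
theorem gram_kernel {k d : ℕ} (U : Fin k → Fin d → ℝ) (δ : Fin k → Prop) [DecidablePred δ]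
    (μ : Fin k → ℝ) :
    (∀ i, ∑ j, (U i ⬝ᵥ U j + if i = j then (if δ i then 1 else 0) else 0) * μ j = 0) ↔
      (∑ j, μ j • U j = 0) ∧ ∀ i, δ i → μ i = 0 := by
  have hrow : ∀ i, ∑ j, (U i ⬝ᵥ U j + if i = j then (if δ i then 1 else 0) else 0) * μ j =
      U i ⬝ᵥ (∑ j, μ j • U j) + if δ i then μ i else 0 := by
    intro i
    simp only [add_mul, Finset.sum_add_distrib, dotProduct_sum, dotProduct_smul, smul_eq_mul,
      ite_mul, zero_mul, one_mul, Finset.sum_ite_eq, Finset.mem_univ, if_true]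
    simp only [mul_comm]
  simp only [hrow]
  constructor
  · intro h
    have h1 : ∑ i, μ i * (U i ⬝ᵥ (∑ j, μ j • U j) + if δ i then μ i else 0) = 0 :=
      Finset.sum_eq_zero fun i _ => by rw [h, mul_zero]
    simp only [mul_add, Finset.sum_add_distrib] at h1
    have h2 : ∑ i, μ i * (U i ⬝ᵥ ∑ j, μ j • U j) = (∑ j, μ j • U j) ⬝ᵥ (∑ j, μ j • U j) := by
      rw [sum_dotProduct]
      simp [smul_dotProduct]
    have h3 : ∀ i ∈ Finset.univ, 0 ≤ μ i * (if δ i then μ i else 0) := by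
      intro i _
      split_ifs
      · exact mul_self_nonneg _
      · simp
    have h4 : 0 ≤ (∑ j, μ j • U j) ⬝ᵥ (∑ j, μ j • U j) :=
      Finset.sum_nonneg fun i _ => mul_self_nonneg _
    rw [h2] at h1
    have h5 := Finset.sum_nonneg h3
    refine ⟨dotProduct_self_eq_zero.1 (by linarith), fun i hi => ?_⟩
    have := (Finset.sum_eq_zero_iff_of_nonneg h3).1 (by linarith) i (Finset.mem_univ i)
    rwa [if_pos hi, mul_self_eq_zero] at this
  · rintro ⟨h1, h2⟩ i
    rw [h1, dotProduct_zero, zero_add]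
    split_ifs with hi
    · exact h2 i hi
    · rfl

/-- The numerators of the first point of a list. -/
def headNums (l : List (List ℚ)) : List ℤ := (l.headD []).map Rat.num

/-- The Gram matrix of the first points, with a diagonal entry `1` for the empty lists. -/
def gramRows (L : List (List (List ℚ))) : List (List ℤ) :=
  L.zipIdx.map fun u => L.zipIdx.map fun v => dot (headNums u.1) (headNums v.1) +
    if decide (u.2 = v.2) then (if u.1.isEmpty then 1 else 0) else 0

@[fun_prop]
theorem Poly.headD_nil {α β : Type} [HasEnc α] [HasEnc β] {l : α → List (List β)} (hl : Poly l) :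
    Poly (fun a => (l a).headD []) := (Poly.headD_zero [] rfl).comp hl

@[fun_prop]
theorem Poly.headD_int {α : Type} [HasEnc α] {l : α → List ℤ} (hl : Poly l) :
    Poly (fun a => (l a).headD 0) := (Poly.headD_zero 0 rfl).comp hl

@[fun_prop]
theorem Poly.headNums {α : Type} [HasEnc α] {l : α → List (List ℚ)} (hl : Poly l) :
    Poly (fun a => headNums (l a)) := by
  unfold ColorfulLP.headNums
  fun_prop

@[fun_prop]
theorem Poly.gramRows {α : Type} [HasEnc α] {L : α → List (List (List ℚ))} (hL : Poly L) :
    Poly (fun a => gramRows (L a)) := by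
  unfold ColorfulLP.gramRows
  fun_prop

section
variable {d k : ℕ}

/-- The matrix behind `gramRows`. -/
def gramMatrix (R : Config d k) (σ : Fin k → Point d) : Matrix (Fin k) (Fin k) ℤ :=
  Matrix.of fun i j => (if R i = [] then 0 else fun l => (σ i l).num) ⬝ᵥ
    (if R j = [] then 0 else fun l => (σ j l).num) +
    if i = j then (if R i = [] then 1 else 0) else 0

theorem gramRows_configList {R : Config d k} {σ : Fin k → Point d}
    (hR : ∀ i, R i = [σ i] ∨ R i = []) :
    gramRows (configList R) = matrixList (gramMatrix R σ) := by
  have hdot : ∀ i j, dot (headNums ((R i).map List.ofFn)) (headNums ((R j).map List.ofFn)) =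
      (if R i = [] then 0 else fun l => (σ i l).num) ⬝ᵥ
        (if R j = [] then 0 else fun l => (σ j l).num) := by
    intro i j
    rcases hR i with h | h <;> rcases hR j with h' | h' <;>
      simp [h, h', headNums, List.map_ofFn, dot_ofFn, Function.comp_def] <;> simp [dot]
  rw [gramRows, configList, zipIdx_ofFn, List.map_ofFn]
  simp only [Function.comp_def, List.map_ofFn, hdot, matrixList, gramMatrix,
    decide_eq_true_eq, ← Fin.ext_iff, List.isEmpty_iff, List.map_eq_nil_iff]
  rfl

theorem transpose_gramMatrix (R : Config d k) (σ : Fin k → Point d) :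
    (gramMatrix R σ).transpose = gramMatrix R σ := by
  ext i j
  simp only [gramMatrix, Matrix.transpose_apply, Matrix.of_apply]
  rw [dotProduct_comm]
  congr 1
  by_cases h : i = j
  · subst h; rfl
  · rw [if_neg h, if_neg (Ne.symm h)]

/-- The diagonal entries 1 at deleted colors force their coefficients to 0, so the kernel consists
of the relations among the remaining points. The points are integral, so numerators suffice. -/
theorem gramMatrix_kernel {R : Config d k} {σ : Fin k → Point d} (hσ : ∀ i l, (σ i l).den = 1)
    (μ : Fin k → ℝ) : ((gramMatrix R σ).map (Int.castRingHom ℝ)).mulVec μ = 0 ↔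
      (∑ j, μ j • toReal (σ j) = 0) ∧ ∀ i, R i = [] → μ i = 0 := by
  have hnum : ∀ i l, (((σ i l).num : ℤ) : ℝ) = toReal (σ i) l := by
    intro i l
    have := Rat.num_div_den (σ i l)
    rw [hσ, Nat.cast_one, div_one] at this
    rw [toReal, ← Rat.cast_intCast, this]
  have h := gram_kernel (fun i => if R i = [] then 0 else toReal (σ i)) (fun i => R i = []) μ
  have h1 : ((gramMatrix R σ).map (Int.castRingHom ℝ)).mulVec μ = 0 ↔ ∀ i, ∑ j,
      ((if R i = [] then 0 else toReal (σ i)) ⬝ᵥ (if R j = [] then 0 else toReal (σ j)) +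
        if i = j then (if R i = [] then 1 else 0) else 0) * μ j = 0 := by
    rw [funext_iff]
    refine forall_congr' fun i => ?_
    rw [Matrix.mulVec, dotProduct, Pi.zero_apply]
    refine Eq.congr_left (Finset.sum_congr rfl fun j _ => ?_)
    congr 1
    simp only [Matrix.map_apply, gramMatrix, Matrix.of_apply, map_add]
    congr 1
    · rw [dotProduct, dotProduct, map_sum]
      refine Finset.sum_congr rfl fun l _ => ?_
      split_ifs <;> simp [hnum]
    · split_ifs <;> simp
  rw [h1, h]
  refine and_congr_left fun h2 => ?_
  refine Eq.congr_left (Finset.sum_congr rfl fun j _ => ?_)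
  split_ifs with hj
  · simp [h2 j hj]
  · rfl

end

/-! ## Solving complementarity problems -/

/-- The projection along the diagonal. -/
def projList (c : List ℤ) : List ℚ := c.tail.map fun z => ((z - c.headD 0 : ℤ) : ℚ)

/-- The rows of the unit matrix. -/
def unitRows (C : List (List ℤ)) : List (List ℤ) := addDiag 1 (C.map fun r => r.map fun _ => 0)

/-- The lists that belong to `complementarityInstance`. -/
def complementarityList (C : List (List ℤ)) : AnotherList :=
  ((C.tail.map fun _ => (1 : ℤ)).sum.natAbs,
    (C.zip (unitRows C)).map fun p => (projList p.1, projList p.2),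
    (unitRows C).map fun e => some (projList e))

/-- The colorful set different from the unit vectors, and the points that remain after greedy
deletions. -/
def minimalPoints (O : Data → Bool) (C : List (List ℤ)) : List (List (List ℚ)) :=
  ((anotherFinal O (complementarityList C)).zipIdx.map fun x => (x.2, [])).foldl
    (fun L e => tryStep O (complementarityList C).1 L e) (anotherFinal O (complementarityList C))

/-- The coefficients of the columns of `C` among the points. -/
def columnWeights (C : List (List ℤ)) (L : List (List (List ℚ))) : List ℤ :=
  ((L.zip (C.map projList)).zip (leVerrierRowSums (gramRows L))).map fun p =>
    if decide (p.1.1 = [p.1.2]) then p.2 else 0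

section
variable {α : Type} [HasEnc α]

@[fun_prop]
theorem Poly.projList {c : α → List ℤ} (hc : Poly c) : Poly (fun a => projList (c a)) := by
  unfold ColorfulLP.projList
  fun_prop

@[fun_prop]
theorem Poly.unitRows {C : α → List (List ℤ)} (hC : Poly C) : Poly (fun a => unitRows (C a)) := by
  unfold ColorfulLP.unitRows
  fun_prop

@[fun_prop]
theorem Poly.complementarityList {C : α → List (List ℤ)} (hC : Poly C) :
    Poly (fun a => complementarityList (C a)) := by
  unfold ColorfulLP.complementarityList
  fun_prop

@[fun_prop]
theorem Poly.columnWeights {C : α → List (List ℤ)} {L : α → List (List (List ℚ))} (hC : Poly C)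
    (hL : Poly L) : Poly (fun a => columnWeights (C a) (L a)) := by
  unfold ColorfulLP.columnWeights
  fun_prop

end

theorem polyO_minimalPoints : PolyO minimalPoints := by
  have h1 : Poly (fun C : List (List ℤ) => complementarityList C) := by fun_prop
  have h2 : Poly (fun C : List (List ℤ) => (complementarityList C).1) := by fun_prop
  have h3 : Poly (fun x : ℕ × List (List (List ℚ)) =>
      ((x.1, x.2.zipIdx.map (fun y => (y.2, [])), x.2) : ReplaceInput (ℕ × List (List ℚ)))) := by
    fun_prop
  have h4 : PolyO anotherFinal := ⟨_, polyQ_anotherFinal⟩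
  exact polyO_try.comp (h3.polyO.comp (h2.polyO.pair (h4.comp h1.polyO)))

theorem polyO_columnWeights : PolyO fun O C => columnWeights C (minimalPoints O C) := by
  have h1 : Poly (fun x : List (List ℤ) × List (List (List ℚ)) => columnWeights x.1 x.2) := by
    fun_prop
  have h2 : Poly (fun C : List (List ℤ) => C) := by fun_prop
  exact h1.polyO.comp (h2.polyO.pair polyO_minimalPoints)

section
variable {d : ℕ}

theorem projList_ofFn (x : Fin (d + 1) → ℤ) : projList (List.ofFn x) = List.ofFn (projDiag x) := by
  rw [projList, List.ofFn_succ, List.tail_cons, List.map_ofFn]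
  rfl

theorem unitRows_matrixList {n : ℕ} (C : Matrix (Fin n) (Fin n) ℤ) :
    unitRows (matrixList C) = matrixList (1 : Matrix (Fin n) (Fin n) ℤ) := by
  have h1 : (matrixList C).map (fun r => r.map fun _ => (0 : ℤ)) =
      matrixList (0 : Matrix (Fin n) (Fin n) ℤ) := by
    simp only [matrixList, List.map_ofFn, Function.comp_def]
    rfl
  rw [unitRows, h1, addDiag_matrixList, zero_add, one_smul]

theorem complementarityList_matrixList (hd : 0 < d) (C : Matrix (Fin (d + 1)) (Fin (d + 1)) ℤ)
    (hC : ∀ k i, 0 ≤ C k i) (hdiag : ∀ k, C k k = 0) :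
    complementarityList (matrixList C) = (complementarityInstance hd C hC hdiag).toLists := by
  have h1 : ((matrixList C).tail.map fun _ => (1 : ℤ)).sum.natAbs = d := by
    simp [matrixList, List.sum_ofFn]
  rw [complementarityList, h1, unitRows_matrixList]
  simp only [matrixList, ofFn_zip, List.map_ofFn, Function.comp_def, projList_ofFn]
  rfl

theorem minimalPoints_matrixList (O : Data → Bool) (hd : 0 < d)
    (C : Matrix (Fin (d + 1)) (Fin (d + 1)) ℤ) (hC : ∀ k i, 0 ≤ C k i) (hdiag : ∀ k, C k k = 0)
    {L : Config d (d + 1)} (hL : ((complementarityInstance hd C hC hdiag).run O).1 = L) :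
    minimalPoints O (matrixList C) = configList
      (((List.finRange (d + 1)).map fun i => (i, [])).foldl (tryReplace O) L) := by
  rw [minimalPoints, complementarityList_matrixList hd C hC hdiag, AnotherInstance.anotherFinal_eq,
    hL, configList_foldl_tryReplace]
  have h1 : (configList L).zipIdx.map (fun x => (x.2, ([] : List (List ℚ)))) =
      ((List.finRange (d + 1)).map fun i => (i, ([] : List (Point d)))).map
        fun e => ((e.1 : ℕ), e.2.map List.ofFn) := by
    rw [configList, zipIdx_ofFn, List.map_ofFn, List.map_map, List.ofFn_eq_map]
    rfl
  rw [← h1]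
  rfl

/-- The points left by the greedy deletions have a balance that is unique up to a factor, and the
row sums give a multiple of it with integer entries. Size and sign of the factor s are unknown, but
it cancels when strategies are normalized. -/
theorem exists_columnWeights {O : Data → Bool} (hO : Decides O colorfulLP) (hd : 0 < d)
    (C : Matrix (Fin (d + 1)) (Fin (d + 1)) ℤ) (hC : ∀ k i, 0 ≤ C k i) (hdiag : ∀ k, C k k = 0)
    (hne : ∀ k, ∃ i, C k i ≠ 0) : ∃ (r : Fin (d + 1) → ℤ) (z : Fin (d + 1) → ℝ) (s t : ℝ),
      columnWeights (matrixList C) (minimalPoints O (matrixList C)) = List.ofFn r ∧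
      s ≠ 0 ∧ (∀ k, (r k : ℝ) = s * z k) ∧ (∀ k, 0 ≤ z k) ∧ 0 < t ∧ (∃ k, z k ≠ 0) ∧
      ∀ i, ∑ k, z k * C k i ≤ t ∧ (z i ≠ 0 → ∑ k, z k * C k i = t) := by
  obtain ⟨σ, h1, h2, h3, h4, h5⟩ := (complementarityInstance hd C hC hdiag).exists_output hO
  change Fin (d + 1) → Point d at σ
  have h2' : ((complementarityInstance hd C hC hdiag).run O).1 = fun i => [σ i] := funext h2
  have h1' : ∀ k, σ k = projDiag (C k) ∨
      σ k = projDiag ((1 : Matrix (Fin (d + 1)) (Fin (d + 1)) ℤ) k) := by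
    intro k
    have h := h1 k
    change σ k ∈ [projDiag (C k), projDiag ((1 : Matrix (Fin (d + 1)) (Fin (d + 1)) ℤ) k)] at h
    rwa [List.mem_cons, List.mem_singleton] at h
  -- Without any column the output would consist of the unit vectors and so be T.
  have hT : ∃ k, σ k = projDiag (C k) := by
    by_contra! h
    apply h5
    rw [h4]
    funext k
    exact congrArg some ((h1' k).resolve_left (h k))
  have hden : ∀ i l, (σ i l).den = 1 := by
    intro i l
    rcases h1' i with h | h <;> rw [h, projDiag, Rat.den_intCast]
  rw [minimalPoints_matrixList O hd C hC hdiag h2']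
  obtain ⟨R, hRdef⟩ : ∃ R : Config d (d + 1), R =
    ((List.finRange (d + 1)).map fun i => (i, [])).foldl (tryReplace O) fun i => [σ i] := ⟨_, rfl⟩
  obtain ⟨hR, w, hw, hwJ, hker⟩ := exists_unique_balance hO h3 hRdef
  rw [← hRdef]
  obtain ⟨s, hs, hsum⟩ := exists_rowSum_leVerrier (transpose_gramMatrix R σ) hw.nonneg
    (fun h => by have := hw.sum_eq_one; simp [h] at this) (fun μ => by
      rw [gramMatrix_kernel hden]
      constructor
      · rintro ⟨g1, g2⟩
        exact hker μ g2 g1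
      · rintro ⟨s, rfl⟩
        refine ⟨?_, fun i hi => by simp [hwJ i hi]⟩
        simp only [Pi.smul_apply, smul_eq_mul, mul_smul, ← Finset.smul_sum]
        exact (congrArg (s • ·) hw.sum_smul).trans (smul_zero s))
  obtain ⟨t, ht, hz, hzt⟩ := hw.complementary hC hne h1' hT (fun k => rfl)
  -- A deleted color fails the test and receives 0, in agreement with w k = 0.
  refine ⟨fun k => if R k = [projDiag (C k)] then
    ∑ j, (leVerrier (gramMatrix R σ) (d + 1 - 1)).1 k j else 0, _, s, t, ?_, hs, fun k => ?_,
    fun k => ?_, ht, hz, hzt⟩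
  · rw [columnWeights, gramRows_configList hR,
      leVerrierRowSums_matrixList (transpose_gramMatrix R σ)]
    simp only [configList, matrixList, List.map_ofFn, ofFn_zip, Function.comp_def, projList_ofFn,
      decide_eq_true_eq]
    congr 1
    ext k : 1
    congr 1
    have : [List.ofFn (projDiag (C k))] = [projDiag (C k)].map List.ofFn := rfl
    rw [this, List.map_inj_right (fun _ _ h => List.ofFn_injective h)]
  · change ((if R k = [projDiag (C k)] then
      ∑ j, (leVerrier (gramMatrix R σ) (d + 1 - 1)).1 k j else 0 : ℤ) : ℝ) =
      s * if σ k = projDiag (C k) then w k else 0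
    rcases hR k with h | h
    · have h' : R k = [projDiag (C k)] ↔ σ k = projDiag (C k) :=
        ⟨fun g => List.singleton_inj.1 (h.symm.trans g), fun g => h.trans (congrArg (fun x => [x]) g)⟩
      split_ifs with g g' g'
      · exact hsum k
      · exact absurd (h'.1 g) g'
      · exact absurd (h'.2 g') g
      · rw [Int.cast_zero, mul_zero]
    · split_ifs with g g'
      · exact absurd (h.symm.trans g) (List.cons_ne_nil _ _).symm
      · exact absurd (h.symm.trans g) (List.cons_ne_nil _ _).symm
      · rw [hwJ k h, Int.cast_zero, mul_zero]
      · rw [Int.cast_zero, mul_zero]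
  · split_ifs
    · exact hw.nonneg k
    · exact le_rfl

end

/-! ## Bimatrix games -/

/-- A common denominator of the entries of two matrices. -/
def commonDen (A B : List (List ℚ)) : ℤ := ((A ++ B).flatten.map fun q => (q.den : ℤ)).prod

/-- The product of `D` and `q`, if the denominator of `q` divides `D`. -/
def scaleRat (D : ℤ) (q : ℚ) : ℤ := q.num * (D / q.den)

/-- A shift that makes all scaled entries of two matrices positive. -/
def shift (D : ℤ) (A B : List (List ℚ)) : ℤ :=
  ((A ++ B).flatten.map fun q => scaleRat D q * scaleRat D q).sum + 1

/-- Scale and shift a matrix. -/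
def scaleRows (D K : ℤ) (A : List (List ℚ)) : List (List ℤ) :=
  A.map fun r => r.map fun q => scaleRat D q + K

/-- The columns of a nonempty matrix. -/
def columns (P : List (List ℤ)) : List (List ℤ) :=
  (P.headD []).zipIdx.map fun x => P.map fun r =>
    (r.zipIdx.map fun y => if decide (y.2 = x.2) then y.1 else 0).sum

/-- The columns of the complementarity problem for two matrices. -/
def blockRows (P Q : List (List ℤ)) : List (List ℤ) :=
  Q.map (fun r => P.map (fun _ => 0) ++ r) ++
    (columns P).map fun c => c ++ (P.headD []).map fun _ => 0

/-- The complementarity problem of a game. -/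
def gameRows (A B : List (List ℚ)) : List (List ℤ) :=
  blockRows (scaleRows (commonDen A B) (shift (commonDen A B) A B) A)
    (scaleRows (commonDen A B) (shift (commonDen A B) A B) B)

/-- Divide by the sum. -/
def normalize (l : List ℤ) : List ℚ := l.map fun x => ((x : ℤ) : ℚ) / ((l.sum : ℤ) : ℚ)

/-- The beginning of a list, as long as a given list. -/
def takeAs {α β : Type} (l : List α) (z : List β) : List β := (l.zip z).map fun p => p.2

/-- The strategies that belong to a solution of the complementarity problem. -/
def strategies (A : List (List ℚ)) (z : List ℤ) : List ℚ × List ℚ :=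
  (normalize (takeAs A z), normalize (takeAs (A.headD []) z.reverse).reverse)

section
variable {α β γ : Type} [HasEnc α] [HasEnc β] [HasEnc γ]

@[fun_prop]
theorem Poly.commonDen {A B : α → List (List ℚ)} (hA : Poly A) (hB : Poly B) :
    Poly (fun a => commonDen (A a) (B a)) := by
  unfold ColorfulLP.commonDen
  fun_prop

@[fun_prop]
theorem Poly.scaleRat {D : α → ℤ} {q : α → ℚ} (hD : Poly D) (hq : Poly q) :
    Poly (fun a => scaleRat (D a) (q a)) := by
  unfold ColorfulLP.scaleRat
  fun_prop

@[fun_prop]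
theorem Poly.shift {D : α → ℤ} {A B : α → List (List ℚ)} (hD : Poly D) (hA : Poly A)
    (hB : Poly B) : Poly (fun a => shift (D a) (A a) (B a)) := by
  unfold ColorfulLP.shift
  fun_prop

@[fun_prop]
theorem Poly.scaleRows {D K : α → ℤ} {A : α → List (List ℚ)} (hD : Poly D) (hK : Poly K)
    (hA : Poly A) : Poly (fun a => scaleRows (D a) (K a) (A a)) := by
  unfold ColorfulLP.scaleRows
  fun_prop

@[fun_prop]
theorem Poly.columns {P : α → List (List ℤ)} (hP : Poly P) : Poly (fun a => columns (P a)) := by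
  unfold ColorfulLP.columns
  fun_prop

@[fun_prop]
theorem Poly.blockRows {P Q : α → List (List ℤ)} (hP : Poly P) (hQ : Poly Q) :
    Poly (fun a => blockRows (P a) (Q a)) := by
  unfold ColorfulLP.blockRows
  fun_prop

@[fun_prop]
theorem Poly.gameRows {A B : α → List (List ℚ)} (hA : Poly A) (hB : Poly B) :
    Poly (fun a => gameRows (A a) (B a)) := by
  unfold ColorfulLP.gameRows
  fun_prop

@[fun_prop]
theorem Poly.normalize {l : α → List ℤ} (hl : Poly l) : Poly (fun a => normalize (l a)) := by
  unfold ColorfulLP.normalize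
  fun_prop

@[fun_prop]
theorem Poly.takeAs {l : α → List β} {z : α → List γ} (hl : Poly l) (hz : Poly z) :
    Poly (fun a => takeAs (l a) (z a)) := by
  unfold ColorfulLP.takeAs
  fun_prop

@[fun_prop]
theorem Poly.strategies {A : α → List (List ℚ)} {z : α → List ℤ} (hA : Poly A) (hz : Poly z) :
    Poly (fun a => strategies (A a) (z a)) := by
  unfold ColorfulLP.strategies
  fun_prop

end

/-- The matrix of the complementarity problem for two matrices; its rows are the columns of the
problem. -/
def blockMatrix {m n : ℕ} (P Q : Matrix (Fin m) (Fin n) ℤ) : Matrix (Fin (m + n)) (Fin (m + n)) ℤ :=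
  Matrix.of (Fin.append (fun k => Fin.append (fun _ => 0) fun j => Q k j)
    fun j => Fin.append (fun i => P i j) fun _ => 0)

section
variable {m n : ℕ} (P Q : Matrix (Fin m) (Fin n) ℤ)

theorem matrixList_eq : matrixList P = List.ofFn fun i => List.ofFn fun j => P i j := rfl

theorem columns_matrixList (P : Matrix (Fin (m + 1)) (Fin n) ℤ) :
    columns (matrixList P) = matrixList P.transpose := by
  have h : (matrixList P).headD [] = List.ofFn fun j => P 0 j := by
    rw [matrixList_eq, List.ofFn_succ]
    rfl
  rw [columns, h, zipIdx_ofFn, List.map_ofFn, matrixList_eq, matrixList_eq]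
  congr 1
  ext j : 1
  simp only [Function.comp, List.map_ofFn]
  congr 1
  ext i : 1
  simp only [Function.comp, zipIdx_ofFn, List.map_ofFn, List.sum_ofFn, decide_eq_true_eq,
    ← Fin.ext_iff, Finset.sum_ite_eq', Finset.mem_univ, if_true]
  rfl

theorem blockRows_matrixList (P Q : Matrix (Fin (m + 1)) (Fin n) ℤ) :
    blockRows (matrixList P) (matrixList Q) = matrixList (blockMatrix P Q) := by
  have h : (matrixList P).headD [] = List.ofFn fun j => P 0 j := by
    rw [matrixList_eq, List.ofFn_succ]
    rfl
  rw [blockRows, columns_matrixList, h, matrixList_eq, matrixList_eq, matrixList_eq]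
  have h2 : matrixList (blockMatrix P Q) =
      List.ofFn (Fin.append (fun k => List.ofFn (Fin.append (fun _ : Fin (m + 1) => 0) fun j => Q k j))
        fun j => List.ofFn (Fin.append (fun i => P i j) fun _ : Fin n => 0)) := by
    rw [matrixList]
    congr 1
    ext k : 1
    refine Fin.addCases (fun k => ?_) (fun k => ?_) k
    · rw [Fin.append_left]
      congr 1
      funext l
      simp [blockMatrix]
    · rw [Fin.append_right]
      congr 1
      funext l
      simp [blockMatrix]
  rw [h2, List.ofFn_fin_append]
  simp only [List.map_ofFn, Function.comp_def, List.ofFn_fin_append]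
  rfl

theorem blockMatrix_self (k : Fin (m + n)) : blockMatrix P Q k k = 0 := by
  refine Fin.addCases (fun k => ?_) (fun k => ?_) k <;> simp [blockMatrix]

theorem blockMatrix_nonneg (hP : ∀ i j, 0 < P i j) (hQ : ∀ i j, 0 < Q i j) (k l : Fin (m + n)) :
    0 ≤ blockMatrix P Q k l := by
  refine Fin.addCases (fun k => ?_) (fun k => ?_) k <;>
    refine Fin.addCases (fun l => ?_) (fun l => ?_) l <;> simp [blockMatrix, (hP _ _).le, (hQ _ _).le]

theorem exists_blockMatrix_ne_zero (hP : ∀ i j, 0 < P i j) (hQ : ∀ i j, 0 < Q i j)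
    (hm : 0 < m) (hn : 0 < n) (k : Fin (m + n)) : ∃ l, blockMatrix P Q k l ≠ 0 := by
  obtain ⟨i⟩ : Nonempty (Fin m) := ⟨⟨0, hm⟩⟩
  obtain ⟨j⟩ : Nonempty (Fin n) := ⟨⟨0, hn⟩⟩
  refine Fin.addCases (fun k => ⟨Fin.natAdd m j, ?_⟩) (fun k => ⟨Fin.castAdd n i, ?_⟩) k
  · simp [blockMatrix, (hQ _ _).ne']
  · simp [blockMatrix, (hP _ _).ne']

theorem sum_mul_blockMatrix_left (z : Fin (m + n) → ℝ) (i : Fin m) :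
    ∑ k, z k * (blockMatrix P Q k (Fin.castAdd n i) : ℝ) =
      ∑ j, (P i j : ℝ) * z (Fin.natAdd m j) := by
  rw [Fin.sum_univ_add]
  simp [blockMatrix, mul_comm]

theorem sum_mul_blockMatrix_right (z : Fin (m + n) → ℝ) (j : Fin n) :
    ∑ k, z k * (blockMatrix P Q k (Fin.natAdd m j) : ℝ) =
      ∑ i, (Q i j : ℝ) * z (Fin.castAdd n i) := by
  rw [Fin.sum_univ_add]
  simp [blockMatrix, mul_comm]

/-- Equilibria from solutions of the complementarity problem of a game. -/
theorem isNash_of_blockMatrix {A B : Matrix (Fin m) (Fin n) ℝ} {a b t : ℝ}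
    (ha : 0 < a) (hP : ∀ i j, (P i j : ℝ) = a * A i j + b)
    (hQ : ∀ i j, (Q i j : ℝ) = a * B i j + b) {z : Fin (m + n) → ℝ} (hz : ∀ k, 0 ≤ z k)
    (ht : 0 < t) (hne : ∃ k, z k ≠ 0)
    (h : ∀ i, ∑ k, z k * (blockMatrix P Q k i : ℝ) ≤ t ∧
      (z i ≠ 0 → ∑ k, z k * (blockMatrix P Q k i : ℝ) = t)) :
    IsNash A B (fun i => z (Fin.castAdd n i) / ∑ i, z (Fin.castAdd n i))
      (fun j => z (Fin.natAdd m j) / ∑ j, z (Fin.natAdd m j)) := by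
  have h1 : ∀ i, ∑ j, (P i j : ℝ) * z (Fin.natAdd m j) ≤ t ∧
      (z (Fin.castAdd n i) ≠ 0 → ∑ j, (P i j : ℝ) * z (Fin.natAdd m j) = t) := fun i => by
    rw [← sum_mul_blockMatrix_left P Q]
    exact h _
  have h2 : ∀ j, ∑ i, (Q i j : ℝ) * z (Fin.castAdd n i) ≤ t ∧
      (z (Fin.natAdd m j) ≠ 0 → ∑ i, (Q i j : ℝ) * z (Fin.castAdd n i) = t) := fun j => by
    rw [← sum_mul_blockMatrix_right P Q]
    exact h _
  have hsum : ∀ {p : ℕ} {u : Fin p → ℝ} (_ : ∀ i, 0 ≤ u i) (i : Fin p), u i ≠ 0 → 0 < ∑ i, u i :=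
    fun hu i hi => Finset.sum_pos' (fun i _ => hu i)
      ⟨i, Finset.mem_univ i, lt_of_le_of_ne (hu i) (Ne.symm hi)⟩
  -- A strategy in the support of one block has payoff t > 0 against the other block, so that block
  -- is not 0. Hence both sums can be divided by.
  have h3 : ∀ i, z (Fin.castAdd n i) ≠ 0 → ∃ j, z (Fin.natAdd m j) ≠ 0 := by
    intro i hi
    by_contra! hj
    have := (h1 i).2 hi
    simp [hj] at this
    exact ht.ne this
  have h4 : ∀ j, z (Fin.natAdd m j) ≠ 0 → ∃ i, z (Fin.castAdd n i) ≠ 0 := by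
    intro j hj
    by_contra! hi
    have := (h2 j).2 hj
    simp [hi] at this
    exact ht.ne this
  obtain ⟨⟨i, hi⟩, j, hj⟩ : (∃ i, z (Fin.castAdd n i) ≠ 0) ∧ ∃ j, z (Fin.natAdd m j) ≠ 0 := by
    obtain ⟨k, hk⟩ := hne
    revert hk
    refine Fin.addCases (fun i hi => ⟨⟨i, hi⟩, h3 i hi⟩) (fun j hj => ⟨h4 j hj, j, hj⟩) k
  exact isNash_of_complementary (P := P.map fun x : ℤ => (x : ℝ)) (Q := Q.map fun x : ℤ => (x : ℝ))
    ha hP hQ (fun i => hz _) (fun j => hz _)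
    (hsum (fun i => hz (Fin.castAdd n i)) i hi) (hsum (fun j => hz (Fin.natAdd m j)) j hj)
    (fun i => (h1 i).1) (fun i => (h1 i).2) (fun j => (h2 j).1) (fun j => (h2 j).2)

end

/-! ### Scaling -/

theorem commonDen_pos (A B : List (List ℚ)) : 0 < commonDen A B := by
  refine List.prod_pos ?_
  intro z hz
  obtain ⟨q, -, rfl⟩ := List.mem_map.1 hz
  exact_mod_cast q.den_pos

theorem scaleRat_eq {D : ℤ} {q : ℚ} (h : (q.den : ℤ) ∣ D) : (scaleRat D q : ℚ) = D * q := by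
  obtain ⟨c, rfl⟩ := h
  have hq : q * (q.den : ℚ) = q.num := Rat.mul_den_eq_num q
  rw [scaleRat, Int.mul_ediv_cancel_left _ (by exact_mod_cast q.den_ne_zero)]
  push_cast
  rw [← hq]
  ring

/-- The shift contains the square of every scaled entry x and the summand 1, and x² + x + 1 > 0.
Squares make a common shift available without computing a minimum. -/
theorem scaleRat_add_shift_pos {D : ℤ} {A B : List (List ℚ)} {q : ℚ}
    (hq : q ∈ (A ++ B).flatten) : 0 < scaleRat D q + shift D A B := by
  have h1 : scaleRat D q * scaleRat D q ≤
      ((A ++ B).flatten.map fun q => scaleRat D q * scaleRat D q).sum := by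
    refine List.single_le_sum ?_ _ (List.mem_map_of_mem (f := fun q => scaleRat D q * scaleRat D q) hq)
    intro z hz
    obtain ⟨q, -, rfl⟩ := List.mem_map.1 hz
    exact mul_self_nonneg _
  rw [shift]
  nlinarith [sq_nonneg (scaleRat D q + 1), sq_nonneg (scaleRat D q)]

/-! ### The reduction -/

section
variable {m n : ℕ}

/-- The rows of a rational matrix. -/
def ratRows (A : Matrix (Fin m) (Fin n) ℚ) : List (List ℚ) :=
  List.ofFn fun i => List.ofFn fun j => A i j

theorem mem_flatten_ratRows (A : Matrix (Fin m) (Fin n) ℚ) (i : Fin m) (j : Fin n) :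
    A i j ∈ (ratRows A).flatten :=
  List.mem_flatten.2 ⟨_, List.mem_ofFn.2 ⟨i, rfl⟩, List.mem_ofFn.2 ⟨j, rfl⟩⟩

theorem takeAs_eq {α β : Type} (l : List α) (z : List β) : takeAs l z = z.take l.length := by
  induction l generalizing z with
  | nil => rfl
  | cons a l ih =>
    cases z with
    | nil => rfl
    | cons b z => exact congrArg (b :: ·) (ih z)

theorem normalize_ofFn (r : Fin n → ℤ) :
    normalize (List.ofFn r) = List.ofFn fun i => (r i : ℚ) / ((∑ i, r i : ℤ) : ℚ) := by
  rw [normalize, List.map_ofFn, List.sum_ofFn]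
  rfl

/-- The second strategy consists of the last entries, read as the first entries of the reversed
list; the reversal does not affect their sum. -/
theorem strategies_ratRows (A : Matrix (Fin (m + 1)) (Fin n) ℚ) (r : Fin (m + 1 + n) → ℤ) :
    strategies (ratRows A) (List.ofFn r) =
      (List.ofFn fun i => (r (Fin.castAdd n i) : ℚ) / ((∑ i, r (Fin.castAdd n i) : ℤ) : ℚ),
        List.ofFn fun j => (r (Fin.natAdd (m + 1) j) : ℚ) /
          ((∑ j, r (Fin.natAdd (m + 1) j) : ℤ) : ℚ)) := by
  have h : List.ofFn r = (List.ofFn fun i => r (Fin.castAdd n i)) ++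
      List.ofFn fun j => r (Fin.natAdd (m + 1) j) := by
    rw [← List.ofFn_fin_append]
    congr 1
    exact (Fin.append_castAdd_natAdd (f := r)).symm
  have h0 : (ratRows A).headD [] = List.ofFn fun j => A 0 j := by
    rw [ratRows, List.ofFn_succ]
    rfl
  have h1 : (List.ofFn fun i => r (Fin.castAdd n i)).length = (ratRows A).length := by
    rw [ratRows, List.length_ofFn, List.length_ofFn]
  have h2 : (List.ofFn fun j => r (Fin.natAdd (m + 1) j)).reverse.length =
      (List.ofFn fun j => A 0 j).length := by
    rw [List.length_reverse, List.length_ofFn, List.length_ofFn]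
  rw [strategies, takeAs_eq, takeAs_eq, h0, h, List.reverse_append, List.take_left' h1,
    List.take_left' h2, List.reverse_reverse, normalize_ofFn, normalize_ofFn]

theorem scaleRows_ratRows (D K : ℤ) (A : Matrix (Fin m) (Fin n) ℚ) :
    scaleRows D K (ratRows A) = matrixList (Matrix.of fun i j => scaleRat D (A i j) + K) := by
  simp only [scaleRows, ratRows, List.map_ofFn, Function.comp_def]
  rfl

theorem intCast_scaleRat_add {D K : ℤ} {q : ℚ} (h : (q.den : ℤ) ∣ D) :
    ((scaleRat D q + K : ℤ) : ℝ) = D * (q : ℝ) + K := by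
  have := congrArg (fun x : ℚ => (x : ℝ)) (scaleRat_eq h)
  push_cast at this ⊢
  rw [this]

theorem exists_columnWeights_of_two_le {N : ℕ} {O : Data → Bool} (hO : Decides O colorfulLP)
    (hN : 2 ≤ N) (C : Matrix (Fin N) (Fin N) ℤ) (hC : ∀ k i, 0 ≤ C k i) (hdiag : ∀ k, C k k = 0)
    (hne : ∀ k, ∃ i, C k i ≠ 0) : ∃ (r : Fin N → ℤ) (z : Fin N → ℝ) (s t : ℝ),
      columnWeights (matrixList C) (minimalPoints O (matrixList C)) = List.ofFn r ∧
      s ≠ 0 ∧ (∀ k, (r k : ℝ) = s * z k) ∧ (∀ k, 0 ≤ z k) ∧ 0 < t ∧ (∃ k, z k ≠ 0) ∧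
      ∀ i, ∑ k, z k * C k i ≤ t ∧ (z i ≠ 0 → ∑ k, z k * C k i = t) := by
  obtain ⟨d, rfl⟩ : ∃ d, N = d + 1 := ⟨N - 1, by omega⟩
  exact exists_columnWeights hO (by omega) C hC hdiag hne

/-- A common denominator and a common shift make all payoffs positive integers without changing the
equilibria. Positivity yields what the complementarity problem needs: nonnegative entries and no
zero column. -/
theorem exists_strategies {O : Data → Bool} (hO : Decides O colorfulLP)
    (A B : Matrix (Fin (m + 1)) (Fin (n + 1)) ℚ) :
    ∃ s : (Fin (m + 1) → ℚ) × (Fin (n + 1) → ℚ),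
      strategies (ratRows A) (columnWeights (gameRows (ratRows A) (ratRows B))
        (minimalPoints O (gameRows (ratRows A) (ratRows B)))) =
          (List.ofFn s.1, List.ofFn s.2) ∧
      IsNash (A.map (fun q : ℚ => (q : ℝ))) (B.map (fun q : ℚ => (q : ℝ)))
        (fun i => (s.1 i : ℝ)) (fun j => (s.2 j : ℝ)) := by
  obtain ⟨D, hD⟩ : ∃ D, D = commonDen (ratRows A) (ratRows B) := ⟨_, rfl⟩
  obtain ⟨K, hK⟩ : ∃ K, K = shift D (ratRows A) (ratRows B) := ⟨_, rfl⟩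
  have hmemA : ∀ i j, A i j ∈ (ratRows A ++ ratRows B).flatten := fun i j => by
    rw [List.flatten_append]
    exact List.mem_append_left _ (mem_flatten_ratRows A i j)
  have hmemB : ∀ i j, B i j ∈ (ratRows A ++ ratRows B).flatten := fun i j => by
    rw [List.flatten_append]
    exact List.mem_append_right _ (mem_flatten_ratRows B i j)
  have hdvd : ∀ q ∈ (ratRows A ++ ratRows B).flatten, (q.den : ℤ) ∣ D := fun q hq => by
    rw [hD]
    exact List.dvd_prod (List.mem_map_of_mem (f := fun q : ℚ => (q.den : ℤ)) hq)
  have hpos : ∀ q ∈ (ratRows A ++ ratRows B).flatten, 0 < scaleRat D q + K := fun q hq => by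
    rw [hK]
    exact scaleRat_add_shift_pos hq
  rw [gameRows, ← hD, ← hK, scaleRows_ratRows, scaleRows_ratRows, blockRows_matrixList]
  set P : Matrix (Fin (m + 1)) (Fin (n + 1)) ℤ := Matrix.of fun i j => scaleRat D (A i j) + K
  set Q : Matrix (Fin (m + 1)) (Fin (n + 1)) ℤ := Matrix.of fun i j => scaleRat D (B i j) + K
  have hP : ∀ i j, 0 < P i j := fun i j => hpos _ (hmemA i j)
  have hQ : ∀ i j, 0 < Q i j := fun i j => hpos _ (hmemB i j)
  obtain ⟨r, z, s, t, hr, hs, hrz, hz, ht, hne, h⟩ := exists_columnWeights_of_two_le hO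
    (by omega) (blockMatrix P Q) (blockMatrix_nonneg P Q hP hQ) (blockMatrix_self P Q)
    (exists_blockMatrix_ne_zero P Q hP hQ (by omega) (by omega))
  have hnash := isNash_of_blockMatrix P Q (A := A.map fun q : ℚ => (q : ℝ))
    (B := B.map fun q : ℚ => (q : ℝ)) (a := D) (b := K)
    (by rw [hD]; exact_mod_cast commonDen_pos _ _)
    (fun i j => intCast_scaleRat_add (hdvd _ (hmemA i j)))
    (fun i j => intCast_scaleRat_add (hdvd _ (hmemB i j))) hz ht hne h
  -- The unknown factor s cancels in each quotient, whatever its sign.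
  have hdiv : ∀ {p : ℕ} (e : Fin p → Fin (m + 1 + (n + 1))) (i : Fin p),
      (((r (e i) : ℚ) / ((∑ i, r (e i) : ℤ) : ℚ) : ℚ) : ℝ) = z (e i) / ∑ i, z (e i) := by
    intro p e i
    push_cast
    simp only [hrz, ← Finset.mul_sum]
    exact mul_div_mul_left _ _ hs
  refine ⟨(fun i => (r (Fin.castAdd (n + 1) i) : ℚ) /
      ((∑ i, r (Fin.castAdd (n + 1) i) : ℤ) : ℚ), fun j => (r (Fin.natAdd (m + 1) j) : ℚ) /
      ((∑ j, r (Fin.natAdd (m + 1) j) : ℤ) : ℚ)), (congrArg (strategies (ratRows A)) hr).trans (strategies_ratRows A r), ?_⟩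
  simp only [hdiv]
  exact hnash

end

/-- The encoded dimensions are ignored: the program reads them off the rows, which works because m
is positive and a first row exists. -/
theorem polyReducible_bimatrix : PolyReducible bimatrix colorfulLP := by
  have h1 : Poly (fun x : (ℤ × ℤ) × List (List ℚ) × List (List ℚ) => gameRows x.2.1 x.2.2) := by
    fun_prop
  have h2 : Poly (fun x : (ℤ × ℤ) × List (List ℚ) × List (List ℚ) => x.2.1) := by fun_prop
  have h3 : Poly (fun x : List (List ℚ) × List ℤ => strategies x.1 x.2) := by fun_prop
  obtain ⟨q, c, p, h⟩ := h3.polyO.comp (h2.polyO.pair (polyO_columnWeights.comp h1.polyO))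
  refine ⟨c, p, fun O hO (I : BimatrixInstance) => ?_⟩
  obtain ⟨m, n, hm, hn, A, B⟩ := I
  obtain ⟨m, rfl⟩ : ∃ m', m = m' + 1 := ⟨m - 1, by omega⟩
  obtain ⟨n, rfl⟩ : ∃ n', n = n' + 1 := ⟨n - 1, by omega⟩
  have henc : bimatrix.enc (⟨m + 1, n + 1, hm, hn, A, B⟩ : BimatrixInstance) =
      enc ((((m + 1 : ℕ) : ℤ), ((n + 1 : ℕ) : ℤ)), (ratRows A, ratRows B)) := by
    have hM : ∀ M : Matrix (Fin (m + 1)) (Fin (n + 1)) ℚ, encMatrix M = enc (ratRows M) :=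
      fun M => encFamily_eq _ (fun r : Fin (n + 1) → ℚ => List.ofFn r) (fun _ => rfl) _
    show Data.node _ (.node (encMatrix A) (encMatrix B)) = _
    rw [hM, hM]
    rfl
  obtain ⟨s, hs, hnash⟩ := exists_strategies hO A B
  obtain ⟨t, h4, h5⟩ := h O ((((m + 1 : ℕ) : ℤ), ((n + 1 : ℕ) : ℤ)), (ratRows A, ratRows B))
  refine ⟨s, t, q O ((((m + 1 : ℕ) : ℤ), ((n + 1 : ℕ) : ℤ)), (ratRows A, ratRows B)), ?_, hnash, ?_⟩
  · beta_reduce at h4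
    rw [hs, ← henc] at h4
    exact h4
  · rw [bits, ← henc] at h5
    exact h5

end ColorfulLP

theorem mainTheorem4 :
    (∃ (c : ColorfulLP.Code) (p : Polynomial ℕ), ∀ O : ColorfulLP.Data → Bool,
      ColorfulLP.Decides O ColorfulLP.colorfulLP → ∀ I : ColorfulLP.AnotherInstance,
        ColorfulLP.IsPDCS I.config (I.output O) ∧ I.output O ≠ I.T ∧
        (I.queries O).length = I.d + 1 ∧
        ∃ t : ℕ, ColorfulLP.Runs O c I.enc (ColorfulLP.encSelection (I.output O)) t (I.queries O) ∧
          t ≤ p.eval I.enc.size) ∧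
    ColorfulLP.PolyReducible ColorfulLP.bimatrix ColorfulLP.colorfulLP ∧
    ColorfulLP.PolyReducible ColorfulLP.colorfulLPTFNP ColorfulLP.colorfulLP := 
  ⟨ColorfulLP.another_program, ColorfulLP.polyReducible_bimatrix, ColorfulLP.polyReducible_tfnp⟩
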